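/- Let $p$ be a prime, $q=p^a$ with $a\ge 1$ (the cardinality of the residue field of a finite extension of $\mathbb{Q}_p$), let $\Bbbk$ be an algebraically closed field of characteristic $\ell\neq p$, $\ell\ge 0$, with $q\not\equiv 1 \bmod \ell$, fix a square root $q^{1/2}\in\Bbbk$, and let $n\geq 2$. Let $\mathrm{W}=\mathfrak{S}_n\ltimes\mathfrak{X}$ be the extended affine Weyl group of $\mathrm{GL}_n$, where $\mathfrak{X}$ is the free abelian multiplicative group on $X_1,\dots,X_n$, permuted by $\mathfrak{S}_n$. Let $\mathbb{I}=\{s_1,\dots,s_{n-1}\}$ be the set of simple transpositions, $s_0=s_{n-1}\cdots s_2s_1s_2\cdots s_{n-1}X_1X_n^{-1}$ and $\tau=s_{n-1}\cdots s_1X_1$. Every $w\in\mathrm{W}$ is of the form $x\tau^j$ with $j\in\mathbb{Z}$ and $x$ in the subgroup generated by $s_0,\dots,s_{n-1}$; the length $\ell(w)$ is the least $r$ such that $x$ is a product of $r$ of the $s_i$. For $J,K\subseteq\mathbb{I}$ let $\mathrm{W}_J=\langle J\rangle$, and let $D_{K,J}$ be the set of shortest double coset representatives in $\mathrm{W}_K\backslash\mathrm{W}/\mathrm{W}_J$.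 For $L\subseteq K$ let $D^K_{\emptyset,L}\subseteq \mathrm{W}_K$ be the set of shortest coset representatives in $\mathrm{W}_K/\mathrm{W}_L$. For $d\in D_{K,J}$ put $K\cap dJ=\{s\in K\mid d^{-1}sd\in J\}$. Let $\mathcal{H}$ be the unital $\Bbbk$-algebra generated by $T_1,\dots,T_{n-1},X_1^{\pm1},\dots,X_n^{\pm1}$ with relations: $(T_i-q)(T_i+1)=0$; $T_iT_j=T_jT_i$ for $|i-j|>1$; $T_iT_{i+1}T_i=T_{i+1}T_iT_{i+1}$; $X_jX_j^{-1}=1=X_j^{-1}X_j$; $X_iX_j=X_jX_i$; $T_iX_j=X_jT_i$ for $j\ne i,i+1$; $T_iX_iT_i=qX_{i+1}$. Put $T_{s_i}=T_i$ for $1\le i\le n-1$, $T_{s_0}=q^{n-1}X_1^{-1}X_n(T_{n-1}\cdots T_2T_1T_2\cdots T_{n-1})^{-1}$ and $T_\tau=q^{-(n-1)/2}T_{n-1}\cdots T_1X_1$, and for $w\in\mathrm{W}$ with reduced expression $w=s_{i_1}\cdots s_{i_r}\tau^j$ put $T_w=T_{s_{i_1}}\cdots T_{s_{i_r}}T_\tau^j$.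 Let $\mathbf{v}_J=\sum_{w\in\mathrm{W}_J}T_w$ and let $$\mathcal{S}=\mathrm{End}_{\mathcal{H}}\Big(\bigoplus_{J\subseteq\mathbb{I}}\mathbf{v}_J\mathcal{H}\Big)$$ be the affine Schur algebra (endomorphisms of right $\mathcal{H}$-modules). Let $U=\sum_{i=1}^{n-1}\mathcal{H}(T_i-q)$, consider the left $\mathcal{H}$-module $\mathcal{H}/U$, and let $\mathbf{v}\in\mathcal{H}/U$ be the class of $1$. Let $$\mathbb{P}(\mathcal{S})=\bigoplus_{K\subseteq\mathbb{I}}\Bbbk[X_1^{\pm1},\dots,X_n^{\pm1}]^{\mathrm{W}_K}\,\mathbf{v}^{(K)},$$ where $\mathrm{W}_K$ permutes the variables and $\mathbf{v}^{(K)}$ is a copy of $\mathbf{v}$, the superscript being a formal index. Then the following hold. 1. The map $f\mapsto f\mathbf{v}$ is a bijection from $\Bbbk[X_1^{\pm1},\dots,X_n^{\pm1}]$ onto $\mathcal{H}/U$. In this way $\mathcal{H}$ acts on $\Bbbk[X_1^{\pm1},\dots,X_n^{\pm1}]\mathbf{v}$. 2. For all $J,K\subseteq\mathbb{I}$ and $d\in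 D_{K,J}$ there is a unique homomorphism of right $\mathcal{H}$-modules $\mathbf{b}^d_{K,J}:\mathbf{v}_J\mathcal{H}\to\mathbf{v}_K\mathcal{H}$ with $\mathbf{b}^d_{K,J}(\mathbf{v}_J)=\sum_{w\in\mathrm{W}_Kd\mathrm{W}_J}T_w$. Extended by zero, it is an element of $\mathcal{S}$ (the standard basis element labelled by $K,J,d$). 3. There is a faithful representation $\rho$ of the $\Bbbk$-algebra $\mathcal{S}$ on $\mathbb{P}(\mathcal{S})$ such that, for all $J,K\subseteq\mathbb{I}$, $d\in D_{K,J}$ and $f\in\Bbbk[X_1^{\pm1},\dots,X_n^{\pm1}]^{\mathrm{W}_J}$, $$\rho(\mathbf{b}^d_{K,J})\,f\mathbf{v}^{(J)}=\sum_{a\in D^K_{\emptyset,K\cap dJ}}T_aT_d\,f\,\mathbf{v}^{(K)},$$ where the right-hand side is computed in $\mathcal{H}/U=\Bbbk[X_1^{\pm1},\dots,X_n^{\pm1}]\mathbf{v}$, lies in $\Bbbk[X_1^{\pm1},\dots,X_n^{\pm1}]^{\mathrm{W}_K}\mathbf{v}$, and is placed in the summand of index $K$; and $\rho(\mathbf{b}^d_{K,J})$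 vanishes on the summands of index different from $J$. -/

import Mathlib

/- Throughout, `n = m + 1`. The simple reflections `s_1, …, s_{n-1}` are indexed by `Fin m`
(so `i : Fin m` stands for `s_{i+1}`, which swaps the positions `i.castSucc` and `i.succ`), and
`X_1, …, X_n` are indexed by `Fin (m + 1)`. A subset of `𝕀 = {s_1, …, s_{n-1}}` is a
`Finset (Fin m)`. -/

namespace AffSchur

noncomputable section

/-! ### The extended affine Weyl group -/

/-- The free abelian group `𝔛` on `X_1, …, X_n`, written multiplicatively: `X_1^{a_1} ⋯ X_n^{a_n}`
is the function `j ↦ a_j`. -/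
abbrev Lattice (m : ℕ) : Type := Fin (m + 1) → Multiplicative ℤ

/-- The extended affine Weyl group `W = 𝔖 ⋉ 𝔛`, where `σ X_j σ⁻¹ = X_{σ j}`. -/
abbrev W (m : ℕ) : Type :=
  Lattice m ⋊[(mulAutArrow : Equiv.Perm (Fin (m + 1)) →* MulAut (Lattice m))]
    Equiv.Perm (Fin (m + 1))

variable {m : ℕ}

/-- The element `X_j` of `W`. -/
def X (j : Fin (m + 1)) : W m :=
  SemidirectProduct.inl (Pi.mulSingle j (Multiplicative.ofAdd 1))

/-- The finite simple reflections `s_1, …, s_{n-1}`. -/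
def s (i : Fin m) : W m := SemidirectProduct.inr (Equiv.swap i.castSucc i.succ)

/-- `τ = s_{n-1} ⋯ s_1 X_1`. -/
def tau (m : ℕ) : W m := (List.ofFn (s (m := m))).reverse.prod * X 0

/-- `s_0 = s_{n-1} ⋯ s_2 s_1 s_2 ⋯ s_{n-1} X_1 X_n⁻¹`. -/
def s0 (m : ℕ) : W m :=
  (List.ofFn (s (m := m))).reverse.prod * (List.ofFn (s (m := m))).tail.prod
    * (X 0 * (X (Fin.last m))⁻¹)

/-- All simple reflections `s_0, s_1, …, s_{n-1}`; here the index `0` stands for `s_0`, and the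
index `i.succ` stands for the `i`-th finite simple reflection. -/
def sAff : Fin (m + 1) → W m := Fin.cases (s0 m) s

/-- `w = s_{i_1} ⋯ s_{i_r} τ^j`, where `e = ([i_1, …, i_r], j)`. -/
def IsExpr (w : W m) (e : List (Fin (m + 1)) × ℤ) : Prop :=
  w = (e.1.map sAff).prod * tau m ^ e.2

/-- The length of `w = x τ^j`: the least `r` such that `x` is a product of `r` simple
reflections. -/
def length (w : W m) : ℕ :=
  sInf {r | ∃ e : List (Fin (m + 1)) × ℤ, IsExpr w e ∧ e.1.length = r}

/-- The standard parabolic subgroup `W_J`, for `J ⊆ 𝕀`. -/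
def parabolic (J : Finset (Fin m)) : Subgroup (W m) := Subgroup.closure (s '' (J : Set (Fin m)))

/-- The double coset `W_K w W_J`. -/
def dcoset (K J : Finset (Fin m)) (w : W m) : Set (W m) :=
  DoubleCoset.doubleCoset w (parabolic K : Set (W m)) (parabolic J : Set (W m))

/-- `D_{K,J}`: the shortest double coset representatives in `W_K \ W / W_J`. -/
def D (K J : Finset (Fin m)) : Set (W m) := {d | ∀ w ∈ dcoset K J d, length d ≤ length w}

/-- `D^K_{J₁,J₂}`: the shortest double coset representatives in `W_{J₁} \ W_K / W_{J₂}`, for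
`J₁, J₂ ⊆ K`. -/
def DIn (K J₁ J₂ : Finset (Fin m)) : Set (W m) := {a | a ∈ parabolic K ∧ a ∈ D J₁ J₂}

open Classical in
/-- `K ∩ dJ = {s ∈ K | d⁻¹ s d ∈ J}`. -/
def interConj (K : Finset (Fin m)) (d : W m) (J : Finset (Fin m)) : Finset (Fin m) :=
  K.filter fun i => ∃ j ∈ J, d⁻¹ * s i * d = s j

/-! ### The Hecke algebra -/

/-- Generators of the Hecke algebra; `Xinv j` stands for `X_j⁻¹`. -/
inductive Gen (m : ℕ) : Type
  | T (i : Fin m) : Gen m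
  | X (j : Fin (m + 1)) : Gen m
  | Xinv (j : Fin (m + 1)) : Gen m

section Hecke

variable {k : Type*} [Field k]

/-- A generator, as an element of the free algebra. -/
abbrev gen (k : Type*) [Field k] (g : Gen m) : FreeAlgebra k (Gen m) := FreeAlgebra.ι k g

/-- Bernstein's defining relations of the Hecke algebra. -/
inductive Rel (q : k) (m : ℕ) : FreeAlgebra k (Gen m) → FreeAlgebra k (Gen m) → Prop
  | quad (i : Fin m) :
      Rel q m ((gen k (.T i) - algebraMap k _ q) * (gen k (.T i) + 1)) 0
  | comm (i j : Fin m) (h : (i : ℕ) + 1 < j ∨ (j : ℕ) + 1 < i) :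
      Rel q m (gen k (.T i) * gen k (.T j)) (gen k (.T j) * gen k (.T i))
  | braid (i j : Fin m) (h : (j : ℕ) = i + 1) :
      Rel q m (gen k (.T i) * gen k (.T j) * gen k (.T i))
        (gen k (.T j) * gen k (.T i) * gen k (.T j))
  | mul_inv (j : Fin (m + 1)) : Rel q m (gen k (.X j) * gen k (.Xinv j)) 1
  | inv_mul (j : Fin (m + 1)) : Rel q m (gen k (.Xinv j) * gen k (.X j)) 1
  | X_comm (i j : Fin (m + 1)) :
      Rel q m (gen k (.X i) * gen k (.X j)) (gen k (.X j) * gen k (.X i))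
  | T_X_comm (i : Fin m) (j : Fin (m + 1)) (h₁ : j ≠ i.castSucc) (h₂ : j ≠ i.succ) :
      Rel q m (gen k (.T i) * gen k (.X j)) (gen k (.X j) * gen k (.T i))
  | T_X_T (i : Fin m) :
      Rel q m (gen k (.T i) * gen k (.X i.castSucc) * gen k (.T i))
        (algebraMap k _ q * gen k (.X i.succ))

/-- The Iwahori-Matsumoto Hecke algebra `ℋ = ℋ_n` (in Bernstein's presentation), `n = m + 1`. -/
def Hecke (q : k) (m : ℕ) : Type _ := RingQuot (Rel q m)

instance (q : k) (m : ℕ) : Ring (Hecke q m) := inferInstanceAs (Ring (RingQuot (Rel q m)))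

instance (q : k) (m : ℕ) : Algebra k (Hecke q m) :=
  inferInstanceAs (Algebra k (RingQuot (Rel q m)))

/-- The quotient map from the free algebra onto `ℋ`. -/
def toHecke (q : k) (m : ℕ) : FreeAlgebra k (Gen m) →ₐ[k] Hecke q m :=
  RingQuot.mkAlgHom k (Rel q m)

theorem toHecke_rel {q : k} {a b : FreeAlgebra k (Gen m)} (h : Rel q m a b) :
    toHecke q m a = toHecke q m b :=
  RingQuot.mkAlgHom_rel k h

/-- The generator `T_i` of `ℋ`. -/
def T (q : k) (i : Fin m) : Hecke q m := toHecke q m (gen k (.T i))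

/-- The generator `X_j` of `ℋ`, as a unit with inverse the generator `X_j⁻¹`. -/
def XH (q : k) (j : Fin (m + 1)) : (Hecke q m)ˣ where
  val := toHecke q m (gen k (.X j))
  inv := toHecke q m (gen k (.Xinv j))
  val_inv := by rw [← map_mul, toHecke_rel (.mul_inv j), map_one]
  inv_val := by rw [← map_mul, toHecke_rel (.inv_mul j), map_one]

theorem XH_commute (q : k) (i j : Fin (m + 1)) : Commute (XH q i) (XH q j) := by
  apply Units.ext
  change toHecke q m _ * toHecke q m _ = toHecke q m _ * toHecke q m _
  rw [← map_mul, toHecke_rel (.X_comm i j), map_mul]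

/-- The image in `ℋ` of the element `T_τ = q^{-(n-1)/2} T_{n-1} ⋯ T_1 X_1` of the Iwahori-Matsumoto
presentation; `r` is a square root of `q`. -/
def Ttau (q r : k) (m : ℕ) : Hecke q m :=
  (r ^ m)⁻¹ • ((List.ofFn (T (m := m) q)).reverse.prod * (XH q 0 : (Hecke q m)ˣ))

/-- `T_τ^j` for an integer `j`. -/
def TtauPow (q r : k) (m : ℕ) : ℤ → Hecke q m
  | .ofNat a => Ttau q r m ^ a
  | .negSucc a => Ring.inverse (Ttau q r m) ^ (a + 1)

/-- The image in `ℋ` of the element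
`T_{s_0} = q^{n-1} X_1⁻¹ X_n (T_{n-1} ⋯ T_2 T_1 T_2 ⋯ T_{n-1})⁻¹` of the Iwahori-Matsumoto
presentation. -/
def T0 (q : k) (m : ℕ) : Hecke q m :=
  q ^ m • (((XH q 0)⁻¹ * XH q (Fin.last m) : (Hecke q m)ˣ)
    * Ring.inverse
        ((List.ofFn (T (m := m) q)).reverse.prod * (List.ofFn (T (m := m) q)).tail.prod))

/-- `T_{s_0}, T_{s_1}, …, T_{s_{n-1}}`, indexed as in `sAff`. -/
def TAff (q : k) : Fin (m + 1) → Hecke q m := Fin.cases (T0 q m) (T q)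

/-- A reduced expression of `w`: one that attains the length of `w`. -/
def reducedExpr (w : W m) : List (Fin (m + 1)) × ℤ :=
  Classical.epsilon fun e => IsExpr w e ∧ e.1.length = length w

/-- `T_w = T_{s_{i_1}} ⋯ T_{s_{i_r}} T_τ^j` for a reduced expression `w = s_{i_1} ⋯ s_{i_r} τ^j`
(every `w` has one, and the braid relations make the product independent of the one chosen). -/
def Tw (q r : k) (w : W m) : Hecke q m :=
  ((reducedExpr w).1.map (TAff q)).prod * TtauPow q r m (reducedExpr w).2

/-! ### The right ideals `v_J ℋ` and the affine Schur algebra -/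

/-- `v_J = ∑_{w ∈ W_J} T_w`. -/
def v (q r : k) (J : Finset (Fin m)) : Hecke q m := ∑ᶠ w ∈ (parabolic J : Set (W m)), Tw q r w

/-- The right ideal `v_J ℋ`. A right `ℋ`-module is a module over `ℋᵐᵒᵖ`. -/
def vIdeal (q r : k) (J : Finset (Fin m)) : Submodule (Hecke q m)ᵐᵒᵖ (Hecke q m) :=
  Submodule.span _ {v q r J}

/-- `v_J`, as an element of `v_J ℋ`. -/
def vGen (q r : k) (J : Finset (Fin m)) : vIdeal q r J :=
  ⟨v q r J, Submodule.mem_span_singleton_self _⟩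

/-- The affine Schur algebra `𝒮 = End_ℋ(⨁_{J ⊆ 𝕀} v_J ℋ)`; the finite direct sum is written as a
product. -/
abbrev Schur (q r : k) (m : ℕ) : Type _ :=
  Module.End (Hecke q m)ᵐᵒᵖ (∀ J : Finset (Fin m), vIdeal q r J)

/-- The element of `𝒮` that a homomorphism `v_J ℋ → v_K ℋ` of right `ℋ`-modules gives by extension
by zero. -/
def ofHom {q r : k} {J K : Finset (Fin m)}
    (φ : vIdeal q r J →ₗ[(Hecke q m)ᵐᵒᵖ] vIdeal q r K) : Schur q r m :=
  LinearMap.single _ (fun L : Finset (Fin m) => vIdeal q r L) K ∘ₗ φ ∘ₗ LinearMap.proj J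

/-- `φ : v_J ℋ → v_K ℋ` is the homomorphism `b^d_{K,J}`: it sends `v_J` to
`∑_{w ∈ W_K d W_J} T_w`. -/
def IsB {q r : k} {J K : Finset (Fin m)} (d : W m)
    (φ : vIdeal q r J →ₗ[(Hecke q m)ᵐᵒᵖ] vIdeal q r K) : Prop :=
  (φ (vGen q r J) : Hecke q m) = ∑ᶠ w ∈ dcoset K J d, Tw q r w

/-! ### The representation spaces -/

/-- The Laurent polynomial ring `k[X_1^{±1}, …, X_n^{±1}]`. -/
abbrev Laurent (k : Type*) [Field k] (m : ℕ) : Type _ := MonoidAlgebra k (Lattice m)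

/-- The permutation action of `𝔖` on Laurent polynomials, `σ X_j = X_{σ j}`. -/
def permAct (k : Type*) [Field k] (σ : Equiv.Perm (Fin (m + 1))) : Laurent k m ≃ₐ[k] Laurent k m :=
  MonoidAlgebra.domCongr k k (mulAutArrow σ)

/-- The invariants `k[X_1^{±1}, …, X_n^{±1}]^{W_K}`. -/
def Inv (k : Type*) [Field k] (K : Finset (Fin m)) : Submodule k (Laurent k m) where
  carrier := {f | ∀ w ∈ parabolic K, permAct k w.right f = f}
  add_mem' ha hb w hw := by rw [map_add, ha w hw, hb w hw]
  zero_mem' w _ := map_zero _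
  smul_mem' c f hf w hw := by rw [map_smul, hf w hw]

/-- `ℙ(𝒮) = ⨁_{K ⊆ 𝕀} k[X_1^{±1}, …, X_n^{±1}]^{W_K} v^{(K)}`; an element is the family of the
coefficients of the formal symbols `v^{(K)}`. -/
abbrev PS (k : Type*) [Field k] (m : ℕ) : Type _ := ∀ K : Finset (Fin m), Inv k K

open Classical in
/-- The element `f v^{(J)}` of `ℙ(𝒮)`. -/
def single {J : Finset (Fin m)} (f : Inv k J) : PS k m := Pi.single J f

/-- The left ideal `U = ∑_i ℋ (T_i - q)`. -/
def U (q : k) (m : ℕ) : Submodule (Hecke q m) (Hecke q m) :=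
  Submodule.span _ (Set.range fun i : Fin m => T q i - algebraMap k _ q)

/-- The left `ℋ`-module `ℙ(ℋ) = ℋ / U`. -/
abbrev PH (q : k) (m : ℕ) : Type _ := Hecke q m ⧸ U q m

/-- The homomorphism `𝔛 → ℋˣ`, `X_1^{a_1} ⋯ X_n^{a_n} ↦ X_1^{a_1} ⋯ X_n^{a_n}`. -/
def latticeToHecke (q : k) (m : ℕ) : Lattice m →* (Hecke q m)ˣ :=
  MonoidHom.noncommPiCoprod (fun j => zpowersHom _ (XH q j)) fun i j _ _ _ =>
    (XH_commute q i j).zpow_zpow _ _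

/-- The map `k[X_1^{±1}, …, X_n^{±1}] → ℋ`. -/
def laurentToHecke (q : k) (m : ℕ) : Laurent k m →ₐ[k] Hecke q m :=
  MonoidAlgebra.lift k (Hecke q m) (Lattice m) ((Units.coeHom _).comp (latticeToHecke q m))

/-- The map `f ↦ f v` from Laurent polynomials to `ℙ(ℋ)`, where `v` is the class of `1`. -/
def mulV (q : k) (m : ℕ) : Laurent k m →ₗ[k] PH q m :=
  (U q m).mkQ.restrictScalars k ∘ₗ (laurentToHecke q m).toLinearMap

end Hecke

end

end AffSchur

/-! Write v_𝕀 for `v q r Finset.univ`. The point is to realise ℙ(𝒮) inside ⨁_J v_J ℋ, on which 𝒮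
already acts, by f v^{(J)} ↦ f v_𝕀 in the summand J. The image is the space of all x with x T_i = q
x for every i. Elements of 𝒮 commute with right multiplication, so they preserve this space, and 𝒮
acts on ℙ(𝒮) by restriction.

Three facts identify the image. A solution of x T_i = q x in ℋ is of the form f v_𝕀 with f a Laurent
polynomial, by comparing coefficients in the basis X^λ T_w (`exists_eq_mul_v_univ`). If f is
W_J-invariant then f commutes with v_J, and v_𝕀 ∈ v_J ℋ, so f v_𝕀 ∈ v_J ℋ. Conversely, f v_𝕀 ∈ v_J ℋ
forces T_j f v_𝕀 = q f v_𝕀 for j ∈ J, and Bernstein's relation turns this into (X_{j+1} - q X_j)(f -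
s_j f) = 0 in a domain.

For the formula, lengths add in the factorisation w = a d b of the elements of W_K d W_J, so
b^d_{K,J}(v_J) = h v_J with h = ∑ T_a T_d. With v_𝕀 = v_J y one gets f v_𝕀 = v_J f y, which goes to
h v_J f y = h f v_𝕀. The isomorphism ℋ/U ≅ ℋ v_𝕀, x ↦ x v_𝕀, reads this in ℋ/U (`mem_U_iff`).

For faithfulness, each v_J g v_𝕀 lies in the image of ℙ(𝒮). If φ acts by zero, then φ(v_J) g v_𝕀 = 0
for all g, so each component of φ(v_J) kills all Laurent polynomials. It vanishes because the
Demazure-Lusztig representation of ℋ is faithful: the operators T_w are triangular in the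
permutations of the variables, which are linearly independent over the rational functions.

The elements T_w rest on Coxeter theory for W, obtained from its action on ℤ by affine permutations:
exchange property, Matsumoto's theorem, minimal coset representatives. Relations involving s_0 or
T_{s_0} are transported from finite ones by conjugation with τ. -/

namespace AffSchur
noncomputable section
variable {m : ℕ}

/-! ### Bernstein relations in a group -/

section BernsteinRelations

variable {G : Type*} [Group G]

/-- The product `t_{j-1} ⋯ t_0`. -/
def descProd (t : ℕ → G) : ℕ → G
  | 0 => 1
  | j + 1 => t j * descProd t j

/-- The product `t_0 ⋯ t_{j-1}`. -/
def ascProd (t : ℕ → G) : ℕ → G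
  | 0 => 1
  | j + 1 => ascProd t j * t j

/-- The braid and Bernstein relations, without the quadratic ones, between elements `t_0, …, t_{m-1}`
and `x_0, …, x_m` of a group. -/
structure BernsteinRel (m : ℕ) (t x : ℕ → G) (z : G) : Prop where
  comm : ∀ i j, i + 1 < j → j < m → t i * t j = t j * t i
  braid : ∀ i, i + 1 < m → t i * t (i + 1) * t i = t (i + 1) * t i * t (i + 1)
  xcomm : ∀ i j, i ≤ m → j ≤ m → x i * x j = x j * x i
  txcomm : ∀ i j, i < m → j ≤ m → j ≠ i → j ≠ i + 1 → t i * x j = x j * t i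
  txt : ∀ i, i < m → t i * x i * t i = z * x (i + 1)
  central : ∀ g, z * g = g * z

namespace BernsteinRel

variable {t x : ℕ → G} {z : G} (h : BernsteinRel m t x z)
include h

theorem descProd_comm {i j : ℕ} (hj : j < i) (hi : i < m) :
    descProd t j * t i = t i * descProd t j := by
  induction j with
  | zero => simp [descProd]
  | succ j ih =>
    rw [descProd, mul_assoc, ih (by omega), ← mul_assoc, h.comm j i (by omega) hi, mul_assoc]

/-- The factor t_{i+1} moves left until it meets t_{i+1} t_i; the braid relation replaces it there
by a t_i on the left, which commutes with the remaining factors. -/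
theorem descProd_mul {i j : ℕ} (hij : i + 1 < j) (hj : j ≤ m) :
    descProd t j * t (i + 1) = t i * descProd t j := by
  induction j with
  | zero => omega
  | succ j ih =>
    rcases Nat.lt_or_ge (i + 1) j with h1 | h1
    · rw [descProd, mul_assoc, ih h1 (by omega), ← mul_assoc, ← h.comm i j (by omega) (by omega),
        mul_assoc]
    · obtain rfl : j = i + 1 := by omega
      rw [descProd, descProd, mul_assoc, mul_assoc, h.descProd_comm (by omega) (by omega)]
      simp only [← mul_assoc]
      rw [h.braid i (by omega)]

/-- Cancelling t_0 leaves t_j ⋯ t_1, and passing through the full product lowers every index by one.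
-/
theorem descProd_mul_descProd {j : ℕ} (hj : j + 1 ≤ m) :
    descProd t m * (descProd t (j + 1) * (t 0)⁻¹) = descProd t j * descProd t m := by
  induction j with
  | zero => simp [descProd]
  | succ j ih =>
    rw [descProd, mul_assoc (t (j + 1)), ← mul_assoc, h.descProd_mul (by omega) le_rfl, mul_assoc,
      ih (by omega), ← mul_assoc, ← descProd]

theorem descProd_x_zero {j : ℕ} (hj : j + 1 ≤ m) :
    x 0 * (descProd t (j + 1) * (t 0)⁻¹) = descProd t (j + 1) * (t 0)⁻¹ * x 0 := by
  induction j with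
  | zero => simp [descProd]
  | succ j ih =>
    rw [descProd, mul_assoc (t (j + 1)), ← mul_assoc,
      ← h.txcomm (j + 1) 0 (by omega) (by omega) (by omega) (by omega), mul_assoc, ih (by omega),
      ← mul_assoc]

theorem descProd_x_ascProd {j : ℕ} (hj : j ≤ m) :
    descProd t j * x 0 * ascProd t j = z ^ j * x j := by
  induction j with
  | zero => simp [descProd, ascProd]
  | succ j ih =>
    have hz : t j * z ^ j = z ^ j * t j := (Commute.pow_left (h.central (t j)) j).eq.symm
    calc _ = t j * (descProd t j * x 0 * ascProd t j) * t j := by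
          simp only [descProd, ascProd, mul_assoc]
      _ = z ^ j * (t j * x j * t j) := by
          rw [ih (by omega)]; simp only [← mul_assoc]; rw [hz]
      _ = _ := by rw [h.txt j (by omega), ← mul_assoc, pow_succ]

theorem tau_mul_succ {i : ℕ} (hi : i + 1 < m) :
    descProd t m * x 0 * t (i + 1) = t i * (descProd t m * x 0) := by
  rw [mul_assoc, ← h.txcomm _ _ hi (by omega) (by omega) (by omega), ← mul_assoc,
    h.descProd_mul hi le_rfl, mul_assoc]

variable (hm : 0 < m)
include hm

/-- With C' = t_{m-1} ⋯ t_1, the element commuting with x_0 is C' (t_0 x_0 t_0) = C' z x_1, and each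
of these three factors commutes with x_0. -/
theorem x_zero_conj :
    descProd t m * x 0 * t 0 * x 0 = x 0 * (descProd t m * x 0 * t 0) := by
  obtain ⟨n, rfl⟩ : ∃ n, m = n + 1 := ⟨m - 1, by omega⟩
  have hC : descProd t (n + 1) = descProd t (n + 1) * (t 0)⁻¹ * t 0 := by group
  have hx := h.descProd_x_zero (j := n) le_rfl
  set C' := descProd t (n + 1) * (t 0)⁻¹
  have h1 := h.txt 0 hm
  have h2 := h.xcomm 1 0 (by omega) (by omega)
  rw [hC]
  calc _ = C' * (t 0 * x 0 * t 0) * x 0 := by simp only [mul_assoc]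
    _ = C' * z * (x 1 * x 0) := by rw [h1]; simp only [mul_assoc]
    _ = C' * x 0 * (z * x 1) := by
        rw [h2, mul_assoc, ← mul_assoc z, h.central]; simp only [mul_assoc]
    _ = _ := by rw [← hx, ← h1]; simp only [mul_assoc]

/-- The right side is the Bernstein expression of T_{s_0}. So s_0 and T_{s_0} are conjugates of s_1
and T_1 by τ, from which they inherit their relations. -/
theorem tau_conj_zero :
    descProd t m * x 0 * t 0 * (descProd t m * x 0)⁻¹ =
      z ^ m * ((x 0)⁻¹ * x m) * (descProd t m * ((t 0)⁻¹ * ascProd t m))⁻¹ := by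
  have h1 := h.descProd_x_ascProd le_rfl
  have h2 := h.x_zero_conj hm
  have h3 : z ^ m * ((x 0)⁻¹ * x m) = (x 0)⁻¹ * (z ^ m * x m) := by
    rw [← mul_assoc, (Commute.pow_left (h.central (x 0)⁻¹) m).eq, mul_assoc]
  rw [h3, ← h1, mul_inv_eq_iff_eq_mul, eq_comm]
  have h4 : descProd t m * x 0 * t 0 = (x 0)⁻¹ * (descProd t m * x 0 * t 0 * x 0) := by
    rw [h2]; group
  calc _ = (x 0)⁻¹ * (descProd t m * x 0 * t 0 * x 0) := by group
    _ = _ := h4.symm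

/-- Conjugation by τ takes t_0 to the zeroth affine generator; a second conjugation lands on
t_{m-1}. This closes the cycle on which τ acts as a rotation. -/
theorem tau_sq_zero :
    descProd t m * x 0 * (descProd t m * x 0 * t 0) =
      t (m - 1) * (descProd t m * x 0) * (descProd t m * x 0) := by
  obtain ⟨n, rfl⟩ : ∃ n, m = n + 1 := ⟨m - 1, by omega⟩
  have hC : descProd t (n + 1) = descProd t (n + 1) * (t 0)⁻¹ * t 0 := by group
  have hx := h.descProd_x_zero (j := n) le_rfl
  have hCC := h.descProd_mul_descProd (j := n) le_rfl
  have h2 := h.x_zero_conj hm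
  set C := descProd t (n + 1)
  have h3 : t n * C * (C * (t 0)⁻¹) = C * C := by
    rw [mul_assoc, hCC, ← mul_assoc]; rfl
  have h4 : C * C * x 0 = t n * C * x 0 * (C * (t 0)⁻¹) := by
    rw [← h3, mul_assoc (t n * C), ← hx, ← mul_assoc]
  have h5 := h.txt 0 hm
  have h6 := h.xcomm 1 0 (by omega) (by omega)
  have h7 : t 0 * x 0 * t 0 * x 0 = x 0 * (t 0 * x 0 * t 0) := by
    rw [h5, mul_assoc, h6, ← mul_assoc, h.central, mul_assoc]
  calc C * x 0 * (C * x 0 * t 0) = C * (x 0 * (C * x 0 * t 0)) := by simp only [mul_assoc]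
    _ = C * C * x 0 * t 0 * x 0 := by rw [← h2]; simp only [mul_assoc]
    _ = t n * C * x 0 * C * x 0 := by rw [h4]; group
    _ = _ := by simp only [mul_assoc]; rfl

end BernsteinRel

/-- A family indexed by `Fin n`, extended by `1` to `ℕ`. -/
def extendOne {n : ℕ} (t : Fin n → G) (i : ℕ) : G := if h : i < n then t ⟨i, h⟩ else 1

theorem extendOne_val {n : ℕ} (t : Fin n → G) (i : Fin n) : extendOne t i = t i := by
  simp [extendOne]

theorem prod_reverse_ofFn {n : ℕ} (t : Fin n → G) :
    (List.ofFn t).reverse.prod = descProd (extendOne t) n := by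
  have aux : ∀ (n : ℕ) (u : ℕ → G),
      (List.ofFn fun i : Fin n => u i).reverse.prod = descProd u n := by
    intro n u
    induction n with
    | zero => simp [descProd]
    | succ n ih => rw [List.ofFn_succ']; simp [descProd, ih]
  rw [← aux]
  simp only [extendOne_val]

theorem prod_ofFn {n : ℕ} (t : Fin n → G) :
    (List.ofFn t).prod = ascProd (extendOne t) n := by
  have aux : ∀ (n : ℕ) (u : ℕ → G), (List.ofFn fun i : Fin n => u i).prod = ascProd u n := by
    intro n u
    induction n with
    | zero => simp [ascProd]
    | succ n ih => rw [List.ofFn_succ']; simp [ascProd, ih]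
  rw [← aux]
  simp only [extendOne_val]

theorem prod_tail_ofFn {n : ℕ} (hn : 0 < n) (t : Fin n → G) :
    (List.ofFn t).tail.prod = (extendOne t 0)⁻¹ * ascProd (extendOne t) n := by
  rw [← prod_ofFn]
  obtain ⟨n, rfl⟩ : ∃ k, n = k + 1 := ⟨n - 1, by omega⟩
  simp [extendOne]

end BernsteinRelations

theorem units_zpow_mul {M ι : Type*} [Monoid M] (u : Mˣ) (t : ι → M) (σ : Equiv.Perm ι)
    (h : ∀ a, (u : M) * t a = t (σ a) * u) (e : ℤ) (a : ι) :
    ((u ^ e : Mˣ) : M) * t a = t ((σ ^ e) a) * (u ^ e : Mˣ) := by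
  induction e generalizing a with
  | zero => simp
  | succ n ih =>
    rw [zpow_add_one, zpow_add_one, Units.val_mul, mul_assoc, h, ← mul_assoc, ih, mul_assoc]; rfl
  | pred n ih =>
    have h1 : ((u⁻¹ : Mˣ) : M) * t a = t (σ⁻¹ a) * (u⁻¹ : Mˣ) := by
      rw [Units.inv_mul_eq_iff_eq_mul, ← mul_assoc, Units.eq_mul_inv_iff_mul_eq, h]; simp
    rw [zpow_sub_one, zpow_sub_one, Units.val_mul, mul_assoc, h1, ← mul_assoc, ih, mul_assoc]; rfl

/-- The rotation `j ↦ j - 1` of the affine Dynkin diagram. -/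
def rot (m : ℕ) : Equiv.Perm (Fin (m + 1)) := Equiv.subRight 1

theorem rot_zero : rot m 0 = Fin.last m := by
  ext; simp [rot, Equiv.subRight, Fin.coe_neg_one]

theorem rot_succ (i : Fin m) : rot m i.succ = i.castSucc := by
  simp only [rot, Equiv.subRight_apply, sub_eq_iff_eq_add]
  ext; simp

theorem rot_add_one (a : Fin (m + 1)) : rot m (a + 1) = a := by
  simp [rot, Equiv.subRight]

/-- The bookkeeping common to W and ℋ: three relations along the cyclic diagram assemble into one
equivariance under `rot m`. -/
theorem mul_cases_eq {M : Type*} [Monoid M] (hm : 1 ≤ m) (u t₀ : M) (t : Fin m → M)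
    (h1 : ∀ i j : Fin m, (j : ℕ) = i + 1 → u * t j = t i * u)
    (h2 : ∀ i : Fin m, (i : ℕ) = 0 → u * t i = t₀ * u)
    (h3 : ∀ i : Fin m, (i : ℕ) + 1 = m → u * t₀ = t i * u) (a : Fin (m + 1)) :
    u * (Fin.cases t₀ t a : M) = (Fin.cases t₀ t (rot m a) : M) * u := by
  obtain ⟨n, rfl⟩ : ∃ k, m = k + 1 := ⟨m - 1, by omega⟩
  cases a using Fin.cases with
  | zero =>
    rw [rot_zero, ← Fin.succ_last]
    exact h3 _ (by simp)
  | succ i =>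
    rw [rot_succ]
    cases i using Fin.cases with
    | zero => exact h2 _ rfl
    | succ i => rw [← Fin.succ_castSucc]; exact h1 _ _ (by simp)

/-! ### The relations in the extended affine Weyl group -/

theorem X_mul_X (i j : Fin (m + 1)) : (X i * X j : W m) = X j * X i := by
  simp only [X, ← map_mul, mul_comm]

theorem mulAutArrow_mulSingle (σ : Equiv.Perm (Fin (m + 1))) (j : Fin (m + 1))
    (c : Multiplicative ℤ) :
    mulAutArrow σ (Pi.mulSingle j c : Lattice m) = Pi.mulSingle (σ j) c := by
  funext i
  change (Pi.mulSingle j _ : Lattice m) (σ⁻¹ i) = _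
  simp [Pi.mulSingle_apply, Equiv.symm_apply_eq]

theorem closure_mulSingle (m : ℕ) : Subgroup.closure
    (Set.range fun j => (Pi.mulSingle j (Multiplicative.ofAdd 1) : Lattice m)) = ⊤ := by
  rw [eq_top_iff]
  intro f _
  rw [← Finset.univ_prod_mulSingle f]
  refine Subgroup.prod_mem _ fun j _ => ?_
  have : (Pi.mulSingle j (f j) : Lattice m) =
      (Pi.mulSingle j (Multiplicative.ofAdd 1)) ^ (f j).toAdd := by
    rw [← Pi.mulSingle_zpow, ← ofAdd_zsmul]; simp
  rw [this]
  exact Subgroup.zpow_mem _ (Subgroup.subset_closure (Set.mem_range_self j)) _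

theorem inr_mul_X (σ : Equiv.Perm (Fin (m + 1))) (j : Fin (m + 1)) :
    (SemidirectProduct.inr σ * X j : W m) = X (σ j) * SemidirectProduct.inr σ := by
  ext1
  · simp only [X, SemidirectProduct.mul_left, SemidirectProduct.left_inr,
      SemidirectProduct.right_inr, SemidirectProduct.left_inl, one_mul, map_one, mul_one,
      SemidirectProduct.right_inl]
    exact mulAutArrow_mulSingle _ _ _
  · simp [X]

theorem s_mul_X (i : Fin m) (j : Fin (m + 1)) :
    s i * X j = X (Equiv.swap i.castSucc i.succ j) * s i := inr_mul_X _ _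

theorem s_mul_self (i : Fin m) : s i * s i = 1 := by
  rw [s, ← map_mul, Equiv.swap_mul_self, map_one]

/-- The group W is the case z = 1 and ℋˣ the case z = q of the same relations, so both share the
computations with τ. -/
theorem bernsteinRel_W (m : ℕ) : BernsteinRel m (extendOne (s (m := m))) (extendOne X) 1 where
  comm i j hij hj := by
    simp only [extendOne, hj, show i < m by omega, dite_true, s, ← map_mul]
    congr 1
    ext x
    simp only [Equiv.Perm.mul_apply, Equiv.swap_apply_def]
    grind
  braid i hi := by
    simp only [extendOne, hi, show i < m by omega, dite_true, s, ← map_mul]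
    congr 1
    have h1 : (⟨i, by omega⟩ : Fin m).succ = (⟨i + 1, hi⟩ : Fin m).castSucc := rfl
    rw [h1, Equiv.swap_mul_swap_mul_swap, Equiv.swap_comm (Fin.castSucc ⟨i, _⟩),
      Equiv.swap_comm _ (Fin.succ _), Equiv.swap_mul_swap_mul_swap, Equiv.swap_comm] <;>
      simp [Fin.ext_iff] <;> omega
  xcomm i j hi hj := by
    simp only [extendOne, Nat.lt_succ_of_le hi, Nat.lt_succ_of_le hj, dite_true, X_mul_X]
  txcomm i j hi hj h1 h2 := by
    simp only [extendOne, hi, Nat.lt_succ_of_le hj, dite_true, s_mul_X]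
    rw [Equiv.swap_apply_of_ne_of_ne] <;> simpa [Fin.ext_iff]
  txt i hi := by
    simp only [extendOne, hi, show i < m + 1 by omega, show i + 1 < m + 1 by omega, dite_true,
      s_mul_X, one_mul, mul_assoc, s_mul_self, mul_one]
    congr 1
    exact Equiv.swap_apply_left _ _
  central g := by simp

theorem tau_eq (m : ℕ) : tau m = descProd (extendOne s) m * extendOne X 0 := by
  rw [tau, prod_reverse_ofFn]
  simp [extendOne]

theorem extendOne_s (i : Fin m) : extendOne (s (m := m)) i = s i := extendOne_val _ _

/-- The general formula yields the inverse of `s0 m`. Being conjugate to the inverse of `s0 m` makes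
s_1 useful in the next step: s_0 is an involution because s_1 is. -/
theorem tau_conj_s_zero (hm : 1 ≤ m) :
    tau m * extendOne s 0 * (tau m)⁻¹ = (s0 m)⁻¹ := by
  rw [tau_eq, (bernsteinRel_W m).tau_conj_zero hm, s0, prod_reverse_ofFn, prod_tail_ofFn hm]
  simp only [extendOne, one_pow, one_mul, mul_inv_rev, Nat.zero_lt_succ, dite_true,
    Nat.lt_succ_self, mul_assoc, inv_inv]
  have h := (Commute.inv_left (a := (X 0 : W m)) (X_mul_X 0 (Fin.last m))).eq
  rw [← mul_assoc (X (Fin.last m)), ← h, mul_assoc]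
  rfl

theorem s0_inv (hm : 1 ≤ m) : (s0 m)⁻¹ = s0 m := by
  have h : extendOne (s (m := m)) 0 * extendOne s 0 = 1 := by
    rw [show extendOne (s (m := m)) 0 = s ⟨0, hm⟩ from extendOne_s ⟨0, hm⟩, s_mul_self]
  suffices (s0 m)⁻¹ * (s0 m)⁻¹ = 1 by rwa [mul_eq_one_iff_eq_inv, inv_inv] at this
  rw [← tau_conj_s_zero hm]
  calc _ = tau m * (extendOne s 0 * extendOne s 0) * (tau m)⁻¹ := by group
    _ = 1 := by rw [h]; group

theorem tau_mul_sAff (hm : 1 ≤ m) (a : Fin (m + 1)) :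
    tau m * sAff a = sAff (rot m a) * tau m := by
  have h0 : tau m * extendOne s 0 = s0 m * tau m := by
    rw [← s0_inv hm, ← tau_conj_s_zero hm]; group
  refine mul_cases_eq hm _ _ _ (fun i j hij => ?_) (fun i hi => ?_) (fun i hi => ?_) a
  · rw [← extendOne_s, ← extendOne_s, hij, tau_eq]
    exact (bernsteinRel_W m).tau_mul_succ (by omega)
  · rw [← extendOne_s, hi, h0]
  · have h2 := (bernsteinRel_W m).tau_sq_zero hm
    rw [← tau_eq] at h2
    have h3 : m - 1 = i := by omega
    rw [h3, extendOne_s, h0, ← mul_assoc] at h2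
    exact mul_right_cancel h2

theorem sAff_succ (i : Fin m) : sAff i.succ = s i := rfl

theorem sAff_mul_self (hm : 1 ≤ m) (a : Fin (m + 1)) : sAff a * sAff a = 1 := by
  cases a using Fin.cases with
  | zero => exact inv_eq_iff_mul_eq_one.1 (s0_inv hm)
  | succ i => exact s_mul_self i

theorem sAff_mul_cancel (hm : 1 ≤ m) (a : Fin (m + 1)) (w : W m) :
    sAff a * (sAff a * w) = w := by
  rw [← mul_assoc, sAff_mul_self hm, one_mul]

theorem mul_sAff_cancel (hm : 1 ≤ m) (a : Fin (m + 1)) (w : W m) :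
    w * sAff a * sAff a = w := by
  rw [mul_assoc, sAff_mul_self hm, mul_one]

theorem sAff_inv (hm : 1 ≤ m) (a : Fin (m + 1)) : (sAff a)⁻¹ = sAff a :=
  inv_eq_of_mul_eq_one_right (sAff_mul_self hm a)

theorem tau_zpow_mul_sAff (hm : 1 ≤ m) (e : ℤ) (a : Fin (m + 1)) :
    tau m ^ e * sAff a = sAff ((rot m ^ e) a) * tau m ^ e := by
  simpa using units_zpow_mul (toUnits (tau m)) sAff (rot m) (by simpa using tau_mul_sAff hm) e a

theorem tau_zpow_mul_prod (hm : 1 ≤ m) (e : ℤ) (l : List (Fin (m + 1))) :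
    tau m ^ e * (l.map sAff).prod = ((l.map (rot m ^ e)).map sAff).prod * tau m ^ e := by
  induction l with
  | nil => simp
  | cons a l ih =>
    rw [List.map_cons, List.prod_cons, ← mul_assoc, tau_zpow_mul_sAff hm, mul_assoc, ih]
    simp [mul_assoc]

/-! ### The action on integers

The integer `j + (m + 1) k`, for `0 ≤ j ≤ m`, is represented by the pair `(k, j)`. -/

/-- The action of `W` as group of affine permutations. -/
def act (w : W m) (p : ℤ × Fin (m + 1)) : ℤ × Fin (m + 1) :=
  (p.1 - (w.left (w.right p.2)).toAdd, w.right p.2)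

/-- The order of the integers. -/
def Lt (p q : ℤ × Fin (m + 1)) : Prop := p.1 < q.1 ∨ p.1 = q.1 ∧ p.2 < q.2

/-- Translation by a multiple of `m + 1`. -/
def shift (p : ℤ × Fin (m + 1)) (k : ℤ) : ℤ × Fin (m + 1) := (p.1 + k, p.2)

/-- The larger one of the integers that `sAff a` exchanges. -/
def hi (a : Fin (m + 1)) : ℤ × Fin (m + 1) := (0, a)

/-- The smaller one of the integers that `sAff a` exchanges. -/
def lo (a : Fin (m + 1)) : ℤ × Fin (m + 1) :=
  Fin.cases (-1, Fin.last m) (fun i => (0, i.castSucc)) a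

theorem act_mul (w w' : W m) (p : ℤ × Fin (m + 1)) : act (w * w') p = act w (act w' p) := by
  ext1
  · simp only [act, SemidirectProduct.mul_left, SemidirectProduct.mul_right, Pi.mul_apply,
      toAdd_mul, Equiv.Perm.mul_apply]
    have : (mulAutArrow w.right w'.left : Lattice m) (w.right (w'.right p.2))
        = w'.left (w'.right p.2) := by
      change w'.left (w.right⁻¹ (w.right (w'.right p.2))) = _
      simp
    rw [this]; ring
  · rfl

theorem act_one (p : ℤ × Fin (m + 1)) : act (1 : W m) p = p := by
  simp [act]

theorem act_injective {w w' : W m} (h : ∀ p, act w p = act w' p) : w = w' := by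
  have h2 : w.right = w'.right := Equiv.ext fun j => (Prod.ext_iff.1 (h (0, j))).2
  ext1
  · funext j
    have := (Prod.ext_iff.1 (h (0, w.right⁻¹ j))).1
    simpa [act, ← h2] using this
  · exact h2

theorem act_shift (w : W m) (p : ℤ × Fin (m + 1)) (k : ℤ) :
    act w (shift p k) = shift (act w p) k := by
  simp only [act, shift, Prod.mk.injEq, and_true]; ring

theorem act_snd_ne (w : W m) {p q : ℤ × Fin (m + 1)} (h : p.2 ≠ q.2) :
    (act w p).2 ≠ (act w q).2 := fun h' => h (w.right.injective h')

theorem Lt.trans {p q r : ℤ × Fin (m + 1)} (h : Lt p q) (h' : Lt q r) : Lt p r := by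
  unfold Lt at *; omega

theorem Lt.asymm {p q : ℤ × Fin (m + 1)} (h : Lt p q) : ¬ Lt q p := by
  unfold Lt at *; omega

theorem lt_or_gt {p q : ℤ × Fin (m + 1)} (h : p.2 ≠ q.2) : Lt p q ∨ Lt q p := by
  unfold Lt at *; omega

theorem lt_shift_iff {p q : ℤ × Fin (m + 1)} {k : ℤ} : Lt (shift p k) (shift q k) ↔ Lt p q := by
  unfold Lt shift; simp only; omega

theorem lo_snd (a : Fin (m + 1)) : (lo a).2 = rot m a := by
  cases a using Fin.cases with
  | zero => rw [rot_zero]; rfl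
  | succ i => rw [rot_succ]; rfl

theorem lo_ne_hi (hm : 1 ≤ m) (a : Fin (m + 1)) : (lo a).2 ≠ (hi a).2 := by
  cases a using Fin.cases with
  | zero => simp [lo, hi, Fin.ext_iff]; omega
  | succ i => simp [lo, hi, Fin.ext_iff]

theorem lo_lt_hi (a : Fin (m + 1)) : Lt (lo a) (hi a) := by
  cases a using Fin.cases with
  | zero => simp [lo, hi, Lt]
  | succ i => simp [lo, hi, Lt, Fin.lt_def]

theorem act_s (i : Fin m) (p : ℤ × Fin (m + 1)) :
    act (s i) p = (p.1, Equiv.swap i.castSucc i.succ p.2) := by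
  simp [act, s]

theorem act_X (j : Fin (m + 1)) (p : ℤ × Fin (m + 1)) :
    act (X j) p = (p.1 - if p.2 = j then 1 else 0, p.2) := by
  simp only [act, X, SemidirectProduct.left_inl, SemidirectProduct.right_inl, Pi.mulSingle_apply]
  split_ifs <;> simp_all

theorem act_descProd_s {j : ℕ} (hj : j ≤ m) (p : ℤ × Fin (m + 1)) :
    (act (descProd (extendOne s) j) p).1 = p.1 ∧
      ((act (descProd (extendOne s) j) p).2 : ℕ) =
        if (p.2 : ℕ) = 0 then j else if (p.2 : ℕ) ≤ j then p.2 - 1 else p.2 := by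
  induction j with
  | zero => simp only [descProd, act_one]; grind
  | succ j ih =>
    obtain ⟨h1, h2⟩ := ih (by omega)
    rw [descProd, act_mul, show extendOne s j = s ⟨j, hj⟩ from extendOne_s ⟨j, hj⟩, act_s]
    refine ⟨h1, ?_⟩
    simp only [Equiv.swap_apply_def, Fin.ext_iff, Fin.val_castSucc, Fin.val_succ]
    grind

/-- In terms of integers τ is the translation by -1. It preserves the order, so powers of τ do not
contribute to length. -/
theorem act_tau (p : ℤ × Fin (m + 1)) :
    act (tau m) p = if p.2 = 0 then (p.1 - 1, Fin.last m) else (p.1, rot m p.2) := by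
  have h0 : extendOne (X (m := m)) 0 = X 0 := extendOne_val X 0
  have h := act_descProd_s le_rfl (act (X 0) p)
  rw [tau_eq, h0, act_mul]
  generalize act (descProd (extendOne s) m) (act (X 0) p) = y at h
  rw [act_X] at h
  obtain ⟨h1, h2⟩ := h
  obtain ⟨k, a⟩ := p
  cases a using Fin.cases with
  | zero => ext <;> simp_all
  | succ i => ext <;> simp_all [rot_succ, Fin.succ_ne_zero]

theorem act_sAff_succ (i : Fin m) (p : ℤ × Fin (m + 1)) :
    act (sAff i.succ) p = if p.2 = (hi i.succ).2 then shift (lo i.succ) (p.1 - (hi i.succ).1)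
      else if p.2 = (lo i.succ).2 then shift (hi i.succ) (p.1 - (lo i.succ).1) else p := by
  rw [sAff_succ, act_s]
  simp only [Equiv.swap_apply_def, hi, lo, shift, Fin.cases_succ]
  split_ifs <;> simp_all

theorem act_sAff (hm : 1 ≤ m) (a : Fin (m + 1)) (p : ℤ × Fin (m + 1)) :
    act (sAff a) p = if p.2 = (hi a).2 then shift (lo a) (p.1 - (hi a).1)
      else if p.2 = (lo a).2 then shift (hi a) (p.1 - (lo a).1) else p := by
  cases a using Fin.cases with
  | succ i => exact act_sAff_succ i p
  | zero =>
    obtain ⟨n, rfl⟩ : ∃ k, m = k + 1 := ⟨m - 1, by omega⟩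
    -- The action of s_0 is read off from that of s_1 through s_0 τ = τ s_1.
    have h := tau_mul_sAff hm (Fin.succ 0)
    rw [rot_succ, Fin.castSucc_zero] at h
    obtain ⟨y, rfl⟩ : ∃ y, p = act (tau (n + 1)) y :=
      ⟨act (tau (n + 1))⁻¹ p, by rw [← act_mul, mul_inv_cancel, act_one]⟩
    rw [← act_mul, ← h, act_mul, act_sAff_succ]
    obtain ⟨k, a⟩ := y
    have h1 : (0 : Fin (n + 2)) ≠ Fin.succ 0 := (Fin.succ_ne_zero 0).symm
    have h2 : Fin.last (n + 1) ≠ 0 := by simp [Fin.ext_iff]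
    have h3 : rot (n + 1) (Fin.succ 0) = 0 := rot_succ 0
    simp only [act_tau, hi, lo, shift, Fin.cases_zero, Fin.cases_succ, Fin.castSucc_zero]
    cases a using Fin.cases with
    | zero =>
      simp only [if_neg h1, if_neg h1.symm, if_neg h2, if_true, h3, Prod.mk.injEq, and_true]
      ring
    | succ i =>
      cases i using Fin.cases with
      | zero => simp only [if_neg h1.symm, if_true, h3, Prod.mk.injEq, and_true]; ring
      | succ i =>
        simp [rot_succ, Fin.ext_iff]
        omega

/-! ### Length and descents -/

theorem act_tau_lt_iff {p q : ℤ × Fin (m + 1)} :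
    Lt (act (tau m) p) (act (tau m) q) ↔ Lt p q := by
  obtain ⟨k, a⟩ := p
  obtain ⟨l, b⟩ := q
  simp only [act_tau]
  cases a using Fin.cases with
  | zero =>
    cases b using Fin.cases with
    | zero => simp [Lt]
    | succ j => simp [Lt, rot_succ, Fin.succ_ne_zero, Fin.lt_def]; omega
  | succ i =>
    cases b using Fin.cases with
    | zero => simp [Lt, rot_succ, Fin.succ_ne_zero, Fin.lt_def]; omega
    | succ j => simp [Lt, rot_succ, Fin.succ_ne_zero]

theorem act_tau_zpow_lt_iff (e : ℤ) {p q : ℤ × Fin (m + 1)} :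
    Lt (act (tau m ^ e) p) (act (tau m ^ e) q) ↔ Lt p q := by
  induction e generalizing p q with
  | zero => simp [act_one]
  | succ n ih => rw [zpow_add_one, act_mul, act_mul, ih, act_tau_lt_iff]
  | pred n ih =>
    rw [zpow_sub_one, act_mul, act_mul, ih, ← act_tau_lt_iff, ← act_mul, ← act_mul]
    simp [act_one]

/-- The integers `lo a` and `hi a` are consecutive, so exchanging them and their translates changes
the order of no other incongruent pair. -/
theorem eq_shift_of_lt_of_act_lt (hm : 1 ≤ m) {a : Fin (m + 1)} {p q : ℤ × Fin (m + 1)}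
    (hne : p.2 ≠ q.2) (h : Lt p q) (h' : Lt (act (sAff a) q) (act (sAff a) p)) :
    ∃ k, p = shift (lo a) k ∧ q = shift (hi a) k := by
  obtain ⟨k, i⟩ := p
  obtain ⟨l, j⟩ := q
  simp only at hne
  suffices i = (lo a).2 ∧ j = (hi a).2 ∧ k - (lo a).1 = l - (hi a).1 from
    ⟨k - (lo a).1, by simp [shift, this.1], by simp [shift, this.2.1, this.2.2]⟩
  rw [act_sAff hm, act_sAff hm] at h'
  cases a using Fin.cases with
  | zero =>
    simp only [lo, hi, shift, Lt, Fin.cases_zero, Fin.lt_def, Fin.ext_iff, Fin.val_last,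
      Fin.val_zero] at *
    grind
  | succ a =>
    simp only [lo, hi, shift, Lt, Fin.cases_succ, Fin.lt_def, Fin.ext_iff, Fin.val_castSucc,
      Fin.val_succ] at *
    grind

theorem act_sAff_hi (hm : 1 ≤ m) (a : Fin (m + 1)) : act (sAff a) (hi a) = lo a := by
  simp [act_sAff hm, shift]

theorem act_sAff_lo (hm : 1 ≤ m) (a : Fin (m + 1)) : act (sAff a) (lo a) = hi a := by
  rw [← act_sAff_hi hm, ← act_mul, sAff_mul_self hm, act_one]

theorem act_sAff_of_ne (hm : 1 ≤ m) {a : Fin (m + 1)} {p : ℤ × Fin (m + 1)}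
    (h1 : p.2 ≠ (hi a).2) (h2 : p.2 ≠ (lo a).2) : act (sAff a) p = p := by
  rw [act_sAff hm, if_neg h1, if_neg h2]

theorem eq_shift_of_snd_eq {p q : ℤ × Fin (m + 1)} (h : p.2 = q.2) :
    p = shift q (p.1 - q.1) := by
  ext1 <;> simp [shift, h]

/-- A reflection is determined by the pair it exchanges, and conjugation by u moves that pair by u.
This gives the exchange property as well as the commutation and braid relations. -/
theorem mul_sAff_eq (hm : 1 ≤ m) {u : W m} {a b : Fin (m + 1)} {k : ℤ}
    (h1 : act u (lo a) = shift (lo b) k) (h2 : act u (hi a) = shift (hi b) k) :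
    u * sAff a = sAff b * u := by
  refine act_injective fun p => ?_
  rw [act_mul, act_mul]
  by_cases hp : p.2 = (hi a).2
  · rw [eq_shift_of_snd_eq hp, act_shift, act_sAff_hi hm, act_shift, h1, act_shift, h2, act_shift,
      act_shift, act_sAff_hi hm]
  by_cases hp' : p.2 = (lo a).2
  · rw [eq_shift_of_snd_eq hp', act_shift, act_sAff_lo hm, act_shift, h2, act_shift, h1, act_shift,
      act_shift, act_sAff_lo hm]
  rw [act_sAff_of_ne hm hp hp', act_sAff_of_ne hm]
  · have := act_snd_ne u hp; rwa [h2] at this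
  · have := act_snd_ne u hp'; rwa [h1] at this

/-- Let the letters act from the right one at a time. The order of p and q is reversed at some
letter b, and just before it the pair must be a translate of the pair exchanged by b. -/
theorem exists_eq_append_of_act_lt (hm : 1 ≤ m) (l : List (Fin (m + 1)))
    {p q : ℤ × Fin (m + 1)} (hne : p.2 ≠ q.2) (h : Lt p q)
    (h' : Lt (act (l.map sAff).prod q) (act (l.map sAff).prod p)) :
    ∃ l₁ b l₂ k, l = l₁ ++ b :: l₂ ∧ act (l₂.map sAff).prod p = shift (lo b) k ∧
      act (l₂.map sAff).prod q = shift (hi b) k := by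
  induction l with
  | nil => simp only [List.map_nil, List.prod_nil, act_one] at h'; exact (h.asymm h').elim
  | cons a l ih =>
    rcases lt_or_gt (act_snd_ne (l.map sAff).prod hne) with h1 | h1
    · rw [List.map_cons, List.prod_cons, act_mul, act_mul] at h'
      obtain ⟨k, hp, hq⟩ := eq_shift_of_lt_of_act_lt hm (act_snd_ne _ hne) h1 h'
      exact ⟨[], a, l, k, rfl, hp, hq⟩
    · obtain ⟨l₁, b, l₂, k, rfl, hp, hq⟩ := ih h1
      exact ⟨a :: l₁, b, l₂, k, rfl, hp, hq⟩

/-- `a` is a right descent of `w`. -/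
def Desc (w : W m) (a : Fin (m + 1)) : Prop := Lt (act w (hi a)) (act w (lo a))

theorem desc_mul_sAff_iff (hm : 1 ≤ m) {w : W m} {a : Fin (m + 1)} :
    Desc (w * sAff a) a ↔ ¬ Desc w a := by
  have hne := act_snd_ne w (lo_ne_hi hm a)
  rw [Desc, Desc, act_mul, act_mul, act_sAff_hi hm, act_sAff_lo hm]
  exact ⟨Lt.asymm, (lt_or_gt hne).resolve_right⟩

/-- The exchange property. -/
theorem exchange (hm : 1 ≤ m) {x y : W m} {l : List (Fin (m + 1))} {e : ℤ} {a : Fin (m + 1)}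
    (hx : IsExpr x (l, e)) (hy : ¬ Desc y a) (h : Desc (x * y) a) :
    ∃ l₁ b l₂, l = l₁ ++ b :: l₂ ∧ IsExpr (x * (y * sAff a * y⁻¹)) (l₁ ++ l₂, e) := by
  simp only [IsExpr] at hx ⊢
  subst hx
  have hne := act_snd_ne y (lo_ne_hi hm a)
  have hlt : Lt (act y (lo a)) (act y (hi a)) := (lt_or_gt hne).resolve_right hy
  rw [Desc, act_mul, act_mul, act_mul, act_mul] at h
  -- Since τ^e preserves the order, the reversal happens inside the word l.
  obtain ⟨l₁, b, l₂, k, rfl, hp, hq⟩ := exists_eq_append_of_act_lt hm l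
    (act_snd_ne _ hne) ((act_tau_zpow_lt_iff e).2 hlt) h
  rw [← act_mul, ← act_mul] at hp hq
  refine ⟨l₁, b, l₂, rfl, ?_⟩
  have h1 := mul_sAff_eq hm hp hq
  simp only [List.map_append, List.prod_append, List.map_cons, List.prod_cons]
  generalize (l₂.map sAff).prod = z at h1
  have h2 : z * (tau m ^ e * (y * sAff a * y⁻¹)) = sAff b * (z * tau m ^ e) := by
    calc _ = z * (tau m ^ e * y) * sAff a * y⁻¹ := by simp only [mul_assoc]
      _ = _ := by rw [← mul_assoc z, h1]; simp only [mul_assoc, mul_inv_cancel, mul_one]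
  simp only [mul_assoc] at h2 ⊢
  rw [h2, sAff_mul_cancel hm]

theorem inr_mem_closure (σ : Equiv.Perm (Fin (m + 1))) :
    (SemidirectProduct.inr σ : W m) ∈ Submonoid.closure (Set.range s) := by
  have h : σ ∈ Submonoid.closure (Set.range fun i : Fin m => Equiv.swap i.castSucc i.succ) := by
    rw [Equiv.Perm.mclosure_swap_castSucc_succ]; trivial
  induction h using Submonoid.closure_induction with
  | mem x hx => obtain ⟨i, rfl⟩ := hx; exact Submonoid.subset_closure ⟨i, rfl⟩
  | one => simp
  | mul x y _ _ hx hy => rw [map_mul]; exact mul_mem hx hy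

theorem closure_sAff_tau (m : ℕ) :
    Subgroup.closure (insert (tau m) (Set.range sAff)) = ⊤ := by
  set Q := Subgroup.closure (insert (tau m) (Set.range sAff))
  have hinr : ∀ σ, (SemidirectProduct.inr σ : W m) ∈ Q := fun σ => by
    refine (Submonoid.closure_le (S := Q.toSubmonoid)).2 ?_ (inr_mem_closure σ)
    rintro _ ⟨i, rfl⟩
    exact Subgroup.subset_closure (Or.inr ⟨i.succ, rfl⟩)
  have hX0 : (X 0 : W m) ∈ Q := by
    have h : tau m ∈ Q := Subgroup.subset_closure (Or.inl rfl)
    have h' : (List.ofFn (s (m := m))).reverse.prod ∈ Q := by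
      refine Subgroup.list_prod_mem _ fun x hx => ?_
      simp only [List.mem_reverse, List.mem_ofFn] at hx
      obtain ⟨i, rfl⟩ := hx
      exact hinr _
    exact (Subgroup.mul_mem_cancel_left _ h').1 h
  have hX : ∀ j, (X j : W m) ∈ Q := fun j => by
    have h := inr_mul_X (Equiv.swap 0 j) 0
    rw [Equiv.swap_apply_left] at h
    rw [eq_mul_inv_of_mul_eq h.symm]
    exact Q.mul_mem (Q.mul_mem (hinr _) hX0) (Q.inv_mem (hinr _))
  have hinl : ∀ f : Lattice m, (SemidirectProduct.inl f : W m) ∈ Q := fun f => by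
    have h : Subgroup.closure (Set.range fun j => (Pi.mulSingle j (Multiplicative.ofAdd 1) :
        Lattice m)) ≤ Q.comap (SemidirectProduct.inl : Lattice m →* W m) := by
      rw [Subgroup.closure_le]
      rintro _ ⟨j, rfl⟩
      exact hX j
    rw [closure_mulSingle] at h
    exact h (Subgroup.mem_top f)
  rw [eq_top_iff]
  intro w _
  rw [← SemidirectProduct.inl_left_mul_inr_right w]
  exact Q.mul_mem (hinl _) (hinr _)

/-- The element τ permutes the simple reflections by conjugation, so all its powers can be collected
at the right end. -/
theorem exists_isExpr (hm : 1 ≤ m) (w : W m) : ∃ e, IsExpr w e := by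
  have hw : w ∈ Subgroup.closure (insert (tau m) (Set.range sAff)) := by
    rw [closure_sAff_tau]; trivial
  have haux : ∀ (e : ℤ) w, (∃ e, IsExpr w e) → ∃ e', IsExpr (tau m ^ e * w) e' := by
    rintro e w ⟨⟨l, f⟩, rfl⟩
    refine ⟨(l.map (rot m ^ e), e + f), ?_⟩
    simp only [IsExpr]
    rw [← mul_assoc, tau_zpow_mul_prod hm, mul_assoc, zpow_add]
  have hs : ∀ (a : Fin (m + 1)) (w : W m), (∃ e, IsExpr w e) → ∃ e', IsExpr (sAff a * w) e' := by
    rintro a w ⟨⟨l, f⟩, rfl⟩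
    exact ⟨(a :: l, f), by simp [IsExpr, mul_assoc]⟩
  induction hw using Subgroup.closure_induction_left with
  | one => exact ⟨([], 0), by simp [IsExpr]⟩
  | mul_left x hx y _ ih =>
    rcases hx with rfl | ⟨a, rfl⟩
    · simpa using haux 1 y ih
    · exact hs a y ih
  | inv_mul_cancel x hx y _ ih =>
    rcases hx with rfl | ⟨a, rfl⟩
    · simpa using haux (-1) y ih
    · rw [sAff_inv hm]; exact hs a y ih

theorem length_le {w : W m} {l : List (Fin (m + 1))} {e : ℤ} (h : IsExpr w (l, e)) :
    length w ≤ l.length := Nat.sInf_le ⟨(l, e), h, rfl⟩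

theorem exists_reduced (hm : 1 ≤ m) (w : W m) :
    ∃ l e, IsExpr w (l, e) ∧ l.length = length w := by
  obtain ⟨e, he⟩ := exists_isExpr hm w
  obtain ⟨⟨l, f⟩, h1, h2⟩ := Nat.sInf_mem
    (s := {r | ∃ e : List (Fin (m + 1)) × ℤ, IsExpr w e ∧ e.1.length = r}) ⟨_, e, he, rfl⟩
  exact ⟨l, f, h1, h2⟩

theorem length_mul_sAff_le (hm : 1 ≤ m) (w : W m) (a : Fin (m + 1)) :
    length (w * sAff a) ≤ length w + 1 := by
  obtain ⟨l, e, rfl, hl⟩ := exists_reduced hm w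
  rw [← hl]
  refine (length_le (l := l ++ [(rot m ^ e) a]) (e := e) ?_).trans (by simp)
  simp only [IsExpr]
  rw [mul_assoc, tau_zpow_mul_sAff hm]
  simp [mul_assoc]

theorem length_mul_sAff_of_desc (hm : 1 ≤ m) {w : W m} {a : Fin (m + 1)} (h : Desc w a) :
    length w = length (w * sAff a) + 1 := by
  obtain ⟨l, e, hw, hl⟩ := exists_reduced hm w
  have h0 : ¬ Desc (1 : W m) a := by
    rw [Desc, act_one, act_one]; exact (lo_lt_hi a).asymm
  obtain ⟨l₁, b, l₂, rfl, h'⟩ := exchange hm hw h0 (by rwa [mul_one])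
  rw [one_mul, inv_one, mul_one] at h'
  have h1 := length_le h'
  have h2 := length_mul_sAff_le hm (w * sAff a) a
  rw [mul_sAff_cancel hm] at h2
  simp at hl h1
  omega

theorem desc_iff_length_lt (hm : 1 ≤ m) {w : W m} {a : Fin (m + 1)} :
    Desc w a ↔ length (w * sAff a) < length w := by
  refine ⟨fun h => by have := length_mul_sAff_of_desc hm h; omega, fun h => ?_⟩
  by_contra h'
  have := length_mul_sAff_of_desc hm ((desc_mul_sAff_iff hm).2 h')
  rw [mul_sAff_cancel hm] at this
  omega

theorem length_mul_sAff_of_not_desc (hm : 1 ≤ m) {w : W m} {a : Fin (m + 1)} (h : ¬ Desc w a) :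
    length (w * sAff a) = length w + 1 := by
  have := length_mul_sAff_of_desc hm ((desc_mul_sAff_iff hm).2 h)
  rwa [mul_sAff_cancel hm] at this

theorem isExpr_inv (hm : 1 ≤ m) {w : W m} {l : List (Fin (m + 1))} {e : ℤ}
    (h : IsExpr w (l, e)) : IsExpr w⁻¹ (l.reverse.map (rot m ^ (-e)), -e) := by
  simp only [IsExpr] at *
  rw [h, ← tau_zpow_mul_prod hm, mul_inv_rev, zpow_neg, List.prod_inv_reverse]
  congr 2
  simp [List.map_reverse, sAff_inv hm, Function.comp_def]

theorem length_inv (hm : 1 ≤ m) (w : W m) : length w⁻¹ = length w := by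
  have aux : ∀ w : W m, length w⁻¹ ≤ length w := fun w => by
    obtain ⟨l, e, hw, hl⟩ := exists_reduced hm w
    rw [← hl]
    exact (length_le (isExpr_inv hm hw)).trans (by simp)
  exact le_antisymm (aux w) (by simpa using aux w⁻¹)

theorem length_mul_le (hm : 1 ≤ m) (w w' : W m) : length (w * w') ≤ length w + length w' := by
  obtain ⟨l, e, hw, hl⟩ := exists_reduced hm w
  obtain ⟨l', e', hw', hl'⟩ := exists_reduced hm w'
  rw [← hl, ← hl']
  refine (length_le (l := l ++ l'.map (rot m ^ e)) (e := e + e') ?_).trans (by simp)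
  simp only [IsExpr] at *
  rw [hw, hw', List.map_append, List.prod_append, zpow_add, mul_assoc, ← mul_assoc (tau m ^ e),
    tau_zpow_mul_prod hm]
  simp only [mul_assoc]

/-- The homomorphism `W → ℤ` that sends `τ` to `1` and simple reflections to `0`. -/
def deg (m : ℕ) : W m →* Multiplicative ℤ where
  toFun w := ∏ j, w.left j
  map_one' := by simp
  map_mul' w w' := by
    simp only [SemidirectProduct.mul_left, Pi.mul_apply, Finset.prod_mul_distrib]
    congr 1
    exact Equiv.prod_comp (w.right⁻¹) w'.left

theorem deg_inr (σ : Equiv.Perm (Fin (m + 1))) : deg m (SemidirectProduct.inr σ) = 1 := by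
  simp [deg]

theorem deg_sAff (hm : 1 ≤ m) (a : Fin (m + 1)) : deg m (sAff a) = 1 := by
  have h := congrArg (deg m) (sAff_mul_self hm a)
  rw [map_mul, map_one, ← pow_two] at h
  have h' := congrArg Multiplicative.toAdd h
  rw [toAdd_pow] at h'
  apply Multiplicative.toAdd.injective
  simpa using h'

theorem deg_tau (m : ℕ) : deg m (tau m) = Multiplicative.ofAdd 1 := by
  rw [tau, map_mul, map_list_prod, List.prod_eq_one, one_mul]
  · simp [deg, X]
  · intro x hx
    simp only [List.mem_map, List.mem_reverse, List.mem_ofFn] at hx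
    obtain ⟨_, ⟨i, rfl⟩, rfl⟩ := hx
    exact deg_inr _

/-- Hence all expressions of w have the same exponent of τ, and comparing two of them reduces to
comparing words. -/
theorem deg_of_isExpr (hm : 1 ≤ m) {w : W m} {l : List (Fin (m + 1))} {e : ℤ}
    (h : IsExpr w (l, e)) : deg m w = Multiplicative.ofAdd e := by
  simp only [IsExpr] at h
  rw [h, map_mul, map_list_prod, List.prod_eq_one, one_mul, map_zpow, deg_tau, ← ofAdd_zsmul]
  · simp
  · intro x hx
    simp only [List.mem_map] at hx
    obtain ⟨_, ⟨i, _, rfl⟩, rfl⟩ := hx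
    exact deg_sAff hm _

/-! ### Braid relations and Matsumoto's theorem -/

/-- Neighbouring reflections share an integer up to translation; the translation is nontrivial only
when a + 1 wraps around to 0. -/
theorem hi_eq_shift_lo (a : Fin (m + 1)) : hi a = shift (lo (a + 1)) (-(lo (a + 1)).1) := by
  have h : (hi a).2 = (lo (a + 1)).2 := by rw [lo_snd, rot_add_one]; rfl
  have := eq_shift_of_snd_eq h
  simpa [hi] using this

theorem lo_fst_nonpos (a : Fin (m + 1)) : (lo a).1 ≤ 0 := by
  cases a using Fin.cases <;> simp [lo]

theorem add_one_ne (hm : 1 ≤ m) (a : Fin (m + 1)) : a + 1 ≠ a := by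
  simp [Fin.ext_iff]; omega

theorem rot_ne_add_one (hm : 2 ≤ m) (a : Fin (m + 1)) : rot m a ≠ a + 1 := by
  intro h
  have h' : a + 1 + 1 = a := by rw [← h]; simp [rot]
  rw [add_assoc, add_eq_left, Fin.ext_iff, Fin.val_add] at h'
  simp [Nat.mod_eq_of_lt (show 1 < m + 1 by omega),
    Nat.mod_eq_of_lt (show 2 < m + 1 by omega)] at h'

theorem rot_eq_iff {a b : Fin (m + 1)} : rot m a = b ↔ a = b + 1 := by
  simp [rot, sub_eq_iff_eq_add]

section NonAdjacent

variable (hm : 1 ≤ m) {a b : Fin (m + 1)} (hab : a ≠ b) (h1 : b ≠ a + 1) (h2 : a ≠ b + 1)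
include hm hab h1 h2

omit h1 in
theorem act_sAff_lo_of_nonadjacent : act (sAff b) (lo a) = lo a := by
  apply act_sAff_of_ne hm
  · rw [lo_snd]; exact fun h => h2 (rot_eq_iff.1 h)
  · rw [lo_snd, lo_snd]; exact fun h => hab ((rot m).injective h)

omit h2 in
theorem act_sAff_hi_of_nonadjacent : act (sAff b) (hi a) = hi a := by
  apply act_sAff_of_ne hm hab
  rw [lo_snd]
  exact fun h => h1 (rot_eq_iff.1 h.symm)

theorem sAff_commute : sAff a * sAff b = (sAff b * sAff a : W m) := by
  symm
  refine mul_sAff_eq hm (k := 0) ?_ ?_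
  · rw [act_sAff_lo_of_nonadjacent hm hab h2]; simp [shift]
  · rw [act_sAff_hi_of_nonadjacent hm hab h1]; simp [shift]

end NonAdjacent

section Adjacent

variable (hm : 2 ≤ m) (a : Fin (m + 1))
include hm

theorem act_sAff_hi_add_one : act (sAff a) (hi (a + 1)) = hi (a + 1) := by
  apply act_sAff_of_ne (by omega) (add_one_ne (by omega) a)
  rw [lo_snd]
  exact (rot_ne_add_one hm a).symm

theorem act_sAff_add_one_lo : act (sAff (a + 1)) (lo a) = lo a := by
  apply act_sAff_of_ne (by omega)
  · rw [lo_snd]; exact rot_ne_add_one hm a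
  · rw [lo_snd, lo_snd]; exact fun h => add_one_ne (by omega) a ((rot m).injective h).symm

theorem sAff_braid :
    sAff a * sAff (a + 1) * sAff a = (sAff (a + 1) * sAff a * sAff (a + 1) : W m) := by
  rw [mul_assoc (sAff (a + 1))]
  refine mul_sAff_eq (by omega) (k := -(lo (a + 1)).1) ?_ ?_
  · rw [act_mul, act_sAff_add_one_lo hm, act_sAff_lo (by omega), hi_eq_shift_lo]
  · rw [hi_eq_shift_lo, act_mul, act_shift, act_sAff_lo (by omega), act_shift,
      act_sAff_hi_add_one hm]

end Adjacent

theorem length_sAff_mul (hm : 1 ≤ m) (a : Fin (m + 1)) (w : W m) :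
    length (sAff a * w) = length (w⁻¹ * sAff a) := by
  rw [← length_inv hm, mul_inv_rev, sAff_inv hm]

theorem length_sAff_mul_of_desc (hm : 1 ≤ m) {a : Fin (m + 1)} {w : W m} (h : Desc w⁻¹ a) :
    length w = length (sAff a * w) + 1 := by
  rw [length_sAff_mul hm, ← length_mul_sAff_of_desc hm h, length_inv hm]

theorem desc_inv_iff (hm : 1 ≤ m) {w : W m} {a : Fin (m + 1)} :
    Desc w⁻¹ a ↔ length (sAff a * w) < length w := by
  rw [desc_iff_length_lt hm, length_sAff_mul hm, length_inv hm]

theorem exists_word (hm : 1 ≤ m) {w : W m} (hw : deg m w = 1) :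
    ∃ l : List (Fin (m + 1)), w = (l.map sAff).prod ∧ l.length = length w := by
  obtain ⟨l, e, h, hl⟩ := exists_reduced hm w
  have := deg_of_isExpr hm h
  rw [hw] at this
  obtain rfl : e = 0 := (congrArg Multiplicative.toAdd this).symm
  exact ⟨l, by simpa [IsExpr] using h, hl⟩

theorem deg_prod (hm : 1 ≤ m) (l : List (Fin (m + 1))) : deg m (l.map sAff).prod = 1 :=
  deg_of_isExpr hm (l := l) (e := 0) (by simp [IsExpr])

theorem length_prod_le (l : List (Fin (m + 1))) : length (l.map sAff).prod ≤ l.length :=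
  length_le (e := 0) (by simp [IsExpr])

/-- Matsumoto's theorem. -/
theorem matsumoto {M : Type*} [Monoid M] (hm : 1 ≤ m) (t : Fin (m + 1) → M)
    (hcomm : ∀ a b, a ≠ b → b ≠ a + 1 → a ≠ b + 1 → t a * t b = t b * t a)
    (hbraid : 2 ≤ m → ∀ a, t a * t (a + 1) * t a = t (a + 1) * t a * t (a + 1)) (n : ℕ)
    (l l' : List (Fin (m + 1))) (hl : l.length = n) (hl' : l'.length = n)
    (h : (l.map sAff).prod = ((l'.map sAff).prod : W m))
    (hn : length ((l.map sAff).prod : W m) = n) : (l.map t).prod = (l'.map t).prod := by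
  induction n generalizing l l' with
  | zero => rw [List.length_eq_zero_iff] at hl hl'; rw [hl, hl']
  | succ n ih =>
    obtain ⟨a, u, rfl⟩ := List.exists_cons_of_length_eq_add_one hl
    obtain ⟨b, v, rfl⟩ := List.exists_cons_of_length_eq_add_one hl'
    simp only [List.length_cons, Nat.add_right_cancel_iff] at hl hl'
    set w : W m := ((a :: u).map sAff).prod with hw
    have hau : sAff a * w = (u.map sAff).prod := by simp [hw, sAff_mul_cancel hm]
    have hbv : sAff b * w = (v.map sAff).prod := by simp [h, sAff_mul_cancel hm]
    have hda : Desc w⁻¹ a := by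
      rw [desc_inv_iff hm, hn, hau, ← hl]; exact Nat.lt_succ_of_le (length_prod_le u)
    have hdb : Desc w⁻¹ b := by
      rw [desc_inv_iff hm, hn, hbv, ← hl']; exact Nat.lt_succ_of_le (length_prod_le v)
    have hla := length_sAff_mul_of_desc hm hda
    have hlb := length_sAff_mul_of_desc hm hdb
    have hdeg : deg m w = 1 := deg_prod hm _
    -- the case of adjacent reflections
    have key : ∀ (c : Fin (m + 1)) (x y : List (Fin (m + 1))), x.length = n → y.length = n →
        sAff c * w = (x.map sAff).prod → sAff (c + 1) * w = (y.map sAff).prod →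
        Desc w⁻¹ c → Desc w⁻¹ (c + 1) → (((c :: x).map t).prod = (((c + 1) :: y).map t).prod) := by
      intro c x y hx hy hcx hcy hc hc'
      have hlc := length_sAff_mul_of_desc hm hc
      have hlc' := length_sAff_mul_of_desc hm hc'
      rcases Nat.lt_or_ge m 2 with h2 | h2
      -- For m = 1 the two reflections generate an infinite dihedral group and cannot both be left
      -- descents: with P and Q the images of `lo (c + 1)` and `lo c`, some translate of P by a
      -- nonnegative amount would be below Q, and likewise with P and Q exchanged.
      · exfalso
        obtain rfl : m = 1 := by omega
        have h3 : hi (c + 1) = shift (lo c) (-(lo c).1) := by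
          have h4 := hi_eq_shift_lo (c + 1)
          rwa [show c + 1 + 1 = c by fin_cases c <;> rfl] at h4
        unfold Desc at hc hc'
        rw [hi_eq_shift_lo, act_shift] at hc
        rw [h3, act_shift] at hc'
        have h5 := lo_fst_nonpos c
        have h6 := lo_fst_nonpos (c + 1)
        unfold Lt shift at *
        simp only at hc hc'
        omega
      -- Up to translation, `lo c`, `hi c`, `hi (c + 1)` are three consecutive integers whose order
      -- w⁻¹ reverses completely. So w has reduced words starting with either side of the braid
      -- relation and continuing with the same y'.
      have e1 : Desc (sAff c * w)⁻¹ (c + 1) := by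
        unfold Desc at *
        rw [mul_inv_rev, sAff_inv hm, act_mul, act_mul, act_sAff_hi_add_one h2]
        have h3 : act (sAff c) (lo (c + 1)) = shift (lo c) (lo (c + 1)).1 := by
          have h4 : lo (c + 1) = shift (hi c) (lo (c + 1)).1 := by
            rw [hi_eq_shift_lo]; simp [shift]
          rw [h4, act_shift, act_sAff_hi hm]; simp [shift, hi]
        rw [h3]
        rw [hi_eq_shift_lo, act_shift, ← lt_shift_iff (k := (lo (c + 1)).1)] at hc
        refine hc'.trans ?_
        rw [act_shift]
        convert hc using 1
        simp [shift]
      have l1 := length_sAff_mul_of_desc hm e1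
      have e2 : Desc (sAff (c + 1) * (sAff c * w))⁻¹ c := by
        unfold Desc at *
        rw [mul_inv_rev, mul_inv_rev, sAff_inv hm, sAff_inv hm, mul_assoc, act_mul, act_mul,
          act_mul, act_mul, act_sAff_add_one_lo h2, act_sAff_lo hm, hi_eq_shift_lo, act_shift,
          act_sAff_lo hm, act_shift, act_sAff_hi_add_one h2, act_shift, act_shift, lt_shift_iff]
        exact hc'
      have l2 := length_sAff_mul_of_desc hm e2
      obtain ⟨y', hy', hyl⟩ := exists_word hm (w := sAff c * (sAff (c + 1) * (sAff c * w)))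
        (by simp [deg_sAff hm, hdeg])
      have hbr : sAff c * (sAff (c + 1) * (sAff c * w)) =
          sAff (c + 1) * (sAff c * (sAff (c + 1) * w)) := by
        simp only [← mul_assoc]; rw [sAff_braid h2]
      have i1 := ih x ((c + 1) :: c :: y') hx (by simp; omega)
        (by simp [← hy', ← hcx, sAff_mul_cancel hm]) (by rw [← hcx]; omega)
      have i2 := ih y (c :: (c + 1) :: y') hy (by simp; omega)
        (by simp [← hy', ← hcy, sAff_mul_cancel hm, hbr]) (by rw [← hcy]; omega)
      rw [List.map_cons, List.prod_cons, List.map_cons, List.prod_cons, i1, i2]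
      simp only [List.map_cons, List.prod_cons, ← mul_assoc]
      rw [hbraid h2]
    by_cases hab : a = b
    · subst hab
      rw [List.map_cons, List.prod_cons, List.map_cons, List.prod_cons,
        ih u v hl hl' (by rw [← hau, ← hbv]) (by rw [← hau]; omega)]
    by_cases h1 : b = a + 1
    · subst h1
      exact key a u v hl hl' hau hbv hda hdb
    by_cases h2 : a = b + 1
    · subst h2
      exact (key b v u hl' hl hbv hau hdb hda).symm
    have e1 : Desc (sAff a * w)⁻¹ b := by
      unfold Desc at *
      rw [mul_inv_rev, sAff_inv hm, act_mul, act_mul,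
        act_sAff_hi_of_nonadjacent hm (Ne.symm hab) h2,
        act_sAff_lo_of_nonadjacent hm (Ne.symm hab) h1]
      exact hdb
    have l1 := length_sAff_mul_of_desc hm e1
    obtain ⟨y, hy, hyl⟩ := exists_word hm (w := sAff b * (sAff a * w))
      (by simp [deg_sAff hm, hdeg])
    have hc : sAff b * (sAff a * w) = sAff a * (sAff b * w) := by
      simp only [← mul_assoc]; rw [sAff_commute hm hab h1 h2]
    have i1 := ih u (b :: y) hl (by simp; omega)
      (by simp [← hy, ← hau, sAff_mul_cancel hm]) (by rw [← hau]; omega)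
    have i2 := ih v (a :: y) hl' (by simp; omega)
      (by simp [← hy, ← hbv, sAff_mul_cancel hm, hc]) (by rw [← hbv]; omega)
    rw [List.map_cons, List.prod_cons, List.map_cons, List.prod_cons, i1, i2]
    simp only [List.map_cons, List.prod_cons, ← mul_assoc]
    rw [hcomm a b hab h1 h2]

/-! ### Parabolic subgroups and coset representatives -/

theorem s_mem_parabolic {J : Finset (Fin m)} {j : Fin m} (hj : j ∈ J) : s j ∈ parabolic J :=
  Subgroup.subset_closure ⟨j, hj, rfl⟩

theorem parabolic_mono {J K : Finset (Fin m)} (h : J ⊆ K) : parabolic J ≤ parabolic K :=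
  Subgroup.closure_mono (Set.image_mono h)

theorem prod_map_s (l : List (Fin m)) :
    (l.map s).prod = ((l.map Fin.succ).map sAff).prod := by
  rw [List.map_map]; rfl

theorem isExpr_map_succ (l : List (Fin m)) : IsExpr (l.map s).prod (l.map Fin.succ, 0) := by
  rw [prod_map_s]; simp [IsExpr]

theorem prod_mem_parabolic {J : Finset (Fin m)} {l : List (Fin m)} (hl : ∀ i ∈ l, i ∈ J) :
    (l.map s).prod ∈ parabolic J := by
  refine Subgroup.list_prod_mem _ fun x hx => ?_
  obtain ⟨i, hi, rfl⟩ := List.mem_map.1 hx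
  exact s_mem_parabolic (hl i hi)

/-- The exchange property shortens a word by deleting one of its letters, so a word in J stays in J.
Hence the length on W_J is computed with letters from J alone. -/
theorem exists_word_parabolic (hm : 1 ≤ m) {J : Finset (Fin m)} {b : W m}
    (hb : b ∈ parabolic J) :
    ∃ l : List (Fin m), (∀ i ∈ l, i ∈ J) ∧ b = (l.map s).prod ∧ l.length = length b := by
  have hone : ¬ ∃ a, Desc (1 : W m) a := by
    rintro ⟨a, ha⟩
    rw [Desc, act_one, act_one] at ha
    exact ha.asymm (lo_lt_hi a)
  have step : ∀ (x : W m) (j : Fin m), j ∈ J →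
      (∃ l : List (Fin m), (∀ i ∈ l, i ∈ J) ∧ x = (l.map s).prod ∧ l.length = length x) →
      ∃ l : List (Fin m), (∀ i ∈ l, i ∈ J) ∧ x * s j = (l.map s).prod ∧
        l.length = length (x * s j) := by
    rintro x j hj ⟨l, hl, hx, hlen⟩
    by_cases hd : Desc x j.succ
    · obtain ⟨l₁, b, l₂, h1, h2⟩ := exchange hm (y := 1) (x := x) (hx ▸ isExpr_map_succ l)
        (fun h => hone ⟨_, h⟩) (by rwa [mul_one])
      obtain ⟨k₁, k₂', rfl, rfl, h3⟩ := List.map_eq_append_iff.1 h1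
      obtain ⟨i, k₂, rfl, rfl, rfl⟩ := List.map_eq_cons_iff.1 h3
      refine ⟨k₁ ++ k₂, fun i hi => hl i (by simp at hi ⊢; tauto), ?_, ?_⟩
      · rw [prod_map_s]; simpa [IsExpr, sAff_succ] using h2
      · have := length_mul_sAff_of_desc hm hd
        rw [sAff_succ] at this
        simp at hlen ⊢
        omega
    · refine ⟨l ++ [j], ?_, by simp [hx], ?_⟩
      · simp only [List.mem_append, List.mem_singleton]; rintro i (hi | rfl)
        exacts [hl i hi, hj]
      · have := length_mul_sAff_of_not_desc hm hd
        rw [sAff_succ] at this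
        simp [this, hlen]
  induction hb using Subgroup.closure_induction_right with
  | one =>
    have : length (1 : W m) = 0 :=
      Nat.le_zero.1 (length_le (l := []) (e := 0) (by simp [IsExpr]))
    exact ⟨[], by simp, by simp, this.symm⟩
  | mul_right x y _ hy ih => obtain ⟨j, hj, rfl⟩ := hy; exact step x j hj ih
  | mul_inv_cancel x y _ hy ih =>
    obtain ⟨j, hj, rfl⟩ := hy
    rw [inv_eq_of_mul_eq_one_right (s_mul_self j)]; exact step x j hj ih

theorem eq_one_of_length_eq_zero (hm : 1 ≤ m) {J : Finset (Fin m)} {b : W m}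
    (hb : b ∈ parabolic J) (h : length b = 0) : b = 1 := by
  obtain ⟨l, _, rfl, hl⟩ := exists_word_parabolic hm hb
  rw [h, List.length_eq_zero_iff] at hl
  simp [hl]

/-- `y` is of minimal length in `y W_J`. -/
def IsMin (J : Finset (Fin m)) (y : W m) : Prop := ∀ b ∈ parabolic J, length y ≤ length (y * b)

theorem IsMin.not_desc (hm : 1 ≤ m) {J : Finset (Fin m)} {y : W m} (hy : IsMin J y) {j : Fin m}
    (hj : j ∈ J) : ¬ Desc y j.succ := by
  rw [desc_iff_length_lt hm]
  exact not_lt.2 (hy _ (s_mem_parabolic hj))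

/-- Build b letter by letter. If a letter j lengthened b but shortened y b, exchange would delete a
letter from a reduced word of y and produce y (b s_j b⁻¹), a shorter element of y W_J. -/
theorem IsMin.length_mul (hm : 1 ≤ m) {J : Finset (Fin m)} {y b : W m} (hy : IsMin J y)
    (hb : b ∈ parabolic J) : length (y * b) = length y + length b := by
  obtain ⟨l, hl, rfl, hlen⟩ := exists_word_parabolic hm hb
  clear hb
  induction l using List.reverseRecOn with
  | nil =>
    have : length (1 : W m) = 0 := by simpa using hlen.symm
    simp [this]
  | append_singleton l j ih =>
    have hl' : ∀ i ∈ l, i ∈ J := fun i hi => hl i (by simp [hi])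
    have hj : j ∈ J := hl j (by simp)
    simp only [List.map_append, List.map_cons, List.map_nil, List.prod_append, List.prod_cons,
      List.prod_nil, mul_one, List.length_append, List.length_cons, List.length_nil] at hlen ⊢
    set b := (l.map s).prod with hb
    have h1 : length b ≤ l.length := by
      simpa using length_le (isExpr_map_succ l)
    have h2 := length_mul_sAff_le hm b j.succ
    rw [sAff_succ] at h2
    have ih' := ih hl' (by omega)
    have h3 : ¬ Desc b j.succ := by
      rw [desc_iff_length_lt hm, sAff_succ]; omega
    have h4 : ¬ Desc (y * b) j.succ := fun h => by
      obtain ⟨ly, e, hye, hly⟩ := exists_reduced hm y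
      obtain ⟨l₁, c, l₂, rfl, h5⟩ := exchange hm hye h3 h
      have h6 := length_le h5
      have hbm : b ∈ parabolic J := prod_mem_parabolic hl'
      have h7 := hy (b * sAff j.succ * b⁻¹)
        (mul_mem (mul_mem hbm (s_mem_parabolic hj)) (inv_mem hbm))
      simp at hly h6
      omega
    have h5 := length_mul_sAff_of_not_desc hm h4
    rw [sAff_succ, mul_assoc] at h5
    omega

theorem exists_isMin_mul (J : Finset (Fin m)) (w : W m) :
    ∃ y, IsMin J y ∧ ∃ b ∈ parabolic J, w = y * b := by
  obtain ⟨c, hc, hmin⟩ := Nat.sInf_mem (s := (fun b => length (w * b)) '' (parabolic J : Set (W m)))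
    ⟨_, 1, one_mem _, rfl⟩
  refine ⟨w * c, fun b hb => ?_, c⁻¹, inv_mem hc, by simp⟩
  simp only at hmin
  rw [hmin, mul_assoc]
  exact Nat.sInf_le ⟨c * b, mul_mem hc hb, rfl⟩

theorem IsMin.eq_of_mul_eq (hm : 1 ≤ m) {J : Finset (Fin m)} {y y' b b' : W m} (hy : IsMin J y)
    (hy' : IsMin J y') (hb : b ∈ parabolic J) (hb' : b' ∈ parabolic J)
    (h : y * b = y' * b') : y = y' ∧ b = b' := by
  have h1 : y' = y * (b * b'⁻¹) := by rw [← mul_assoc, h]; simp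
  have hc := mul_mem hb (inv_mem hb')
  have h2 := hy.length_mul hm hc
  have h3 := hy' _ (inv_mem hc)
  rw [← h1] at h2
  have h4 : y' * (b * b'⁻¹)⁻¹ = y := by rw [h1]; group
  rw [h4] at h3
  have h5 := eq_one_of_length_eq_zero hm hc (by omega)
  rw [h5, mul_one] at h1
  exact ⟨h1.symm, mul_inv_eq_one.1 h5⟩

theorem isMin_iff (hm : 1 ≤ m) {J : Finset (Fin m)} {y : W m} :
    IsMin J y ↔ ∀ j ∈ J, ¬ Desc y j.succ := by
  refine ⟨fun h j => h.not_desc hm, fun h => ?_⟩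
  obtain ⟨z, hz, b, hb, rfl⟩ := exists_isMin_mul J y
  obtain ⟨l, hl, rfl, hlen⟩ := exists_word_parabolic hm hb
  rcases List.eq_nil_or_concat' l with rfl | ⟨l, j, rfl⟩
  · simpa using hz
  exfalso
  refine h j (hl j (by simp)) ?_
  have hl' : ∀ i ∈ l, i ∈ J := fun i hi => hl i (by simp [hi])
  rw [desc_iff_length_lt hm, hz.length_mul hm hb, ← hlen, sAff_succ]
  have h1 : z * ((l ++ [j]).map s).prod * s j = z * (l.map s).prod := by
    simp [mul_assoc, s_mul_self]
  have h2 := length_le (isExpr_map_succ l)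
  rw [h1, hz.length_mul hm (prod_mem_parabolic hl')]
  simp at h2 ⊢
  omega

theorem mem_dcoset {K J : Finset (Fin m)} {d w : W m} :
    w ∈ dcoset K J d ↔ ∃ u ∈ parabolic K, ∃ b ∈ parabolic J, w = u * d * b :=
  DoubleCoset.mem_doubleCoset

theorem isMin_of_mem_D {K J : Finset (Fin m)} {d : W m} (hd : d ∈ D K J) : IsMin J d :=
  fun b hb => hd _ (mem_dcoset.2 ⟨1, one_mem _, b, hb, by simp⟩)

theorem isMin_inv_of_mem_D (hm : 1 ≤ m) {K J : Finset (Fin m)} {d : W m} (hd : d ∈ D K J) :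
    IsMin K d⁻¹ := fun u hu => by
  rw [length_inv hm, ← length_inv hm (d⁻¹ * u)]
  exact hd _ (mem_dcoset.2 ⟨u⁻¹, inv_mem hu, 1, one_mem _, by simp⟩)

theorem parabolic_empty : parabolic (∅ : Finset (Fin m)) = ⊥ := by
  simp [parabolic]

theorem mem_DIn_iff {K L : Finset (Fin m)} {a : W m} :
    a ∈ DIn K ∅ L ↔ a ∈ parabolic K ∧ IsMin L a := by
  refine and_congr_right fun _ => ⟨isMin_of_mem_D, fun h w hw => ?_⟩
  obtain ⟨u, hu, b, hb, rfl⟩ := mem_dcoset.1 hw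
  rw [parabolic_empty, Subgroup.mem_bot] at hu
  simpa [hu] using h b hb

theorem IsMin.length_mul_left (hm : 1 ≤ m) {K : Finset (Fin m)} {y u : W m} (hy : IsMin K y⁻¹)
    (hu : u ∈ parabolic K) : length (u * y) = length u + length y := by
  rw [← length_inv hm, mul_inv_rev, hy.length_mul hm (inv_mem hu), length_inv hm, length_inv hm,
    add_comm]

/-- Since j is no descent of d, exchange acts on the word of u and shows d s_j d⁻¹ ∈ W_K. Comparing
the length of (d s_j d⁻¹) d = d s_j with that of d, this element has length 1, so it is a simple
reflection in K. -/
theorem exists_conj_eq_of_desc (hm : 1 ≤ m) {K J : Finset (Fin m)} {d u : W m} (hd : d ∈ D K J)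
    (hu : u ∈ parabolic K) {j : Fin m} (hj : j ∈ J) (h : Desc (u * d) j.succ) :
    ∃ i ∈ K, d⁻¹ * s i * d = s j := by
  have h1 := (isMin_of_mem_D hd).not_desc hm hj
  obtain ⟨l, hl, hul, -⟩ := exists_word_parabolic hm hu
  obtain ⟨l₁, c, l₂, h2, h3⟩ := exchange hm (hul ▸ isExpr_map_succ l) h1 h
  obtain ⟨k₁, k₂', rfl, rfl, h4⟩ := List.map_eq_append_iff.1 h2
  obtain ⟨i, k₂, rfl, rfl, rfl⟩ := List.map_eq_cons_iff.1 h4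
  have h5 : u * (d * sAff j.succ * d⁻¹) ∈ parabolic K := by
    simp only [IsExpr, zpow_zero, mul_one] at h3
    rw [h3, ← List.map_append, ← prod_map_s]
    exact prod_mem_parabolic fun i hi => hl i (by simp at hi ⊢; tauto)
  rw [Subgroup.mul_mem_cancel_left _ hu, sAff_succ] at h5
  have h6 := (isMin_inv_of_mem_D hm hd).length_mul_left hm h5
  rw [inv_mul_cancel_right, ← sAff_succ, length_mul_sAff_of_not_desc hm h1] at h6
  obtain ⟨l', hl', h7, h8⟩ := exists_word_parabolic hm h5
  rw [sAff_succ] at h6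
  obtain ⟨i', rfl⟩ := List.length_eq_one_iff.1 (show l'.length = 1 by omega)
  refine ⟨i', hl' i' (by simp), ?_⟩
  have h9 : d * s j * d⁻¹ = s i' := by simpa using h7
  rw [← h9]; group

/-- A descent j ∈ J of a d would come from some i ∈ K ∩ dJ with a d s_j = a s_i d, making a s_i
shorter than a. -/
theorem isMin_mul (hm : 1 ≤ m) {K J : Finset (Fin m)} {d a : W m} (hd : d ∈ D K J)
    (ha : a ∈ DIn K ∅ (interConj K d J)) : IsMin J (a * d) := by
  obtain ⟨haK, ha⟩ := mem_DIn_iff.1 ha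
  refine (isMin_iff hm).2 fun j hj h => ?_
  obtain ⟨i, hi, hij⟩ := exists_conj_eq_of_desc hm hd haK hj h
  have hiL : i ∈ interConj K d J := by
    classical
    exact Finset.mem_filter.2 ⟨hi, j, hj, hij⟩
  have h1 : a * d * sAff j.succ = a * s i * d := by rw [sAff_succ, ← hij]; group
  have hd' := isMin_inv_of_mem_D hm hd
  rw [desc_iff_length_lt hm, h1, hd'.length_mul_left hm haK,
    hd'.length_mul_left hm (mul_mem haK (s_mem_parabolic hi))] at h
  have := ha _ (s_mem_parabolic hiL)
  omega

theorem length_mul_mul (hm : 1 ≤ m) {K J : Finset (Fin m)} {d a b : W m} (hd : d ∈ D K J)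
    (ha : a ∈ DIn K ∅ (interConj K d J)) (hb : b ∈ parabolic J) :
    length (a * d * b) = length (a * d) + length b ∧
      length (a * d) = length a + length d :=
  ⟨(isMin_mul hm hd ha).length_mul hm hb, (isMin_inv_of_mem_D hm hd).length_mul_left hm ha.1⟩

theorem conj_mem_parabolic {K J : Finset (Fin m)} {d c : W m}
    (hc : c ∈ parabolic (interConj K d J)) : d⁻¹ * c * d ∈ parabolic J := by
  have h : parabolic (interConj K d J) ≤
      (parabolic J).comap (MulAut.conj d⁻¹).toMonoidHom := by
    refine (Subgroup.closure_le _).2 ?_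
    rintro _ ⟨i, hi, rfl⟩
    classical
    obtain ⟨-, j, hj, hij⟩ := Finset.mem_filter.1 (show i ∈ interConj K d J from hi)
    simpa [hij] using s_mem_parabolic hj
  simpa using h hc

/-- The factor of u in W_{K ∩ dJ} passes through d and is absorbed into W_J. -/
theorem mem_dcoset_iff {K J : Finset (Fin m)} {d w : W m} :
    w ∈ dcoset K J d ↔ ∃ a ∈ DIn K ∅ (interConj K d J), ∃ b ∈ parabolic J, w = a * d * b := by
  rw [mem_dcoset]
  constructor
  · rintro ⟨u, hu, b, hb, rfl⟩
    obtain ⟨a, ha, c, hc, rfl⟩ := exists_isMin_mul (interConj K d J) u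
    have hcK : c ∈ parabolic K := parabolic_mono (Finset.filter_subset _ _) hc
    refine ⟨a, mem_DIn_iff.2 ⟨(Subgroup.mul_mem_cancel_right _ hcK).1 hu, ha⟩, d⁻¹ * c * d * b,
      mul_mem (conj_mem_parabolic hc) hb, by group⟩
  · rintro ⟨a, ha, b, hb, rfl⟩
    exact ⟨a, ha.1, b, hb, rfl⟩

theorem finite_parabolic (J : Finset (Fin m)) : (parabolic J : Set (W m)).Finite := by
  refine (Set.finite_range (SemidirectProduct.inr :
    Equiv.Perm (Fin (m + 1)) →* W m)).subset ?_
  rw [← MonoidHom.coe_range]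
  refine (Subgroup.closure_le _).2 ?_
  rintro _ ⟨i, _, rfl⟩
  exact ⟨_, rfl⟩

theorem finite_DIn (K L : Finset (Fin m)) : (DIn K ∅ L).Finite :=
  (finite_parabolic K).subset fun _ h => h.1

theorem finite_dcoset (K J : Finset (Fin m)) (d : W m) : (dcoset K J d).Finite := by
  refine (((finite_parabolic K).prod (finite_parabolic J)).image
    fun p => p.1 * d * p.2).subset fun w hw => ?_
  obtain ⟨u, hu, b, hb, rfl⟩ := mem_dcoset.1 hw
  exact ⟨(u, b), ⟨hu, hb⟩, rfl⟩

/-! ### The Iwahori-Matsumoto relations in the Hecke algebra -/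

section Hecke

variable {k : Type*} [Field k] {q r : k}

theorem T_quad (q : k) (i : Fin m) :
    (T q i - algebraMap k _ q) * (T q i + 1) = 0 := by
  have h := toHecke_rel (q := q) (Rel.quad i)
  simpa [map_mul, map_sub, map_add, T] using h

theorem T_mul_self (q : k) (i : Fin m) : T q i * T q i = (q - 1) • T q i + algebraMap k _ q := by
  have h := T_quad q i
  rw [sub_mul, mul_add, mul_add, mul_one, mul_one, ← Algebra.smul_def, sub_eq_zero] at h
  rw [sub_smul, one_smul, eq_sub_of_add_eq h]; abel

theorem T_comm (q : k) {i j : Fin m} (h : (i : ℕ) + 1 < j ∨ (j : ℕ) + 1 < i) :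
    T q i * T q j = T q j * T q i := by
  simpa [T] using toHecke_rel (q := q) (Rel.comm i j h)

theorem T_braid (q : k) {i j : Fin m} (h : (j : ℕ) = i + 1) :
    T q i * T q j * T q i = T q j * T q i * T q j := by
  simpa [T] using toHecke_rel (q := q) (Rel.braid i j h)

theorem T_X_comm (q : k) {i : Fin m} {j : Fin (m + 1)} (h₁ : j ≠ i.castSucc) (h₂ : j ≠ i.succ) :
    T q i * (XH q j : (Hecke q m)ˣ) = (XH q j : (Hecke q m)ˣ) * T q i := by
  simpa [T, XH] using toHecke_rel (q := q) (Rel.T_X_comm i j h₁ h₂)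

theorem T_X_T (q : k) (i : Fin m) :
    T q i * (XH q i.castSucc : (Hecke q m)ˣ) * T q i =
      algebraMap k _ q * (XH q i.succ : (Hecke q m)ˣ) := by
  simpa [T, XH] using toHecke_rel (q := q) (Rel.T_X_T i)

theorem T_mul_sub (q : k) (i : Fin m) :
    T q i * (T q i - (q - 1) • 1) = algebraMap k _ q := by
  rw [mul_sub, T_mul_self, mul_smul_comm, mul_one]; abel

/-- A nonzero scalar, as a unit of `ℋ`. -/
def scalarUnit (q : k) (m : ℕ) {c : k} (hc : c ≠ 0) : (Hecke q m)ˣ :=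
  Units.map (algebraMap k (Hecke q m) : k →* Hecke q m) (Units.mk0 c hc)

theorem scalarUnit_val (q : k) (m : ℕ) {c : k} (hc : c ≠ 0) :
    (scalarUnit q m hc : Hecke q m) = algebraMap k _ c := rfl

theorem scalarUnit_comm {c : k} (hc : c ≠ 0) (u : (Hecke q m)ˣ) :
    scalarUnit q m hc * u = u * scalarUnit q m hc := by
  ext; exact Algebra.commutes _ _

/-- `T_i` as a unit. -/
def TU (hq : q ≠ 0) (i : Fin m) : (Hecke q m)ˣ where
  val := T q i
  inv := q⁻¹ • (T q i - (q - 1) • 1)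
  val_inv := by
    rw [mul_smul_comm, T_mul_sub, Algebra.algebraMap_eq_smul_one, smul_smul, inv_mul_cancel₀ hq,
      one_smul]
  inv_val := by
    have : T q i * (T q i - (q - 1) • 1) = (T q i - (q - 1) • 1) * T q i := by
      rw [mul_sub, sub_mul, mul_smul_comm, smul_mul_assoc, mul_one, one_mul]
    rw [smul_mul_assoc, ← this, T_mul_sub, Algebra.algebraMap_eq_smul_one, smul_smul,
      inv_mul_cancel₀ hq, one_smul]

theorem TU_val (hq : q ≠ 0) (i : Fin m) : (TU hq i : Hecke q m) = T q i := rfl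

theorem extendOne_of_lt {G : Type*} [Group G] {n : ℕ} (t : Fin n → G) {i : ℕ} (h : i < n) :
    extendOne t i = t ⟨i, h⟩ := by
  simp [extendOne, h]

theorem bernsteinRel_hecke (hq : q ≠ 0) (m : ℕ) :
    BernsteinRel m (extendOne (TU (m := m) hq)) (extendOne (XH q)) (scalarUnit q m hq) where
  comm i j hij hj := by
    rw [extendOne_of_lt _ hj, extendOne_of_lt _ (by omega)]
    exact Units.ext (T_comm q (Or.inl hij))
  braid i hi := by
    rw [extendOne_of_lt _ hi, extendOne_of_lt _ (by omega)]
    exact Units.ext (T_braid q rfl)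
  xcomm i j hi hj := by
    rw [extendOne_of_lt _ (Nat.lt_succ_of_le hi), extendOne_of_lt _ (Nat.lt_succ_of_le hj)]
    exact XH_commute q _ _
  txcomm i j hi hj h1 h2 := by
    rw [extendOne_of_lt _ (Nat.lt_succ_of_le hj), extendOne_of_lt _ hi]
    exact Units.ext (T_X_comm q (by simpa [Fin.ext_iff]) (by simpa [Fin.ext_iff]))
  txt i hi := by
    rw [extendOne_of_lt _ hi, extendOne_of_lt _ (by omega), extendOne_of_lt _ (by omega)]
    exact Units.ext (T_X_T q ⟨i, hi⟩)
  central u := scalarUnit_comm hq u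

/-- `T_{n-1} ⋯ T_1 X_1` as a unit. -/
def tauUnit (hq : q ≠ 0) (m : ℕ) : (Hecke q m)ˣ :=
  descProd (extendOne (TU hq)) m * extendOne (XH q) 0

theorem prod_ofFn_TU (hq : q ≠ 0) (m : ℕ) :
    (List.ofFn (T (m := m) q)) = (List.ofFn (TU (m := m) hq)).map (Units.coeHom _) := by
  rw [List.map_ofFn]; rfl

theorem Ttau_eq (hr : r ≠ 0) (hq : q ≠ 0) (m : ℕ) :
    Ttau q r m = (scalarUnit q m (inv_ne_zero (pow_ne_zero m hr)) * tauUnit hq m :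
      (Hecke q m)ˣ) := by
  rw [Ttau, prod_ofFn_TU hq, ← List.map_reverse, ← map_list_prod, prod_reverse_ofFn, tauUnit,
    extendOne_of_lt _ (Nat.succ_pos m), Units.val_mul, Units.val_mul, scalarUnit_val,
    ← Algebra.smul_def]
  rfl

theorem T0_eq (hq : q ≠ 0) (hm : 1 ≤ m) :
    T0 q m = (tauUnit hq m * TU hq ⟨0, hm⟩ * (tauUnit hq m)⁻¹ : (Hecke q m)ˣ) := by
  have h := (bernsteinRel_hecke hq m).tau_conj_zero hm
  rw [tauUnit, ← extendOne_of_lt (TU hq) hm, h, T0, prod_ofFn_TU hq, ← List.map_reverse,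
    ← List.map_tail, ← map_list_prod, ← map_list_prod, prod_reverse_ofFn, prod_tail_ofFn hm,
    ← map_mul, Units.coeHom_apply, Ring.inverse_unit, extendOne_of_lt _ (Nat.succ_pos m),
    extendOne_of_lt _ (Nat.lt_succ_self m), Units.val_mul, Units.val_mul, Units.val_mul,
    Units.val_pow_eq_pow_val,    scalarUnit_val, Algebra.smul_def, map_pow]
  simp only [Units.val_mul, mul_assoc]
  rfl

theorem tauUnit_mul_TAff (hq : q ≠ 0) (hm : 1 ≤ m) (a : Fin (m + 1)) :
    (tauUnit hq m : Hecke q m) * TAff q a = TAff q (rot m a) * tauUnit hq m := by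
  refine mul_cases_eq hm _ _ _ (fun i j hij => ?_) (fun i hi => ?_) (fun i hi => ?_) a
  · have h := (bernsteinRel_hecke hq m).tau_mul_succ (i := i) (by omega)
    rw [extendOne_of_lt (TU hq) i.2, extendOne_of_lt (TU hq) (hij ▸ j.2)] at h
    have hj : j = ⟨i + 1, hij ▸ j.2⟩ := Fin.ext hij
    rw [hj]
    exact congrArg Units.val h
  · obtain rfl : i = ⟨0, hm⟩ := Fin.ext hi
    rw [T0_eq hq hm, ← Units.val_mul, inv_mul_cancel_right]; rfl
  · have h2 := (bernsteinRel_hecke hq m).tau_sq_zero hm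
    have h3 : m - 1 = i := by omega
    rw [h3, extendOne_val, extendOne_of_lt _ hm, ← tauUnit] at h2
    rw [T0_eq hq hm, ← TU_val hq i, ← Units.val_mul, ← Units.val_mul]
    congr 1
    rw [← mul_assoc, mul_inv_eq_iff_eq_mul, h2]

/-- `T_τ` as a unit. -/
def TtauU (hr : r ≠ 0) (hq : q ≠ 0) (m : ℕ) : (Hecke q m)ˣ :=
  scalarUnit q m (inv_ne_zero (pow_ne_zero m hr)) * tauUnit hq m

theorem TtauPow_eq (hr : r ≠ 0) (hq : q ≠ 0) (e : ℤ) :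
    TtauPow q r m e = (TtauU hr hq m ^ e : (Hecke q m)ˣ) := by
  cases e with
  | ofNat a => simp [TtauPow, Ttau_eq hr hq, TtauU]
  | negSucc a =>
    simp only [TtauPow, Ttau_eq hr hq, Ring.inverse_unit, TtauU, zpow_negSucc, ← inv_pow,
      Units.val_pow_eq_pow_val]

theorem TtauU_mul_TAff (hr : r ≠ 0) (hq : q ≠ 0) (hm : 1 ≤ m) (a : Fin (m + 1)) :
    (TtauU hr hq m : Hecke q m) * TAff q a = TAff q (rot m a) * TtauU hr hq m := by
  rw [TtauU, Units.val_mul, mul_assoc, tauUnit_mul_TAff hq hm, scalarUnit_val, Algebra.commutes,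
    mul_assoc, ← Algebra.commutes]

theorem TAff_eq_conj (hq : q ≠ 0) (hm : 1 ≤ m) (a : Fin (m + 1)) :
    TAff q a = (tauUnit hq m : Hecke q m) * TAff q (a + 1) * (↑(tauUnit hq m)⁻¹ : Hecke q m) := by
  rw [tauUnit_mul_TAff hq hm, rot_add_one, Units.mul_inv_cancel_right]

theorem TAff_succ (q : k) (i : Fin m) : TAff q i.succ = T q i := rfl

theorem conj_mul {M : Type*} [Monoid M] (u : Mˣ) (x y : M) :
    (u : M) * x * ↑u⁻¹ * (u * y * ↑u⁻¹) = u * (x * y) * ↑u⁻¹ := by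
  simp [mul_assoc]

/-- Conjugation by τ raises both indices by one. If one of them is 0, then after the shift neither
is, because a and b are not adjacent. -/
theorem TAff_comm (hq : q ≠ 0) (hm : 1 ≤ m) {a b : Fin (m + 1)} (hab : a ≠ b) (h1 : b ≠ a + 1)
    (h2 : a ≠ b + 1) : TAff q a * TAff q b = TAff q b * TAff q a := by
  have key : ∀ {a b : Fin (m + 1)}, a ≠ b → b ≠ a + 1 → a ≠ b + 1 → a ≠ 0 → b ≠ 0 →
      TAff q a * TAff q b = TAff q b * TAff q a := by
    intro a b hab h1 h2 ha hb
    obtain ⟨i, rfl⟩ := Fin.exists_succ_eq.2 ha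
    obtain ⟨j, rfl⟩ := Fin.exists_succ_eq.2 hb
    rw [TAff_succ, TAff_succ]
    apply T_comm
    have h1' : (j : ℕ) ≠ i + 1 := fun h => h1 <| by
      rw [show i.succ = j.castSucc from Fin.ext (by simp [h])]
      exact rot_eq_iff.1 (rot_succ j)
    have h2' : (i : ℕ) ≠ j + 1 := fun h => h2 <| by
      rw [show j.succ = i.castSucc from Fin.ext (by simp [h])]
      exact rot_eq_iff.1 (rot_succ i)
    have : (i : ℕ) ≠ j := fun h => hab (by rw [Fin.ext h])
    omega
  have hne : ∀ {a b : Fin (m + 1)}, a ≠ b → a + 1 ≠ b + 1 := fun h h' => h (add_right_cancel h')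
  by_cases h0 : a ≠ 0 ∧ b ≠ 0
  · exact key hab h1 h2 h0.1 h0.2
  · have h3 : a + 1 ≠ 0 ∧ b + 1 ≠ 0 := by
      have h10 : (0 : Fin (m + 1)) + 1 ≠ 0 := add_one_ne hm 0
      rw [not_and_or, not_not, not_not] at h0
      rcases h0 with rfl | rfl
      · exact ⟨h10, fun h => h2 h.symm⟩
      · exact ⟨fun h => h1 h.symm, h10⟩
    rw [TAff_eq_conj hq hm a, TAff_eq_conj hq hm b, conj_mul, conj_mul,
      key (hne hab) (hne h1) (hne h2) h3.1 h3.2]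

/-- The pair (0, 1) is reached from (1, 2) by one conjugation with τ, and the pair (m, 0) from (0,
1) by another. -/
theorem TAff_braid (hq : q ≠ 0) (hm : 2 ≤ m) (a : Fin (m + 1)) :
    TAff q a * TAff q (a + 1) * TAff q a = TAff q (a + 1) * TAff q a * TAff q (a + 1) := by
  have hm' : 1 ≤ m := by omega
  have key : ∀ a : Fin (m + 1), a ≠ 0 → a + 1 ≠ 0 →
      TAff q a * TAff q (a + 1) * TAff q a = TAff q (a + 1) * TAff q a * TAff q (a + 1) := by
    intro a ha hb
    obtain ⟨i, rfl⟩ := Fin.exists_succ_eq.2 ha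
    obtain ⟨j, hj⟩ := Fin.exists_succ_eq.2 hb
    rw [← hj, TAff_succ, TAff_succ]
    apply T_braid
    have := congrArg (rot m) hj
    rw [rot_succ, rot_add_one] at this
    simpa using congrArg Fin.val this
  have step : ∀ a : Fin (m + 1),
      TAff q (a + 1) * TAff q (a + 1 + 1) * TAff q (a + 1) =
        TAff q (a + 1 + 1) * TAff q (a + 1) * TAff q (a + 1 + 1) →
      TAff q a * TAff q (a + 1) * TAff q a = TAff q (a + 1) * TAff q a * TAff q (a + 1) := by
    intro a h
    have e1 := TAff_eq_conj hq hm' a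
    have e2 := TAff_eq_conj hq hm' (a + 1)
    set u := tauUnit hq m
    calc _ = ((u : Hecke q m) * TAff q (a + 1) * ↑u⁻¹) * ((u : Hecke q m) * TAff q (a + 1 + 1) * ↑u⁻¹) *
          ((u : Hecke q m) * TAff q (a + 1) * (↑u⁻¹ : Hecke q m)) := by rw [← e1, ← e2]
      _ = ((u : Hecke q m) * TAff q (a + 1 + 1) * ↑u⁻¹) * ((u : Hecke q m) * TAff q (a + 1) * ↑u⁻¹) *
          ((u : Hecke q m) * TAff q (a + 1 + 1) * (↑u⁻¹ : Hecke q m)) := by simp only [conj_mul, h]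
      _ = _ := by rw [← e1, ← e2]
  have h0 : TAff q 0 * TAff q (0 + 1) * TAff q (0 : Fin (m + 1)) =
      TAff q (0 + 1) * TAff q 0 * TAff q (0 + 1) := by
    refine step 0 (key _ (add_one_ne hm' 0) fun h => ?_)
    have := rot_ne_add_one hm (0 : Fin (m + 1))
    exact this (rot_eq_iff.2 h.symm)
  by_cases ha : a = 0
  · subst ha; exact h0
  by_cases hb : a + 1 = 0
  · exact step a (by rw [hb]; exact h0)
  exact key a ha hb

/-! ### The elements `T_w` -/

/-- The independence of T_w from the choice in `reducedExpr`: the degree fixes the exponent of τ,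
and Matsumoto's theorem takes care of the word. -/
theorem Tw_eq (hr : r ≠ 0) (hq : q ≠ 0) (hm : 1 ≤ m) {w : W m} {l : List (Fin (m + 1))} {e : ℤ}
    (hw : IsExpr w (l, e)) (hl : l.length = length w) :
    Tw q r w = (l.map (TAff q)).prod * (TtauU hr hq m ^ e : (Hecke q m)ˣ) := by
  have hspec : IsExpr w (reducedExpr w) ∧ (reducedExpr w).1.length = length w :=
    Classical.epsilon_spec (p := fun e : List (Fin (m + 1)) × ℤ => IsExpr w e ∧ e.1.length = length w)
      ⟨(l, e), hw, hl⟩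
  obtain ⟨h1, h2⟩ := hspec
  rw [Tw, TtauPow_eq hr hq]
  generalize reducedExpr w = x at h1 h2
  obtain ⟨l', e'⟩ := x
  obtain rfl : e = e' := Multiplicative.ofAdd.injective
    ((deg_of_isExpr hm hw).symm.trans (deg_of_isExpr hm h1))
  simp only [IsExpr] at hw h1 h2
  have h3 : (l.map sAff).prod = ((l'.map sAff).prod : W m) := mul_right_cancel (hw.symm.trans h1)
  have h4 : length ((l.map sAff).prod : W m) = l.length := by
    refine le_antisymm (length_prod_le l) ?_
    obtain ⟨y, hy, hyl⟩ := exists_word hm (deg_prod hm l)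
    rw [← hyl, hl]
    exact length_le (e := e) (by rw [IsExpr, ← hy, hw])
  rw [matsumoto hm (TAff q) (fun a b => TAff_comm hq hm) (fun h => TAff_braid hq h) l.length l l'
    rfl (h2.trans hl.symm) h3 h4]

theorem Tw_mul (hr : r ≠ 0) (hq : q ≠ 0) (hm : 1 ≤ m) {x y : W m}
    (h : length (x * y) = length x + length y) : Tw q r (x * y) = Tw q r x * Tw q r y := by
  obtain ⟨l, e, hx, hl⟩ := exists_reduced hm x
  obtain ⟨l', e', hy, hl'⟩ := exists_reduced hm y
  have hxy : IsExpr (x * y) (l ++ l'.map (rot m ^ e), e + e') := by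
    simp only [IsExpr] at *
    rw [hx, hy, List.map_append, List.prod_append, zpow_add, mul_assoc, ← mul_assoc (tau m ^ e),
      tau_zpow_mul_prod hm]
    simp only [mul_assoc]
  have hτ : ∀ l' : List (Fin (m + 1)), (↑(TtauU hr hq m ^ e) : Hecke q m) *
      (l'.map (TAff q)).prod =
        ((l'.map (rot m ^ e)).map (TAff q)).prod * (TtauU hr hq m ^ e : (Hecke q m)ˣ) := by
    intro l'
    induction l' with
    | nil => simp
    | cons a l' ih =>
      rw [List.map_cons, List.prod_cons, ← mul_assoc,
        units_zpow_mul _ _ _ (TtauU_mul_TAff hr hq hm), mul_assoc, ih]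
      simp [mul_assoc]
  rw [Tw_eq hr hq hm hx hl, Tw_eq hr hq hm hy hl', Tw_eq hr hq hm hxy (by simp [hl, hl', h]),
    List.map_append, List.prod_append, zpow_add, Units.val_mul]
  rw [mul_assoc, mul_assoc, ← mul_assoc _ (List.map (TAff q) l').prod, hτ]
  simp only [mul_assoc]

theorem Tw_one (hr : r ≠ 0) (hq : q ≠ 0) (hm : 1 ≤ m) : Tw q r (1 : W m) = 1 := by
  have h : IsExpr (1 : W m) ([], 0) := by simp [IsExpr]
  rw [Tw_eq hr hq hm h (Nat.le_zero.1 (length_le h)).symm]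
  simp

theorem length_s (hm : 1 ≤ m) (i : Fin m) : length (s i) = 1 := by
  have h : ¬ Desc (1 : W m) i.succ := by
    rw [Desc, act_one, act_one]; exact (lo_lt_hi _).asymm
  have h1 := length_mul_sAff_of_not_desc hm h
  have h2 : length (1 : W m) = 0 :=
    Nat.le_zero.1 (length_le (l := []) (e := 0) (by simp [IsExpr]))
  rwa [one_mul, sAff_succ, h2] at h1

theorem Tw_s (hr : r ≠ 0) (hq : q ≠ 0) (hm : 1 ≤ m) (i : Fin m) : Tw q r (s i) = T q i := by
  rw [Tw_eq hr hq hm (l := [i.succ]) (e := 0) (by simp [IsExpr, sAff_succ]) (by simp [length_s hm])]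
  simp [TAff_succ]

end Hecke

/-! ### Sums over cosets and the homomorphisms `b^d_{K,J}` -/

theorem finsum_mem_mul_finsum_mem {α β γ R : Type*} [Semiring R] {A : Set α} {B : Set β}
    {C : Set γ} {f : α → R} {g : β → R} {h : γ → R} (e : α → β → γ) (hA : A.Finite)
    (hB : B.Finite) (he : Set.BijOn (fun p : α × β => e p.1 p.2) (A ×ˢ B) C)
    (heq : ∀ a ∈ A, ∀ b ∈ B, h (e a b) = f a * g b) :
    ∑ᶠ c ∈ C, h c = (∑ᶠ a ∈ A, f a) * ∑ᶠ b ∈ B, g b := by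
  rw [← finsum_mem_eq_of_bijOn (f := fun p : α × β => f p.1 * g p.2) _ he
    fun p hp => (heq _ hp.1 _ hp.2).symm]
  rw [← hA.coe_toFinset, ← hB.coe_toFinset, ← Finset.coe_product, finsum_mem_coe_finset,
    finsum_mem_coe_finset, finsum_mem_coe_finset, Finset.sum_mul_sum, Finset.sum_product]

section Hecke

variable {k : Type*} [Field k] {q r : k} (hr : r ≠ 0) (hq : q ≠ 0) (hm : 1 ≤ m)
include hr hq hm

theorem finsum_Tw_mul_right {A : Set (W m)} (hA : A.Finite) (J : Finset (Fin m))
    (hJ : ∀ w ∈ A, ∀ b ∈ parabolic J, w * b ∈ A) :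
    ∑ᶠ w ∈ A, Tw q r w = (∑ᶠ y ∈ {y | y ∈ A ∧ IsMin J y}, Tw q r y) * v q r J := by
  refine finsum_mem_mul_finsum_mem (fun y b => y * b) (hA.subset fun _ h => h.1)
    (finite_parabolic J) ⟨?_, ?_, ?_⟩ fun y hy b hb => Tw_mul hr hq hm (hy.2.length_mul hm hb)
  · rintro ⟨y, b⟩ ⟨hy, hb⟩; exact hJ y hy.1 b hb
  · rintro ⟨y, b⟩ ⟨hy, hb⟩ ⟨y', b'⟩ ⟨hy', hb'⟩ h
    exact Prod.ext_iff.2 (hy.2.eq_of_mul_eq hm hy'.2 hb hb' h)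
  · intro w hw
    obtain ⟨y, hy, b, hb, rfl⟩ := exists_isMin_mul J w
    refine ⟨(y, b), ⟨⟨?_, hy⟩, hb⟩, rfl⟩
    simpa using hJ _ hw _ (inv_mem hb)

theorem finsum_Tw_mul_left {A : Set (W m)} (hA : A.Finite) (K : Finset (Fin m))
    (hK : ∀ w ∈ A, ∀ u ∈ parabolic K, u * w ∈ A) :
    ∑ᶠ w ∈ A, Tw q r w = v q r K * ∑ᶠ y ∈ {y | y ∈ A ∧ IsMin K y⁻¹}, Tw q r y := by
  refine finsum_mem_mul_finsum_mem (fun u y => u * y) (finite_parabolic K)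
    (hA.subset fun _ h => h.1) ⟨?_, ?_, ?_⟩
    fun u hu y hy => Tw_mul hr hq hm (hy.2.length_mul_left hm hu)
  · rintro ⟨u, y⟩ ⟨hu, hy⟩; exact hK y hy.1 u hu
  · rintro ⟨u, y⟩ ⟨hu, hy⟩ ⟨u', y'⟩ ⟨hu', hy'⟩ h
    have h' : y⁻¹ * u⁻¹ = y'⁻¹ * u'⁻¹ := by
      rw [← mul_inv_rev, ← mul_inv_rev]; exact congrArg _ h
    have := hy.2.eq_of_mul_eq hm hy'.2 (inv_mem hu) (inv_mem hu') h'
    exact Prod.ext_iff.2 ⟨inv_injective this.2, inv_injective this.1⟩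
  · intro w hw
    obtain ⟨y, hy, b, hb, h⟩ := exists_isMin_mul K w⁻¹
    obtain rfl : w = b⁻¹ * y⁻¹ := by rw [← mul_inv_rev, ← h, inv_inv]
    refine ⟨(b⁻¹, y⁻¹), ⟨inv_mem hb, ?_, by rwa [inv_inv]⟩, rfl⟩
    simpa using hK _ hw _ hb

/-- The factorisation w = a d b is unique with additive lengths, so T_w = T_a T_d T_b. As a left
multiple of v_J, the sum is the image of v_J under a left multiplication, which is how b^d_{K,J}
arises. -/
theorem finsum_Tw_dcoset {K J : Finset (Fin m)} {d : W m} (hd : d ∈ D K J) :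
    ∑ᶠ w ∈ dcoset K J d, Tw q r w =
      (∑ᶠ a ∈ DIn K ∅ (interConj K d J), Tw q r a * Tw q r d) * v q r J := by
  refine finsum_mem_mul_finsum_mem (fun a b => a * d * b) (finite_DIn _ _) (finite_parabolic J)
    ⟨?_, ?_, ?_⟩ fun a ha b hb => ?_
  · rintro ⟨a, b⟩ ⟨ha, hb⟩; exact mem_dcoset_iff.2 ⟨a, ha, b, hb, rfl⟩
  · rintro ⟨a, b⟩ ⟨ha, hb⟩ ⟨a', b'⟩ ⟨ha', hb'⟩ h
    have := (isMin_mul hm hd ha).eq_of_mul_eq hm (isMin_mul hm hd ha') hb hb' h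
    exact Prod.ext_iff.2 ⟨mul_right_cancel this.1, this.2⟩
  · intro w hw
    obtain ⟨a, ha, b, hb, rfl⟩ := mem_dcoset_iff.1 hw
    exact ⟨(a, b), ⟨ha, hb⟩, rfl⟩
  · obtain ⟨h1, h2⟩ := length_mul_mul hm hd ha hb
    rw [Tw_mul hr hq hm h1, Tw_mul hr hq hm h2]

/-- Here the double coset is cut into left W_K-orbits, which extracts v_K on the left. -/
theorem finsum_Tw_dcoset_mem (K J : Finset (Fin m)) (d : W m) :
    ∑ᶠ w ∈ dcoset K J d, Tw q r w ∈ vIdeal q r K := by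
  rw [finsum_Tw_mul_left hr hq hm (finite_dcoset K J d) K]
  · exact Submodule.mem_span_singleton.2 ⟨MulOpposite.op _, rfl⟩
  · intro w hw u hu
    obtain ⟨u', hu', b, hb, rfl⟩ := mem_dcoset.1 hw
    exact mem_dcoset.2 ⟨u * u', mul_mem hu hu', b, hb, by simp only [mul_assoc]⟩

theorem v_singleton (i : Fin m) : v q r {i} = 1 + T q i := by
  have h : (parabolic {i} : Set (W m)) = {1, s i} := by
    ext w
    constructor
    · intro hw
      induction hw using Subgroup.closure_induction with
      | mem x hx => obtain ⟨j, hj, rfl⟩ := hx; simp at hj; simp [hj]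
      | one => simp
      | mul x y _ _ hx hy =>
        rcases hx with rfl | rfl <;> rcases hy with rfl | rfl <;> simp [s_mul_self]
      | inv x _ hx =>
        rcases hx with rfl | rfl
        · simp
        · rw [inv_eq_of_mul_eq_one_right (s_mul_self i)]; simp
    · rintro (rfl | rfl)
      exacts [one_mem _, s_mem_parabolic (by simp)]
  have hne : (1 : W m) ≠ s i := fun h => by
    have h1 := length_s hm i
    rw [← h] at h1
    have : length (1 : W m) ≤ 0 := length_le (l := []) (e := 0) (by simp [IsExpr])
    omega
  rw [v, h, finsum_mem_pair hne, Tw_one hr hq hm, Tw_s hr hq hm]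

/-- Factoring v_K through v_{i} = 1 + T_i reduces this to the quadratic relation. -/
theorem T_mul_v {K : Finset (Fin m)} {i : Fin m} (hi : i ∈ K) : T q i * v q r K = q • v q r K := by
  have h := finsum_Tw_mul_left hr hq hm (finite_parabolic K) {i} fun w hw u hu =>
    mul_mem (parabolic_mono (Finset.singleton_subset_iff.2 hi) hu) hw
  have h' := T_quad q i
  rw [v, h, v_singleton hr hq hm, ← mul_assoc, Algebra.smul_def, ← mul_assoc, add_comm,
    ← sub_eq_zero, ← sub_mul, ← sub_mul, h', zero_mul]

theorem v_mul_T {K : Finset (Fin m)} {i : Fin m} (hi : i ∈ K) : v q r K * T q i = q • v q r K := by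
  have h := finsum_Tw_mul_right hr hq hm (finite_parabolic K) {i} fun w hw u hu =>
    mul_mem hw (parabolic_mono (Finset.singleton_subset_iff.2 hi) hu)
  have h' : (1 + T q i) * T q i = (1 + T q i) * algebraMap k _ q := by
    have := T_quad q i
    rw [← sub_eq_zero, ← mul_sub, ← this, sub_mul, mul_add, mul_add, add_mul, mul_sub, mul_sub,
      Algebra.commutes]
    noncomm_ring
  rw [v, h, v_singleton hr hq hm, mul_assoc, h', ← mul_assoc, ← Algebra.commutes, Algebra.smul_def]

theorem exists_v_univ_eq (J : Finset (Fin m)) : ∃ h, v q r Finset.univ = v q r J * h :=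
  ⟨_, finsum_Tw_mul_left hr hq hm (finite_parabolic Finset.univ) J fun _ hw _ hu =>
    mul_mem (parabolic_mono (Finset.subset_univ J) hu) hw⟩

omit hr hq hm in
theorem mem_vIdeal {J : Finset (Fin m)} {x : Hecke q m} :
    x ∈ vIdeal q r J ↔ ∃ h, x = v q r J * h := by
  rw [vIdeal, Submodule.mem_span_singleton]
  exact ⟨fun ⟨h, hh⟩ => ⟨h.unop, hh.symm⟩, fun ⟨h, hh⟩ => ⟨MulOpposite.op h, hh.symm⟩⟩

omit hr hq hm in
/-- A homomorphism out of `v_J ℋ` is determined by the image of `v_J`. -/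
theorem hom_apply {J K : Finset (Fin m)}
    (φ : vIdeal q r J →ₗ[(Hecke q m)ᵐᵒᵖ] vIdeal q r K) (h : Hecke q m)
    (hmem : v q r J * h ∈ vIdeal q r J) :
    (φ ⟨v q r J * h, hmem⟩ : Hecke q m) = φ (vGen q r J) * h := by
  have : (⟨v q r J * h, hmem⟩ : vIdeal q r J) = MulOpposite.op h • vGen q r J := Subtype.ext rfl
  rw [this, map_smul]; rfl

omit hr hq hm in
/-- Left multiplication by `h`, as a homomorphism `v_J ℋ → v_K ℋ`. -/
def mulLeftHom {J K : Finset (Fin m)} (h : Hecke q m) (hJK : h * v q r J ∈ vIdeal q r K) :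
    vIdeal q r J →ₗ[(Hecke q m)ᵐᵒᵖ] vIdeal q r K where
  toFun x := ⟨h * x, by
    obtain ⟨y, hy⟩ := mem_vIdeal.1 x.2
    obtain ⟨z, hz⟩ := mem_vIdeal.1 hJK
    exact mem_vIdeal.2 ⟨z * y, by rw [hy, ← mul_assoc, hz, mul_assoc]⟩⟩
  map_add' x y := Subtype.ext (mul_add h (x : Hecke q m) y)
  map_smul' c x := Subtype.ext (mul_assoc h (x : Hecke q m) c.unop).symm

theorem existsUnique_isB {J K : Finset (Fin m)} {d : W m} (hd : d ∈ D K J) :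
    ∃! φ : vIdeal q r J →ₗ[(Hecke q m)ᵐᵒᵖ] vIdeal q r K, IsB d φ := by
  have h := finsum_Tw_dcoset hr hq hm hd
  have h' := finsum_Tw_dcoset_mem hr hq hm K J d
  refine ⟨mulLeftHom _ (h ▸ h'), h.symm, fun φ hφ => LinearMap.ext fun x => ?_⟩
  obtain ⟨x, hx⟩ := x
  obtain ⟨y, rfl⟩ := mem_vIdeal.1 hx
  refine Subtype.ext ?_
  rw [hom_apply, hom_apply, hφ.trans h]
  rfl

end Hecke

/-! ### The polynomial representation -/

section Hecke

variable {k : Type*} [Field k]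

/-- The variable `X_j` of the Laurent polynomial ring. -/
def xL (k : Type*) [Field k] (j : Fin (m + 1)) : Laurent k m :=
  MonoidAlgebra.single (Pi.mulSingle j (Multiplicative.ofAdd 1)) 1

theorem permAct_xL (σ : Equiv.Perm (Fin (m + 1))) (j : Fin (m + 1)) :
    permAct k σ (xL k j) = xL k (σ j) := by
  rw [xL, permAct, MonoidAlgebra.domCongr_single, mulAutArrow_mulSingle]; rfl

theorem permAct_mul (σ τ : Equiv.Perm (Fin (m + 1))) (f : Laurent k m) :
    permAct k (σ * τ) f = permAct k σ (permAct k τ f) := by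
  induction f using MonoidAlgebra.induction_linear with
  | zero => simp
  | add f g hf hg => simp only [map_add, hf, hg]
  | single a c => simp only [permAct, MonoidAlgebra.domCongr_single, map_mul]; rfl

theorem permAct_one (f : Laurent k m) : permAct k 1 f = f := by
  have h := permAct_mul 1 1 f
  rw [mul_one] at h
  exact ((permAct k 1).injective h).symm

theorem xL_injective : Function.Injective (xL k : Fin (m + 1) → Laurent k m) := by
  intro i j h
  by_contra hij
  have h1 := MonoidAlgebra.single_left_injective (one_ne_zero) h
  have h2 := congrFun h1 i
  rw [Pi.mulSingle_eq_same, Pi.mulSingle_eq_of_ne hij] at h2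
  simp at h2

theorem xL_sub_smul_ne_zero {i j : Fin (m + 1)} (hij : i ≠ j) (c : k) :
    xL k i - c • xL k j ≠ 0 := by
  intro h
  have h1 : (Pi.mulSingle i (Multiplicative.ofAdd 1) : Lattice m) ≠
      Pi.mulSingle j (Multiplicative.ofAdd 1) := fun h1 => hij <| by
    apply xL_injective (k := k); rw [xL, h1, xL]
  have h2 := congrArg (fun f : Laurent k m => f.coeff (Pi.mulSingle i (Multiplicative.ofAdd 1))) h
  simp [xL, MonoidAlgebra.coeff_sub, h1.symm] at h2

/-- The field of fractions of the Laurent polynomial ring. -/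
abbrev Frac (k : Type*) [Field k] (m : ℕ) : Type _ := FractionRing (Laurent k m)

/-- The permutation action on rational functions. -/
def permF (k : Type*) [Field k] (σ : Equiv.Perm (Fin (m + 1))) : Frac k m ≃ₐ[k] Frac k m :=
  IsFractionRing.fieldEquivOfAlgEquiv k _ _ (permAct k σ)

theorem permF_algebraMap (σ : Equiv.Perm (Fin (m + 1))) (f : Laurent k m) :
    permF k σ (algebraMap _ (Frac k m) f) = algebraMap _ _ (permAct k σ f) :=
  IsFractionRing.fieldEquivOfAlgEquiv_algebraMap _ _ _ _ _

theorem permF_mul (σ τ : Equiv.Perm (Fin (m + 1))) (f : Frac k m) :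
    permF k (σ * τ) f = permF k σ (permF k τ f) := by
  obtain ⟨a, b, -, rfl⟩ := IsFractionRing.div_surjective (A := Laurent k m) f
  simp only [map_div₀, permF_algebraMap, permAct_mul]

theorem permF_one (f : Frac k m) : permF k 1 f = f := by
  have h := permF_mul 1 1 f
  rw [mul_one] at h
  exact ((permF k 1).injective h).symm

/-- The variable `X_j` as a rational function. -/
def xF (k : Type*) [Field k] (j : Fin (m + 1)) : Frac k m := algebraMap _ _ (xL k j)

theorem permF_xF (σ : Equiv.Perm (Fin (m + 1))) (j : Fin (m + 1)) :
    permF k σ (xF k j) = xF k (σ j) := by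
  rw [xF, permF_algebraMap, permAct_xL, xF]

theorem xF_injective : Function.Injective (xF k : Fin (m + 1) → Frac k m) :=
  (IsFractionRing.injective (Laurent k m) (Frac k m)).comp xL_injective

theorem xF_ne_zero (j : Fin (m + 1)) : (xF k j : Frac k m) ≠ 0 := by
  intro h
  have h1 : xL k j = 0 := IsFractionRing.injective (Laurent k m) (Frac k m)
    (by rw [map_zero]; exact h)
  rw [xL, MonoidAlgebra.single_eq_zero] at h1
  exact one_ne_zero h1

/-- The transposition underlying `s i`. -/
abbrev sw (i : Fin m) : Equiv.Perm (Fin (m + 1)) := Equiv.swap i.castSucc i.succ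

/-- The coefficient of `s_i` in the Demazure-Lusztig operator. -/
def coefA (q : k) (i : Fin m) : Frac k m :=
  (xF k i.succ - algebraMap k _ q * xF k i.castSucc) / (xF k i.succ - xF k i.castSucc)

/-- The coefficient of `1` in the Demazure-Lusztig operator. -/
def coefB (q : k) (i : Fin m) : Frac k m :=
  (algebraMap k _ q - 1) * xF k i.succ / (xF k i.succ - xF k i.castSucc)

/-- The Demazure-Lusztig operator. -/
def opT (q : k) (i : Fin m) : Module.End k (Frac k m) :=
  Algebra.lmul k _ (coefA q i) * (permF k (sw i)).toLinearMap + Algebra.lmul k _ (coefB q i)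

theorem opT_apply (q : k) (i : Fin m) (f : Frac k m) :
    opT q i f = coefA q i * permF k (sw i) f + coefB q i * f := rfl

theorem castSucc_ne_succ' (i : Fin m) : i.castSucc ≠ i.succ := by simp [Fin.ext_iff]

theorem xF_sub_ne_zero {i j : Fin (m + 1)} (h : i ≠ j) : (xF k i - xF k j : Frac k m) ≠ 0 :=
  sub_ne_zero.2 fun h' => h (xF_injective h')

theorem permF_sw_sw (i : Fin m) (f : Frac k m) : permF k (sw i) (permF k (sw i) f) = f := by
  rw [← permF_mul, Equiv.swap_mul_self, permF_one]

/-- Over the fraction field T_i acts as A s_i + B with rational A and B. This and the following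
relations become identities of rational functions once the permutations are moved past the
coefficients. -/
theorem opT_quad (q : k) (i : Fin m) :
    (opT q i - algebraMap k _ q) * (opT q i + 1) = 0 := by
  ext1 f
  have h := xF_sub_ne_zero (k := k) (castSucc_ne_succ' i)
  have h' := xF_sub_ne_zero (k := k) (castSucc_ne_succ' i).symm
  simp only [Module.End.mul_apply, LinearMap.sub_apply, LinearMap.add_apply, Module.End.one_apply,
    opT_apply, map_add, map_mul, permF_sw_sw, coefA, coefB, map_div₀, map_sub, permF_xF,
    Equiv.swap_apply_left, Equiv.swap_apply_right, AlgEquiv.commutes, map_one,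
    Module.algebraMap_end_apply, Algebra.smul_def, LinearMap.zero_apply]
  field_simp
  ring

theorem opT_X_T (q : k) (i : Fin m) :
    opT q i * Algebra.lmul k _ (xF k i.castSucc) * opT q i =
      algebraMap k _ q * Algebra.lmul k _ (xF k i.succ) := by
  ext1 f
  have h := xF_sub_ne_zero (k := k) (castSucc_ne_succ' i)
  have h' := xF_sub_ne_zero (k := k) (castSucc_ne_succ' i).symm
  simp only [Module.End.mul_apply, Algebra.coe_lmul_eq_mul, LinearMap.mul_apply',
    opT_apply, map_add, map_mul, permF_sw_sw, coefA, coefB, map_div₀, map_sub, permF_xF,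
    Equiv.swap_apply_left, Equiv.swap_apply_right, AlgEquiv.commutes, map_one,
    Module.algebraMap_end_apply, Algebra.smul_def]
  field_simp
  ring

theorem opT_X_comm (q : k) {i : Fin m} {j : Fin (m + 1)} (h₁ : j ≠ i.castSucc) (h₂ : j ≠ i.succ) :
    opT q i * Algebra.lmul k _ (xF k j) = Algebra.lmul k _ (xF k j) * opT q i := by
  ext1 f
  simp only [Module.End.mul_apply, Algebra.coe_lmul_eq_mul, LinearMap.mul_apply', opT_apply,
    map_mul, permF_xF, Equiv.swap_apply_of_ne_of_ne h₁ h₂]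
  ring

theorem sw_commute {i j : Fin m} (h : (i : ℕ) + 1 < j ∨ (j : ℕ) + 1 < i) :
    sw i * sw j = sw j * sw i := by
  ext x
  simp only [sw, Equiv.Perm.mul_apply, Equiv.swap_apply_def]
  grind

theorem opT_comm (q : k) {i j : Fin m} (h : (i : ℕ) + 1 < j ∨ (j : ℕ) + 1 < i) :
    opT q i * opT q j = opT q j * opT q i := by
  ext1 f
  have e1 : sw i j.castSucc = j.castSucc :=
    Equiv.swap_apply_of_ne_of_ne (by simp [Fin.ext_iff]; omega)
    (by simp [Fin.ext_iff]; omega)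
  have e2 : sw i j.succ = j.succ :=
    Equiv.swap_apply_of_ne_of_ne (by simp [Fin.ext_iff]; omega)
    (by simp [Fin.ext_iff]; omega)
  have e3 : sw j i.castSucc = i.castSucc :=
    Equiv.swap_apply_of_ne_of_ne (by simp [Fin.ext_iff]; omega)
    (by simp [Fin.ext_iff]; omega)
  have e4 : sw j i.succ = i.succ :=
    Equiv.swap_apply_of_ne_of_ne (by simp [Fin.ext_iff]; omega)
    (by simp [Fin.ext_iff]; omega)
  simp only [Module.End.mul_apply, opT_apply, map_add, map_mul, ← permF_mul, sw_commute h, coefA,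
    coefB, map_div₀, map_sub, permF_xF, e1, e2, e3, e4, AlgEquiv.commutes, map_one]
  ring

theorem sw_braid {i j : Fin m} (h : (j : ℕ) = i + 1) :
    sw i * sw j * sw i = sw j * sw i * sw j := by
  ext x
  simp only [sw, Equiv.Perm.mul_apply, Equiv.swap_apply_def]
  grind

theorem opT_braid (q : k) {i j : Fin m} (h : (j : ℕ) = i + 1) :
    opT q i * opT q j * opT q i = opT q j * opT q i * opT q j := by
  ext1 f
  have hj : j.castSucc = i.succ := by grind
  have e1 : sw i j.succ = j.succ :=
    Equiv.swap_apply_of_ne_of_ne (by grind) (by grind)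
  have e2 : sw j i.castSucc = i.castSucc :=
    Equiv.swap_apply_of_ne_of_ne (by grind) (by grind)
  have e3 : sw j i.succ = j.succ := by rw [← hj]; exact Equiv.swap_apply_left _ _
  have e4 : sw j j.succ = i.succ := by rw [← hj]; exact Equiv.swap_apply_right _ _
  have n1 := xF_sub_ne_zero (k := k) (castSucc_ne_succ' i)
  have n2 := xF_sub_ne_zero (k := k) (show i.succ ≠ j.succ by grind)
  have n3 := xF_sub_ne_zero (k := k) (show i.castSucc ≠ j.succ by grind)
  have n1' := xF_sub_ne_zero (k := k) (castSucc_ne_succ' i).symm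
  have n2' := xF_sub_ne_zero (k := k) (show i.succ ≠ j.succ by grind).symm
  have n3' := xF_sub_ne_zero (k := k) (show i.castSucc ≠ j.succ by grind).symm
  have b := congrArg (fun σ => permF k σ f) (sw_braid h)
  simp only [permF_mul] at b
  simp only [Module.End.mul_apply, opT_apply, map_add, map_mul, permF_sw_sw, b, coefA,
    coefB, map_div₀, map_sub, permF_xF, hj, e1, e2, e3, e4, AlgEquiv.commutes, map_one,
    Equiv.swap_apply_left, Equiv.swap_apply_right]
  -- The permuted copies of f can be treated as independent variables.
  generalize permF k (sw i) (permF k (sw j) f) = f1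
  generalize permF k (sw j) (permF k (sw i) f) = f2
  generalize permF k (sw i) f = f3
  generalize permF k (sw j) f = f4
  field_simp
  ring

/-- The operators of the generators of `ℋ`. -/
def genOp (q : k) : Gen m → Module.End k (Frac k m)
  | .T i => opT q i
  | .X j => Algebra.lmul k _ (xF k j)
  | .Xinv j => Algebra.lmul k _ (xF k j)⁻¹

/-- The polynomial representation of `ℋ`, on rational functions. -/
def polyRep (q : k) (m : ℕ) : Hecke q m →ₐ[k] Module.End k (Frac k m) :=
  RingQuot.liftAlgHom k ⟨FreeAlgebra.lift k (genOp q), by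
    intro x y h
    induction h with
    | quad i => simpa [genOp] using opT_quad q i
    | comm i j h => simpa [genOp] using opT_comm q h
    | braid i j h => simpa [genOp] using opT_braid q h
    | mul_inv j =>
      simp only [map_mul, FreeAlgebra.lift_ι_apply, genOp, map_one]
      rw [← map_mul, mul_inv_cancel₀ (xF_ne_zero j), map_one]
    | inv_mul j =>
      simp only [map_mul, FreeAlgebra.lift_ι_apply, genOp, map_one]
      rw [← map_mul, inv_mul_cancel₀ (xF_ne_zero j), map_one]
    | X_comm i j =>
      simp only [map_mul, FreeAlgebra.lift_ι_apply, genOp]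
      rw [← map_mul, mul_comm, map_mul]
    | T_X_comm i j h₁ h₂ => simpa [genOp] using opT_X_comm q h₁ h₂
    | T_X_T i => simpa [genOp] using opT_X_T q i⟩

theorem polyRep_toHecke (q : k) (x : FreeAlgebra k (Gen m)) :
    polyRep q m (toHecke q m x) = FreeAlgebra.lift k (genOp q) x :=
  RingQuot.liftAlgHom_mkAlgHom_apply _ _ _ _

theorem polyRep_T (q : k) (i : Fin m) : polyRep q m (T q i) = opT q i := by
  rw [T, polyRep_toHecke, FreeAlgebra.lift_ι_apply]; rfl

theorem polyRep_X (q : k) (j : Fin (m + 1)) :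
    polyRep q m (XH q j : (Hecke q m)ˣ) = Algebra.lmul k _ (xF k j) := by
  change polyRep q m (toHecke q m _) = _
  rw [polyRep_toHecke, FreeAlgebra.lift_ι_apply]; rfl

end Hecke

/-! ### Bernstein's relation and the identification of ℋ/U with Laurent polynomials. -/

section Hecke

variable {k : Type*} [Field k]

theorem toHecke_surjective (q : k) (m : ℕ) : Function.Surjective (toHecke q m) :=
  RingQuot.mkAlgHom_surjective k (Rel q m)

theorem hecke_induction {q : k} {P : Hecke q m → Prop}
    (algebraMap : ∀ c, P (algebraMap k _ c)) (T : ∀ i, P (T q i))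
    (X : ∀ j, P (XH q j : (Hecke q m)ˣ)) (Xinv : ∀ j, P ((XH q j)⁻¹ : (Hecke q m)ˣ))
    (add : ∀ x y, P x → P y → P (x + y)) (mul : ∀ x y, P x → P y → P (x * y)) (x : Hecke q m) :
    P x := by
  obtain ⟨x, rfl⟩ := toHecke_surjective q m x
  induction x using FreeAlgebra.induction with
  | grade0 c => rw [AlgHom.commutes]; exact algebraMap c
  | grade1 g => cases g with
    | T i => exact T i
    | X j => exact X j
    | Xinv j => exact Xinv j
  | mul x y hx hy => rw [map_mul]; exact mul _ _ hx hy
  | add x y hx hy => rw [map_add]; exact add _ _ hx hy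

theorem latticeToHecke_mulSingle (q : k) (j : Fin (m + 1)) :
    latticeToHecke q m (Pi.mulSingle j (Multiplicative.ofAdd 1)) = XH q j := by
  refine (MonoidHom.noncommPiCoprod_mulSingle _ j _).trans ?_
  simp [zpowersHom_apply]

theorem laurentToHecke_single (q : k) (a : Lattice m) (c : k) :
    laurentToHecke q m (MonoidAlgebra.single a c) = c • (latticeToHecke q m a : Hecke q m) :=
  MonoidAlgebra.lift_single _ _ _

theorem laurentToHecke_xL (q : k) (j : Fin (m + 1)) :
    laurentToHecke q m (xL k j) = (XH q j : (Hecke q m)ˣ) := by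
  rw [xL, laurentToHecke_single, latticeToHecke_mulSingle, one_smul]

/-- An induction principle for Laurent polynomials. -/
theorem laurent_induction {P : Laurent k m → Prop} (x : ∀ j, P (xL k j))
    (inv : ∀ f g, f * g = 1 → P f → P g) (smul : ∀ (c : k) f, P f → P (c • f))
    (add : ∀ f g, P f → P g → P (f + g)) (mul : ∀ f g, P f → P g → P (f * g))
    (f : Laurent k m) : P f := by
  have one : P 1 := by
    have hinv : xL k 0 * MonoidAlgebra.single (Pi.mulSingle 0 (Multiplicative.ofAdd 1) : Lattice m)⁻¹ 1 =
        (1 : Laurent k m) := by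
      rw [xL, MonoidAlgebra.single_mul_single, mul_inv_cancel, one_mul]; rfl
    have := mul _ _ (x 0) (inv _ _ hinv (x 0))
    rwa [hinv] at this
  have mon : ∀ a : Lattice m, P (MonoidAlgebra.single a 1) := fun a => by
    have ha : a ∈ Subgroup.closure
        (Set.range fun j => (Pi.mulSingle j (Multiplicative.ofAdd 1) : Lattice m)) := by
      rw [closure_mulSingle]; trivial
    induction ha using Subgroup.closure_induction with
    | mem _ h => obtain ⟨j, rfl⟩ := h; exact x j
    | one => exact one
    | mul a b _ _ ha hb =>
      have := mul _ _ ha hb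
      rwa [MonoidAlgebra.single_mul_single, one_mul] at this
    | inv a _ ha =>
      refine inv _ _ ?_ ha
      rw [MonoidAlgebra.single_mul_single, mul_inv_cancel, one_mul]; rfl
  induction f using MonoidAlgebra.induction_linear with
  | zero => simpa using smul 0 1 one
  | add f g hf hg => exact add f g hf hg
  | single a c => simpa using smul c _ (mon a)

/-- Bernstein's relation. -/
theorem bernstein {q : k} (hq : q ≠ 0) (i : Fin m) (f : Laurent k m) :
    ∃ g : Laurent k m,
      T q i * laurentToHecke q m f =
        laurentToHecke q m (permAct k (sw i) f) * T q i + laurentToHecke q m g ∧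
      (xL k i.succ - xL k i.castSucc) * g =
        (q - 1) • (xL k i.succ * (f - permAct k (sw i) f)) := by
  have hsw : ∀ f, permAct k (sw i) (permAct k (sw i) f) = f := fun f => by
    rw [← permAct_mul, Equiv.swap_mul_self, permAct_one]
  have hT : T q i * laurentToHecke q m (xL k i.castSucc) =
      laurentToHecke q m (xL k i.succ) * (T q i - (q - 1) • 1) := by
    have h1 : T q i * laurentToHecke q m (xL k i.castSucc) * T q i =
        laurentToHecke q m (xL k i.succ) * (T q i - (q - 1) • 1) * T q i := by
      rw [laurentToHecke_xL, laurentToHecke_xL, T_X_T, mul_assoc, sub_mul, smul_mul_assoc, one_mul,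
        T_mul_self, add_sub_cancel_left, Algebra.commutes]
    exact (TU hq i).isUnit.mul_right_cancel h1
  have hT' : T q i * laurentToHecke q m (xL k i.succ) =
      laurentToHecke q m (xL k i.castSucc) * T q i + (q - 1) • laurentToHecke q m (xL k i.succ) := by
    have h1 : T q i * (T q i * laurentToHecke q m (xL k i.castSucc) * T q i) =
      T q i * (algebraMap k _ q * laurentToHecke q m (xL k i.succ)) := by
        rw [laurentToHecke_xL, laurentToHecke_xL, T_X_T]
    rw [← Algebra.smul_def, mul_smul_comm] at h1
    have h2 : q • (T q i * laurentToHecke q m (xL k i.succ)) =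
      q • (laurentToHecke q m (xL k i.castSucc) * T q i +
        (q - 1) • laurentToHecke q m (xL k i.succ)) := by
      rw [← h1, mul_assoc, ← mul_assoc, T_mul_self, add_mul, smul_mul_assoc, ← mul_assoc (T q i),
        laurentToHecke_xL, laurentToHecke_xL, T_X_T, ← Algebra.smul_def, ← Algebra.smul_def,
        smul_add, smul_comm q (q - 1), add_comm]
    exact smul_right_injective _ hq h2
  -- The correction term g depends on f as a twisted derivation, g(f₁ f₂) = s_i(f₁) g(f₂) + g(f₁)
  -- f₂, so the variables are the only direct computation. The divided difference is kept in
  -- multiplied-out form, which still determines g in a domain.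
  induction f using laurent_induction with
  | x j =>
    rw [permAct_xL]
    by_cases h1 : j = i.castSucc
    · subst h1
      refine ⟨-((q - 1) • xL k i.succ), ?_, ?_⟩
      · rw [hT, Equiv.swap_apply_left, mul_sub, mul_smul_comm, mul_one, map_neg, map_smul,
          sub_eq_add_neg]
      · rw [Equiv.swap_apply_left, mul_neg, mul_smul_comm, ← smul_neg]; congr 1; ring
    by_cases h2 : j = i.succ
    · subst h2
      refine ⟨(q - 1) • xL k i.succ, ?_, ?_⟩
      · rw [hT', Equiv.swap_apply_right, map_smul]
      · rw [Equiv.swap_apply_right, mul_smul_comm]; congr 1; ring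
    · refine ⟨0, ?_, ?_⟩
      · rw [laurentToHecke_xL, T_X_comm q h1 h2, Equiv.swap_apply_of_ne_of_ne h1 h2,
          laurentToHecke_xL, map_zero, add_zero]
      · rw [Equiv.swap_apply_of_ne_of_ne h1 h2]; simp
  | inv f g hfg hf =>
    obtain ⟨f', h1, h2⟩ := hf
    have hs : permAct k (sw i) g * permAct k (sw i) f = 1 := by
      rw [← map_mul, mul_comm, hfg, map_one]
    have hs' : laurentToHecke q m (permAct k (sw i) g) * laurentToHecke q m (permAct k (sw i) f) =
      1 := by rw [← map_mul, hs, map_one]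
    have hfg' : laurentToHecke q m f * laurentToHecke q m g = 1 := by
      rw [← map_mul, hfg, map_one]
    -- The twisted Leibniz rule applied to g f = 1 forces this value.
    refine ⟨-(permAct k (sw i) g * f' * g), ?_, ?_⟩
    · have h3 := congrArg (fun x => laurentToHecke q m (permAct k (sw i) g) * x *
        laurentToHecke q m g) h1
      simp only [mul_add, add_mul] at h3
      rw [mul_assoc (T q i |> fun _ => laurentToHecke q m (permAct k (sw i) g)),
        mul_assoc (T q i), hfg', mul_one, ← mul_assoc _ _ (T q i), hs', one_mul] at h3
      rw [h3, map_neg, map_mul, map_mul]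
      abel
    · have h4 : (xL k i.succ - xL k i.castSucc) * -(permAct k (sw i) g * f' * g) =
          -((permAct k (sw i) g * g) * ((xL k i.succ - xL k i.castSucc) * f')) := by ring
      rw [h4, h2, mul_smul_comm, ← smul_neg]
      congr 1
      linear_combination (-xL k i.succ * permAct k (sw i) g) * hfg + (xL k i.succ * g) * hs
  | smul c f hf =>
    obtain ⟨g, h1, h2⟩ := hf
    refine ⟨c • g, ?_, ?_⟩
    · simp only [map_smul, mul_smul_comm, smul_mul_assoc, h1, smul_add]
    · rw [mul_smul_comm, h2, map_smul, ← smul_sub, mul_smul_comm, smul_comm]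
  | add f₁ f₂ hf₁ hf₂ =>
    obtain ⟨g₁, h1, h2⟩ := hf₁
    obtain ⟨g₂, h3, h4⟩ := hf₂
    refine ⟨g₁ + g₂, ?_, ?_⟩
    · simp only [map_add, mul_add, add_mul, h1, h3]; abel
    · rw [mul_add, h2, h4, ← smul_add, map_add]; congr 1; ring
  | mul f₁ f₂ hf₁ hf₂ =>
    obtain ⟨g₁, h1, h2⟩ := hf₁
    obtain ⟨g₂, h3, h4⟩ := hf₂
    refine ⟨permAct k (sw i) f₁ * g₂ + g₁ * f₂, ?_, ?_⟩
    · simp only [map_add, map_mul]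
      rw [← mul_assoc, h1, add_mul, mul_assoc, h3, mul_add]
      simp only [mul_assoc, add_assoc]
    · rw [map_mul, mul_add, mul_left_comm, h4, ← mul_assoc, h2, mul_smul_comm, smul_mul_assoc,
        ← smul_add]
      congr 1; ring

theorem polyRep_laurentToHecke (q : k) (f : Laurent k m) :
    polyRep q m (laurentToHecke q m f) = Algebra.lmul k _ (algebraMap _ (Frac k m) f) := by
  induction f using laurent_induction with
  | x j => rw [laurentToHecke_xL, polyRep_X]; rfl
  | inv f g hfg hf =>
    have h1 : polyRep q m (laurentToHecke q m g) * polyRep q m (laurentToHecke q m f) = 1 := by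
      rw [← map_mul, ← map_mul, mul_comm, hfg, map_one, map_one]
    rw [hf] at h1
    refine left_inv_eq_right_inv h1 ?_
    rw [← map_mul, ← map_mul, hfg, map_one, map_one]
  | smul c f hf =>
    rw [map_smul, map_smul, hf, Algebra.smul_def c f, map_mul,
      ← IsScalarTower.algebraMap_apply k (Laurent k m) (Frac k m), map_mul, AlgHom.commutes,
      ← Algebra.smul_def]
  | add f g hf hg => rw [map_add, map_add, hf, hg, map_add, map_add]
  | mul f g hf hg => rw [map_mul, map_mul, hf, hg, map_mul, map_mul]

theorem mulV_apply (q : k) (f : Laurent k m) :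
    mulV q m f = Submodule.Quotient.mk (laurentToHecke q m f) := rfl

/-- The coefficients satisfy A + B = q, so T_i · 1 = q, and x ↦ x · 1 factors through ℋ/U. -/
theorem polyRep_eq_zero_of_mem_U {q : k} {x : Hecke q m} (hx : x ∈ U q m) :
    polyRep q m x 1 = 0 := by
  induction hx using Submodule.span_induction with
  | mem x hx =>
    obtain ⟨i, rfl⟩ := hx
    have h := xF_sub_ne_zero (k := k) (castSucc_ne_succ' i).symm
    simp only [map_sub, polyRep_T, AlgHom.commutes, LinearMap.sub_apply, opT_apply, map_one,
      mul_one, Module.algebraMap_end_apply, coefA, coefB, Algebra.smul_def]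
    field_simp
    ring
  | zero => simp
  | add x y _ _ hx hy => simp [hx, hy]
  | smul c x _ hx => rw [smul_eq_mul, map_mul, Module.End.mul_apply, hx, map_zero]

/-- Applying f v to the constant 1 in the polynomial representation recovers f. -/
theorem mulV_injective (q : k) (m : ℕ) : Function.Injective (mulV q m) := by
  rw [injective_iff_map_eq_zero]
  intro f hf
  rw [mulV_apply, Submodule.Quotient.mk_eq_zero] at hf
  have h := polyRep_eq_zero_of_mem_U hf
  rw [polyRep_laurentToHecke] at h
  simpa using h

theorem T_smul_mulV {q : k} (i : Fin m) {f g : Laurent k m}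
    (h : T q i * laurentToHecke q m f =
        laurentToHecke q m (permAct k (sw i) f) * T q i + laurentToHecke q m g) :
    T q i • mulV q m f = mulV q m (q • permAct k (sw i) f + g) := by
  rw [mulV_apply, mulV_apply, ← Submodule.Quotient.mk_smul, smul_eq_mul, h,
    Submodule.Quotient.eq, map_add, map_smul, add_sub_add_right_eq_sub]
  have h1 : laurentToHecke q m (permAct k (sw i) f) * T q i -
      q • laurentToHecke q m (permAct k (sw i) f) =
        laurentToHecke q m (permAct k (sw i) f) • (T q i - algebraMap k _ q) := by
    rw [smul_eq_mul, mul_sub, ← Algebra.commutes, Algebra.smul_def]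
  rw [h1]
  exact Submodule.smul_mem _ _ (Submodule.subset_span ⟨i, rfl⟩)

/-- By Bernstein's relation the image is stable under ℋ, and it contains the generator v. -/
theorem mulV_surjective {q : k} (hq : q ≠ 0) (m : ℕ) : Function.Surjective (mulV q m) := by
  have key : ∀ x : Hecke q m, ∀ f, ∃ g, x • mulV q m f = mulV q m g := by
    have hθ : ∀ f g, laurentToHecke q m f • mulV q m g = mulV q m (f * g) := fun f g => by
      rw [mulV_apply, mulV_apply, map_mul]; rfl
    have hinv : ∀ j, ∃ f : Laurent k m, laurentToHecke q m f = (↑(XH q j)⁻¹ : Hecke q m) :=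
      fun j => ⟨MonoidAlgebra.single (Pi.mulSingle j (Multiplicative.ofAdd 1) : Lattice m)⁻¹ 1, by
        rw [laurentToHecke_single, map_inv, latticeToHecke_mulSingle, one_smul]⟩
    intro x
    induction x using hecke_induction with
    | algebraMap c => exact fun f => ⟨c • f, by rw [map_smul, algebraMap_smul]⟩
    | T i =>
      intro f
      obtain ⟨g, h, -⟩ := bernstein hq i f
      exact ⟨_, T_smul_mulV i h⟩
    | X j => exact fun f => ⟨_, by rw [← laurentToHecke_xL, hθ]⟩
    | Xinv j =>
      obtain ⟨g, hg⟩ := hinv j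
      exact fun f => ⟨_, by rw [← hg, hθ]⟩
    | add x y hx hy =>
      intro f
      obtain ⟨g, hg⟩ := hx f
      obtain ⟨g', hg'⟩ := hy f
      exact ⟨g + g', by rw [add_smul, hg, hg', map_add]⟩
    | mul x y hx hy =>
      intro f
      obtain ⟨g, hg⟩ := hy f
      obtain ⟨g', hg'⟩ := hx g
      exact ⟨g', by rw [mul_smul, hg, hg']⟩
  intro x
  obtain ⟨x, rfl⟩ := Submodule.Quotient.mk_surjective _ x
  obtain ⟨g, hg⟩ := key x 1
  refine ⟨g, hg.symm.trans ?_⟩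
  rw [mulV_apply, map_one, ← Submodule.Quotient.mk_smul, smul_eq_mul, mul_one]

end Hecke

/-! ### The basis `X^λ T_w` of the Hecke algebra -/

section Hecke

variable {k : Type*} [Field k] {q r : k}

theorem inr_prod_sw (l : List (Fin m)) :
    (SemidirectProduct.inr (l.map sw).prod : W m) = (l.map s).prod := by
  rw [map_list_prod, List.map_map]; rfl

theorem inr_mem_parabolic (σ : Equiv.Perm (Fin (m + 1))) :
    (SemidirectProduct.inr σ : W m) ∈ parabolic Finset.univ := by
  refine (Submonoid.closure_le (S := (parabolic Finset.univ).toSubmonoid)).2 ?_ (inr_mem_closure σ)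
  rintro _ ⟨i, rfl⟩
  exact s_mem_parabolic (Finset.mem_univ i)

theorem exists_word_inr (hm : 1 ≤ m) (σ : Equiv.Perm (Fin (m + 1))) :
    ∃ l : List (Fin m), (SemidirectProduct.inr σ : W m) = (l.map s).prod ∧
      l.length = length (SemidirectProduct.inr σ : W m) := by
  obtain ⟨l, -, h⟩ := exists_word_parabolic hm (inr_mem_parabolic σ)
  exact ⟨l, h⟩

theorem Tw_prod_s (hr : r ≠ 0) (hq : q ≠ 0) (hm : 1 ≤ m) {l : List (Fin m)}
    (hl : l.length = length (l.map s).prod) : Tw q r (l.map s).prod = (l.map (T q)).prod := by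
  rw [Tw_eq hr hq hm (isExpr_map_succ l) (by simpa using hl)]
  simp [Function.comp_def, TAff_succ]

theorem coefA_ne_zero (q : k) (i : Fin m) : coefA q i ≠ 0 := by
  refine div_ne_zero ?_ (xF_sub_ne_zero (castSucc_ne_succ' i).symm)
  have h : xF k i.succ - algebraMap k _ q * xF k i.castSucc =
      algebraMap (Laurent k m) (Frac k m) (xL k i.succ - q • xL k i.castSucc) := by
    rw [map_sub, Algebra.smul_def, map_mul,
      ← IsScalarTower.algebraMap_apply k (Laurent k m) (Frac k m)]
    rfl
  rw [h]
  intro h0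
  rw [← map_zero (algebraMap (Laurent k m) (Frac k m))] at h0
  exact xL_sub_smul_ne_zero (castSucc_ne_succ' i).symm q
    (IsFractionRing.injective (Laurent k m) (Frac k m) h0)

theorem length_s_mul_le (hm : 1 ≤ m) (i : Fin m) (w : W m) :
    length (s i * w) ≤ length w + 1 := by
  have := length_mul_le hm (s i) w
  rw [length_s hm] at this
  omega

/-- The triangular expansion of `T_w` in terms of permutations of the variables. -/
theorem exists_expansion_word (hm : 1 ≤ m) (q : k) (l : List (Fin m))
    (hl : l.length = length (l.map s).prod) :
    ∃ c : Equiv.Perm (Fin (m + 1)) → Frac k m,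
      (∀ g, polyRep q m (l.map (T q)).prod g = ∑ u, c u * permF k u g) ∧
      c (l.map sw).prod ≠ 0 ∧
      ∀ u, c u ≠ 0 → u = (l.map sw).prod ∨ length (SemidirectProduct.inr u : W m) < l.length := by
  classical
  induction l with
  | nil =>
    refine ⟨Pi.single 1 1, fun g => ?_, ?_, fun u hu => ?_⟩
    · simp [Pi.single_apply, permF_one]
    · rw [List.map_nil, List.prod_nil, Pi.single_eq_same]; exact one_ne_zero
    · left
      by_contra h
      exact hu (Pi.single_eq_of_ne h _)
  | cons i l ih =>
    have hle := length_le (isExpr_map_succ l)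
    have hle' := length_s_mul_le hm i (l.map s).prod
    simp only [List.map_cons, List.prod_cons, List.length_cons, List.length_map] at hl hle ⊢
    obtain ⟨c, h1, h2, h3⟩ := ih (by omega)
    refine ⟨fun u => coefA q i * permF k (sw i) (c (sw i * u)) + coefB q i * c u, fun g => ?_,
      ?_, fun u hu => ?_⟩
    · rw [map_mul, Module.End.mul_apply, h1, polyRep_T, opT_apply, map_sum, Finset.mul_sum,
        Finset.mul_sum, ← Equiv.sum_comp (Equiv.mulLeft (sw i)), ← Finset.sum_add_distrib]
      refine Finset.sum_congr rfl fun u _ => ?_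
      simp only [map_mul, ← permF_mul, Equiv.coe_mulLeft, ← mul_assoc, Equiv.swap_mul_self, one_mul]
      ring
    -- The permutation s_i w is longer than w, so it is absent from the expansion for w. The new
    -- leading coefficient is therefore A · s_i(c w), with no contribution from B.
    · have h4 : c (sw i * (l.map sw).prod) = 0 := by
        by_contra h
        rcases h3 _ h with h5 | h5
        · rw [mul_eq_right, Equiv.swap_eq_one_iff] at h5
          exact castSucc_ne_succ' i h5
        · rw [map_mul, inr_prod_sw] at h5
          change length (s i * _) < _ at h5
          omega
      simp only [← mul_assoc, Equiv.swap_mul_self, one_mul, h4, mul_zero, add_zero]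
      exact mul_ne_zero (coefA_ne_zero q i) ((map_ne_zero_iff _ (permF k (sw i)).injective).2 h2)
    · by_cases hc : c u = 0
      · have hc' : c (sw i * u) ≠ 0 := fun h => hu (by simp [hc, h])
        rcases h3 _ hc' with h5 | h5
        · left; rw [← h5, ← mul_assoc, Equiv.swap_mul_self, one_mul]
        · right
          have h6 := length_s_mul_le hm i (SemidirectProduct.inr (sw i * u))
          rw [map_mul, ← mul_assoc] at h6
          change length (s i * s i * _) ≤ length (s i * _) + 1 at h6
          rw [map_mul] at h5
          change length (s i * _) < _ at h5
          rw [s_mul_self, one_mul] at h6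
          omega
      · right
        rcases h3 _ hc with h5 | h5
        · rw [h5, inr_prod_sw]; omega
        · omega

theorem exists_expansion (hr : r ≠ 0) (hq : q ≠ 0) (hm : 1 ≤ m) (σ : Equiv.Perm (Fin (m + 1))) :
    ∃ c : Equiv.Perm (Fin (m + 1)) → Frac k m,
      (∀ g, polyRep q m (Tw q r (SemidirectProduct.inr σ)) g = ∑ u, c u * permF k u g) ∧
      c σ ≠ 0 ∧ ∀ u, c u ≠ 0 → u = σ ∨
        length (SemidirectProduct.inr u : W m) < length (SemidirectProduct.inr σ : W m) := by
  obtain ⟨l, hl, hlen⟩ := exists_word_inr hm σ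
  have hσ : (l.map sw).prod = σ := by
    rw [← inr_prod_sw] at hl
    exact (SemidirectProduct.inr_injective hl).symm
  rw [hl] at hlen
  rw [hl, Tw_prod_s hr hq hm hlen, ← hlen, ← hσ]
  exact exists_expansion_word hm q l hlen

/-- The element `∑_w f_w T_w` of `ℋ`, the sum being over the finite Weyl group. -/
def pbw (q r : k) (f : Equiv.Perm (Fin (m + 1)) → Laurent k m) : Hecke q m :=
  ∑ σ, laurentToHecke q m (f σ) * Tw q r (SemidirectProduct.inr σ)

theorem permAct_injective {σ τ : Equiv.Perm (Fin (m + 1))}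
    (h : ∀ f, permAct k σ f = permAct k τ f) : σ = τ := by
  ext j
  have := h (xL k j)
  rw [permAct_xL, permAct_xL] at this
  rw [xL_injective this]

/-- The permutation action, as a homomorphism from Laurent polynomials to rational functions. -/
def laurentHom (k : Type*) [Field k] (σ : Equiv.Perm (Fin (m + 1))) :
    Laurent k m →* Frac k m where
  toFun f := permF k σ (algebraMap _ _ f)
  map_one' := by rw [map_one, map_one]
  map_mul' f g := by rw [map_mul, map_mul]

theorem laurentHom_apply (σ : Equiv.Perm (Fin (m + 1))) (f : Laurent k m) :
    laurentHom k σ f = permF k σ (algebraMap _ _ f) := rfl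

theorem laurentHom_injective : Function.Injective (laurentHom (m := m) k) := fun σ τ h =>
  permAct_injective fun f => by
    have h2 := DFunLike.congr_fun h f
    rw [laurentHom_apply, laurentHom_apply, permF_algebraMap, permF_algebraMap] at h2
    exact IsFractionRing.injective (Laurent k m) (Frac k m) h2

theorem linearIndependent_laurentHom (k : Type*) [Field k] (m : ℕ) :
    LinearIndependent (Frac k m)
      (fun σ : Equiv.Perm (Fin (m + 1)) => (laurentHom k σ : Laurent k m → Frac k m)) :=
  (linearIndependent_monoidHom (Laurent k m) (Frac k m)).comp _ laurentHom_injective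

/-- Take σ of maximal length with f_σ ≠ 0. By triangularity only the term of σ contributes to the
permutation σ, with nonzero coefficient, contradicting Dedekind's independence of characters. This
gives both the independence of the X^λ T_w and the faithfulness of the representation. -/
theorem eq_zero_of_polyRep_pbw (hr : r ≠ 0) (hq : q ≠ 0) (hm : 1 ≤ m)
    {f : Equiv.Perm (Fin (m + 1)) → Laurent k m}
    (h : ∀ g : Laurent k m, polyRep q m (pbw q r f) (algebraMap _ _ g) = 0) : f = 0 := by
  classical
  choose c hc1 hc2 hc3 using exists_expansion (m := m) hr hq hm
  by_contra hf
  obtain ⟨σ₀, hσ₀⟩ := Function.ne_iff.1 hf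
  obtain ⟨σ, hσ, hmax⟩ := Finset.exists_max_image (Finset.univ.filter fun σ => f σ ≠ 0)
    (fun σ => length (SemidirectProduct.inr σ : W m)) ⟨σ₀, by simpa using hσ₀⟩
  have h1 : ∑ u, (∑ τ, algebraMap _ (Frac k m) (f τ) * c τ u) •
      (laurentHom k u : Laurent k m → Frac k m) = 0 := by
    funext g
    refine Eq.trans ?_ (h g)
    rw [pbw, map_sum, LinearMap.sum_apply, Finset.sum_apply]
    simp only [map_mul, polyRep_laurentToHecke, Module.End.mul_apply, hc1, Pi.smul_apply,
      smul_eq_mul, laurentHom_apply, Algebra.coe_lmul_eq_mul, LinearMap.mul_apply', Finset.mul_sum, Finset.sum_mul]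
    rw [Finset.sum_comm]
    simp only [mul_assoc]
  have h2 := Fintype.linearIndependent_iff.1 (linearIndependent_laurentHom k m) _ h1 σ
  rw [Finset.sum_eq_single σ] at h2
  · rcases mul_eq_zero.1 h2 with h3 | h3
    · rw [← map_zero (algebraMap (Laurent k m) (Frac k m))] at h3
      exact (Finset.mem_filter.1 hσ).2 (IsFractionRing.injective (Laurent k m) (Frac k m) h3)
    · exact hc2 σ h3
  · intro τ _ hτ
    by_contra h3
    obtain ⟨h4, h5⟩ := mul_ne_zero_iff.1 h3
    have h6 : f τ ≠ 0 := fun h => h4 (by rw [h, map_zero])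
    have h7 := hmax τ (by simpa using h6)
    rcases hc3 τ σ h5 with h8 | h8
    · exact hτ h8.symm
    · exact absurd h8 (not_lt.2 h7)
  · simp

theorem pbw_add (f g : Equiv.Perm (Fin (m + 1)) → Laurent k m) :
    pbw q r (f + g) = pbw q r f + pbw q r g := by
  simp only [pbw, Pi.add_apply, map_add, add_mul, Finset.sum_add_distrib]

theorem pbw_single [DecidableEq (Equiv.Perm (Fin (m + 1)))] (σ : Equiv.Perm (Fin (m + 1)))
    (f : Laurent k m) :
    pbw q r (Pi.single σ f) = laurentToHecke q m f * Tw q r (SemidirectProduct.inr σ) := by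
  rw [pbw, Finset.sum_eq_single σ]
  · simp
  · intro τ _ hτ; rw [Pi.single_eq_of_ne hτ, map_zero, zero_mul]
  · simp

theorem pbw_mul_left (f : Equiv.Perm (Fin (m + 1)) → Laurent k m) (g : Laurent k m) :
    laurentToHecke q m g * pbw q r f = pbw q r (fun σ => g * f σ) := by
  simp only [pbw, Finset.mul_sum, map_mul, mul_assoc]

theorem pbw_smul (f : Equiv.Perm (Fin (m + 1)) → Laurent k m) (c : k) :
    c • pbw q r f = pbw q r (c • f) := by
  simp only [pbw, Finset.smul_sum, Pi.smul_apply, map_smul, smul_mul_assoc]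

theorem pbw_injective (hr : r ≠ 0) (hq : q ≠ 0) (hm : 1 ≤ m) :
    Function.Injective (pbw q r : (Equiv.Perm (Fin (m + 1)) → Laurent k m) → Hecke q m) := by
  intro f g h
  rw [← sub_eq_zero]
  refine eq_zero_of_polyRep_pbw hr hq hm (r := r) (q := q) fun x => ?_
  have h1 : pbw q r (f - g) = 0 := by
    have h2 := pbw_add (q := q) (r := r) (f - g) g
    rw [sub_add_cancel, h] at h2
    simpa using h2
  rw [h1, map_zero, LinearMap.zero_apply]

/-! ### Spanning by X^λ T_w, faithfulness, and the solutions of x T_i = q x. -/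

section

variable (hr : r ≠ 0) (hq : q ≠ 0) (hm : 1 ≤ m)
include hr hq hm

theorem T_mul_Tw (i : Fin m) {w : W m} (h : ¬ Desc w⁻¹ i.succ) :
    T q i * Tw q r w = Tw q r (s i * w) := by
  rw [Tw_mul hr hq hm, Tw_s hr hq hm]
  have h1 := length_mul_sAff_of_not_desc hm h
  rw [← length_sAff_mul hm, length_inv hm, sAff_succ] at h1
  rw [h1, length_s hm, add_comm]

theorem Tw_mul_T (i : Fin m) {w : W m} (h : ¬ Desc w i.succ) :
    Tw q r w * T q i = Tw q r (w * s i) := by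
  rw [Tw_mul hr hq hm, Tw_s hr hq hm]
  have h1 := length_mul_sAff_of_not_desc hm h
  rw [sAff_succ] at h1
  rw [h1, length_s hm]

theorem T_mul_Tw_of_desc (i : Fin m) {w : W m} (h : Desc w⁻¹ i.succ) :
    T q i * Tw q r w = (q - 1) • Tw q r w + q • Tw q r (s i * w) := by
  have h1 : ¬ Desc (s i * w)⁻¹ i.succ := by
    rw [← sAff_succ, mul_inv_rev, sAff_inv hm, desc_mul_sAff_iff hm, not_not]; exact h
  have h2 := T_mul_Tw hr hq hm i h1
  rw [← mul_assoc, s_mul_self, one_mul] at h2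
  rw [← h2, ← mul_assoc, T_mul_self, add_mul, smul_mul_assoc, Algebra.smul_def q]

theorem Tw_mul_T_of_desc (i : Fin m) {w : W m} (h : Desc w i.succ) :
    Tw q r w * T q i = (q - 1) • Tw q r w + q • Tw q r (w * s i) := by
  have h1 : ¬ Desc (w * s i) i.succ := by
    rw [← sAff_succ, desc_mul_sAff_iff hm, not_not]; exact h
  have h2 := Tw_mul_T hr hq hm i h1
  rw [mul_assoc, s_mul_self, mul_one] at h2
  rw [← h2, mul_assoc, T_mul_self, mul_add, mul_smul_comm, ← Algebra.commutes, Algebra.smul_def q]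

/-- The range is a left ideal, since Bernstein's relation moves T_i past polynomials and T_i T_w
expands again; it contains 1. -/
theorem pbw_surjective :
    Function.Surjective (pbw q r : (Equiv.Perm (Fin (m + 1)) → Laurent k m) → Hecke q m) := by
  classical
  have hT : ∀ i (σ : Equiv.Perm (Fin (m + 1))) (f : Laurent k m), ∃ g, pbw q r g =
      laurentToHecke q m f * (T q i * Tw q r (SemidirectProduct.inr σ)) := by
    intro i σ f
    have hs : (s i * SemidirectProduct.inr σ : W m) = SemidirectProduct.inr (sw i * σ) := by
      rw [map_mul]; rfl
    by_cases h : Desc (SemidirectProduct.inr σ : W m)⁻¹ i.succ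
    · rw [T_mul_Tw_of_desc hr hq hm i h, hs]
      refine ⟨Pi.single σ ((q - 1) • f) + Pi.single (sw i * σ) (q • f), ?_⟩
      rw [pbw_add, pbw_single, pbw_single, map_smul, map_smul]
      simp only [mul_add, mul_smul_comm, smul_mul_assoc]
    · rw [T_mul_Tw hr hq hm i h, hs]
      exact ⟨_, pbw_single _ _⟩
  have hinv : ∀ j, ∃ f : Laurent k m, laurentToHecke q m f = ((XH q j)⁻¹ : (Hecke q m)ˣ) :=
    fun j => ⟨MonoidAlgebra.single (Pi.mulSingle j (Multiplicative.ofAdd 1) : Lattice m)⁻¹ 1, by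
      rw [laurentToHecke_single, map_inv, latticeToHecke_mulSingle, one_smul]⟩
  have hsum : ∀ (ι : Type) (t : Finset ι) (x : ι → Hecke q m), (∀ i ∈ t, ∃ g, pbw q r g = x i) →
      ∃ g, pbw q r g = ∑ i ∈ t, x i := by
    intro ι t x hx
    induction t using Finset.induction_on with
    | empty => exact ⟨0, by simp [pbw]⟩
    | insert a t ha ih =>
      obtain ⟨g, hg⟩ := ih fun i hi => hx i (Finset.mem_insert_of_mem hi)
      obtain ⟨g', hg'⟩ := hx a (Finset.mem_insert_self a t)
      exact ⟨g' + g, by rw [pbw_add, hg, hg', Finset.sum_insert ha]⟩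
  have key : ∀ x : Hecke q m, ∀ f, ∃ g, pbw q r g = x * pbw q r f := by
    intro x
    induction x using hecke_induction with
    | algebraMap c => exact fun f => ⟨c • f, by rw [← pbw_smul, Algebra.smul_def]⟩
    | T i =>
      intro f
      rw [pbw, Finset.mul_sum]
      refine hsum _ _ _ fun σ _ => ?_
      obtain ⟨g, h, -⟩ := bernstein hq i (f σ)
      obtain ⟨g', hg'⟩ := hT i σ (permAct k (sw i) (f σ))
      refine ⟨g' + Pi.single σ g, ?_⟩
      rw [pbw_add, hg', pbw_single, ← mul_assoc, ← mul_assoc, h, add_mul]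
    | X j => exact fun f => ⟨_, by rw [← laurentToHecke_xL, pbw_mul_left]⟩
    | Xinv j =>
      obtain ⟨g, hg⟩ := hinv j
      exact fun f => ⟨_, by rw [← hg, pbw_mul_left]⟩
    | add x y hx hy =>
      intro f
      obtain ⟨g, hg⟩ := hx f
      obtain ⟨g', hg'⟩ := hy f
      exact ⟨g + g', by rw [pbw_add, hg, hg', add_mul]⟩
    | mul x y hx hy =>
      intro f
      obtain ⟨g, hg⟩ := hy f
      obtain ⟨g', hg'⟩ := hx g
      exact ⟨g', by rw [hg', hg, mul_assoc]⟩
  intro x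
  obtain ⟨g, hg⟩ := key x (Pi.single 1 1)
  refine ⟨g, ?_⟩
  rw [hg, pbw_single, map_one, map_one, Tw_one hr hq hm, mul_one, mul_one]

/-- The polynomial representation is faithful. -/
theorem eq_zero_of_polyRep {x : Hecke q m}
    (h : ∀ g : Laurent k m, polyRep q m x (algebraMap _ _ g) = 0) : x = 0 := by
  obtain ⟨f, rfl⟩ := pbw_surjective hr hq hm x
  rw [eq_zero_of_polyRep_pbw hr hq hm h]
  simp [pbw]

omit hr hq hm in
theorem v_univ : v q r (Finset.univ : Finset (Fin m)) =
    ∑ σ : Equiv.Perm (Fin (m + 1)), Tw q r (SemidirectProduct.inr σ) := by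
  have h : (parabolic (Finset.univ : Finset (Fin m)) : Set (W m)) =
      Set.range (SemidirectProduct.inr : Equiv.Perm (Fin (m + 1)) →* W m) := by
    refine Set.Subset.antisymm ?_ ?_
    · rw [← MonoidHom.coe_range]
      refine (Subgroup.closure_le _).2 ?_
      rintro _ ⟨i, _, rfl⟩
      exact ⟨_, rfl⟩
    · rintro _ ⟨σ, rfl⟩
      exact inr_mem_parabolic σ
  rw [v, h, finsum_mem_range SemidirectProduct.inr_injective, finsum_eq_sum_of_fintype]

omit hr hq hm in
theorem laurentToHecke_mul_v_univ (f : Laurent k m) :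
    laurentToHecke q m f * v q r Finset.univ = pbw q r fun _ => f := by
  rw [v_univ, pbw, Finset.mul_sum]

theorem laurentToHecke_mul_v_univ_injective :
    Function.Injective fun f : Laurent k m => laurentToHecke q m f * v q r Finset.univ := by
  intro f g h
  simp only [laurentToHecke_mul_v_univ] at h
  exact congrFun (pbw_injective hr hq hm h) 1

/-- Comparing coefficients of T_σ in x T_i = q x, for σ without descent i, gives f_{σ s_i} = f_σ.
Hence the coefficients do not depend on σ, and x = f v_𝕀. -/
theorem exists_eq_mul_v_univ {x : Hecke q m} (hx : ∀ i, x * T q i = q • x) :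
    ∃ f, x = laurentToHecke q m f * v q r Finset.univ := by
  classical
  obtain ⟨f, rfl⟩ := pbw_surjective hr hq hm x
  have hs : ∀ i (σ : Equiv.Perm (Fin (m + 1))),
      (SemidirectProduct.inr σ * s i : W m) = SemidirectProduct.inr (σ * sw i) := by
    intro i σ; rw [map_mul]; rfl
  have key : ∀ i (σ : Equiv.Perm (Fin (m + 1))),
      ¬ Desc (SemidirectProduct.inr σ : W m) i.succ → f (σ * sw i) = f σ := by
    intro i σ hσ
    -- The scalars α and β treat both cases of the product at once: T_τ T_i = β_τ T_τ + α_τ T_{τ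
    -- s_i}.
    set α : Equiv.Perm (Fin (m + 1)) → k :=
      fun τ => if Desc (SemidirectProduct.inr τ : W m) i.succ then q else 1 with hα
    set β : Equiv.Perm (Fin (m + 1)) → k :=
      fun τ => if Desc (SemidirectProduct.inr τ : W m) i.succ then q - 1 else 0 with hβ
    have h1 : ∀ τ : Equiv.Perm (Fin (m + 1)), Tw q r (SemidirectProduct.inr τ) * T q i =
        β τ • Tw q r (SemidirectProduct.inr τ) +
          α τ • Tw q r (SemidirectProduct.inr (τ * sw i)) := by
      intro τ
      by_cases hτ : Desc (SemidirectProduct.inr τ : W m) i.succ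
      · rw [Tw_mul_T_of_desc hr hq hm i hτ, hs]; simp [hα, hβ, hτ]
      · rw [Tw_mul_T hr hq hm i hτ, hs]; simp [hα, hβ, hτ]
    have h2 : pbw q r f * T q i =
        pbw q r (fun τ => β τ • f τ + α (τ * sw i) • f (τ * sw i)) := by
      simp only [pbw, Finset.sum_mul, mul_assoc, h1, mul_add, map_add, add_mul,
        Finset.sum_add_distrib, map_smul, mul_smul_comm, smul_mul_assoc]
      congr 1
      rw [← Equiv.sum_comp (Equiv.mulRight (sw i))]
      simp only [Equiv.coe_mulRight, mul_assoc, Equiv.swap_mul_self, mul_one]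
    rw [hx i, pbw_smul] at h2
    have h3 := congrFun (pbw_injective hr hq hm h2) σ
    have hσ' : Desc (SemidirectProduct.inr (σ * sw i) : W m) i.succ := by
      rw [← hs, ← sAff_succ, desc_mul_sAff_iff hm]; exact hσ
    simp only [Pi.smul_apply, hα, hβ, if_neg hσ, if_pos hσ', zero_smul, zero_add] at h3
    exact (smul_right_injective _ hq h3).symm
  have key' : ∀ i (σ : Equiv.Perm (Fin (m + 1))), f (σ * sw i) = f σ := by
    intro i σ
    by_cases hσ : Desc (SemidirectProduct.inr σ : W m) i.succ
    · have h : ¬ Desc (SemidirectProduct.inr (σ * sw i) : W m) i.succ := by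
        rw [← hs, ← sAff_succ, desc_mul_sAff_iff hm, not_not]; exact hσ
      have := key i _ h
      rw [mul_assoc, Equiv.swap_mul_self, mul_one] at this
      exact this.symm
    · exact key i σ hσ
  have hconst : ∀ σ, f σ = f 1 := by
    intro σ
    obtain ⟨l, hl, -⟩ := exists_word_inr hm σ
    rw [← inr_prod_sw] at hl
    rw [SemidirectProduct.inr_injective hl]
    induction l using List.reverseRecOn generalizing σ with
    | nil => simp
    | append_singleton l i ih =>
      simp only [List.map_append, List.map_cons, List.map_nil, List.prod_append, List.prod_cons,
        List.prod_nil, mul_one, key']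
      exact ih _ rfl
  refine ⟨f 1, ?_⟩
  rw [laurentToHecke_mul_v_univ]
  congr 1
  exact funext hconst

end

end Hecke

/-! ### The representation of the affine Schur algebra -/

section Hecke

variable {k : Type*} [Field k] {q r : k}

theorem permAct_sw_of_mem_Inv {J : Finset (Fin m)} {f : Laurent k m} (hf : f ∈ Inv k J) {j : Fin m}
    (hj : j ∈ J) : permAct k (sw j) f = f :=
  hf (s j) (s_mem_parabolic hj)

theorem mem_Inv_of_forall {J : Finset (Fin m)} {f : Laurent k m}
    (hf : ∀ j ∈ J, permAct k (sw j) f = f) : f ∈ Inv k J := by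
  intro w hw
  induction hw using Subgroup.closure_induction with
  | mem _ h => obtain ⟨j, hj, rfl⟩ := h; exact hf j hj
  | one => exact permAct_one f
  | mul x y _ _ hx hy => rw [SemidirectProduct.mul_right, permAct_mul, hy, hx]
  | inv x _ hx =>
    rw [SemidirectProduct.inv_right]
    conv_lhs => rw [← hx]
    rw [← permAct_mul, inv_mul_cancel, permAct_one]

theorem xL_sub_ne_zero (i : Fin m) : xL k i.succ - xL k i.castSucc ≠ 0 :=
  sub_ne_zero.2 fun h => castSucc_ne_succ' i (xL_injective h).symm

/-- For invariant f the correction term g in Bernstein's relation satisfies (X_{i+1} - X_i) g = 0 in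
a domain. -/
theorem T_commute_of_invariant (hq : q ≠ 0) {i : Fin m} {f : Laurent k m}
    (hf : permAct k (sw i) f = f) : Commute (laurentToHecke q m f) (T q i) := by
  obtain ⟨g, h1, h2⟩ := bernstein hq i f
  rw [hf, sub_self, mul_zero, smul_zero] at h2
  rw [hf, (mul_eq_zero.1 h2).resolve_left (xL_sub_ne_zero i), map_zero, add_zero] at h1
  exact h1.symm

theorem ofHom_single {J K : Finset (Fin m)}
    (φ : vIdeal q r J →ₗ[(Hecke q m)ᵐᵒᵖ] vIdeal q r K) (x : vIdeal q r J) :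
    ofHom φ (Pi.single J x) = Pi.single K (φ x) := by
  simp [ofHom]

section

variable (hr : r ≠ 0) (hq : q ≠ 0) (hm : 1 ≤ m)
include hr hq hm

theorem laurentToHecke_commute_v {J : Finset (Fin m)} {f : Laurent k m} (hf : f ∈ Inv k J) :
    Commute (laurentToHecke q m f) (v q r J) := by
  refine finsum_mem_induction (p := fun x => Commute (laurentToHecke q m f) x)
    (Commute.zero_right _) (fun _ _ hx hy => hx.add_right hy) fun w hw => ?_
  obtain ⟨l, hl, rfl, hlen⟩ := exists_word_parabolic hm hw
  rw [Tw_prod_s hr hq hm hlen]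
  refine Commute.list_prod_right _ _ fun x hx => ?_
  obtain ⟨i, hi, rfl⟩ := List.mem_map.1 hx
  exact T_commute_of_invariant hq (permAct_sw_of_mem_Inv hf (hl i hi))

theorem laurentToHecke_mul_v_univ_mem {J : Finset (Fin m)} {f : Laurent k m} (hf : f ∈ Inv k J) :
    laurentToHecke q m f * v q r Finset.univ ∈ vIdeal q r J := by
  obtain ⟨h, hh⟩ := exists_v_univ_eq hr hq hm J
  refine mem_vIdeal.2 ⟨laurentToHecke q m f * h, ?_⟩
  rw [hh, ← mul_assoc, (laurentToHecke_commute_v hr hq hm hf).eq, mul_assoc]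

/-- Left multiplication by T_j is the scalar q on v_J ℋ, so q s_j(f) + g = q f with g the correction
term in Bernstein's relation. Eliminating g gives (X_{j+1} - q X_j)(f - s_j f) = 0, whose first
factor is nonzero. -/
theorem mem_Inv_of_mul_v_univ_mem {J : Finset (Fin m)} {f : Laurent k m}
    (hf : laurentToHecke q m f * v q r Finset.univ ∈ vIdeal q r J) : f ∈ Inv k J := by
  refine mem_Inv_of_forall fun j hj => ?_
  obtain ⟨h, hh⟩ := mem_vIdeal.1 hf
  obtain ⟨g, h1, h2⟩ := bernstein hq j f
  have h3 : T q j * (laurentToHecke q m f * v q r Finset.univ) =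
      q • (laurentToHecke q m f * v q r Finset.univ) := by
    rw [hh, ← mul_assoc, T_mul_v hr hq hm hj, smul_mul_assoc]
  rw [← mul_assoc, h1, add_mul, mul_assoc, T_mul_v hr hq hm (Finset.mem_univ j), mul_smul_comm,
    ← smul_mul_assoc, ← smul_mul_assoc, ← add_mul] at h3
  have h4 : q • permAct k (sw j) f + g = q • f :=
    laurentToHecke_mul_v_univ_injective hr hq hm (by
      simpa only [map_add, map_smul] using h3)
  have h5 : (xL k j.succ - q • xL k j.castSucc) * (f - permAct k (sw j) f) = 0 := by
    rw [← eq_sub_iff_add_eq'] at h4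
    rw [h4] at h2
    simp only [Algebra.smul_def, map_sub, map_one] at h2 ⊢
    linear_combination h2
  exact (sub_eq_zero.1 ((mul_eq_zero.1 h5).resolve_left
    (xL_sub_smul_ne_zero (castSucc_ne_succ' j).symm q))).symm

/-- Modulo U every element is a Laurent polynomial f, and f ↦ f v_𝕀 is injective. So x ↦ x v_𝕀
identifies ℋ/U with ℋ v_𝕀. -/
theorem mem_U_iff {x : Hecke q m} : x ∈ U q m ↔ x * v q r Finset.univ = 0 := by
  have h1 : ∀ x ∈ U q m, x * v q r Finset.univ = 0 := fun x hx => by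
    induction hx using Submodule.span_induction with
    | mem _ hx =>
      obtain ⟨i, rfl⟩ := hx
      rw [sub_mul, T_mul_v hr hq hm (Finset.mem_univ i), Algebra.smul_def, sub_self]
    | zero => exact zero_mul _
    | add x y _ _ hx hy => rw [add_mul, hx, hy, add_zero]
    | smul c x _ hx => rw [smul_eq_mul, mul_assoc, hx, mul_zero]
  refine ⟨h1 x, fun hx => ?_⟩
  obtain ⟨f, hf⟩ := mulV_surjective hq m (Submodule.Quotient.mk x)
  rw [mulV_apply, Submodule.Quotient.eq] at hf
  have h2 := h1 _ hf
  rw [sub_mul, hx, sub_zero] at h2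
  have h3 : f = 0 := laurentToHecke_mul_v_univ_injective hr hq hm
    (h2.trans (by simp : (0 : Hecke q m) = laurentToHecke q m 0 * v q r Finset.univ))
  rw [h3, map_zero, zero_sub] at hf
  exact (Submodule.neg_mem_iff _).1 hf

theorem eq_zero_of_mul_v_univ {x : Hecke q m}
    (hx : ∀ g : Laurent k m, x * laurentToHecke q m g * v q r Finset.univ = 0) : x = 0 := by
  refine eq_zero_of_polyRep hr hq hm fun g => ?_
  have h := polyRep_eq_zero_of_mem_U ((mem_U_iff hr hq hm).2 (hx g))
  rw [map_mul, polyRep_laurentToHecke, Module.End.mul_apply] at h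
  simpa using h

/-- The embedding `f v^{(J)} ↦ f v_𝕀` of `ℙ(𝒮)` into `⨁_J v_J ℋ`. -/
def embPS : PS k m →ₗ[k] (∀ J : Finset (Fin m), vIdeal q r J) where
  toFun f J := ⟨laurentToHecke q m (f J) * v q r Finset.univ,
    laurentToHecke_mul_v_univ_mem hr hq hm (f J).2⟩
  map_add' f g := funext fun J => Subtype.ext <| by
    simp only [Pi.add_apply, Submodule.coe_add, map_add, add_mul]
  map_smul' c f := funext fun J => Subtype.ext <| by
    simp only [Pi.smul_apply, Submodule.coe_smul, map_smul, smul_mul_assoc, RingHom.id_apply,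
      Submodule.coe_smul_of_tower]

theorem embPS_apply (f : PS k m) (J : Finset (Fin m)) :
    (embPS hr hq hm f J : Hecke q m) = laurentToHecke q m (f J) * v q r Finset.univ := rfl

theorem embPS_injective : Function.Injective (embPS hr hq hm : PS k m → _) := by
  intro f g h
  funext J
  have h1 := congrArg (fun x : ∀ J : Finset (Fin m), vIdeal q r J => (x J : Hecke q m)) h
  exact Subtype.ext (laurentToHecke_mul_v_univ_injective hr hq hm h1)

theorem exists_embPS_eq {x : ∀ J : Finset (Fin m), vIdeal q r J}
    (hx : ∀ i J, (x J : Hecke q m) * T q i = q • (x J : Hecke q m)) :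
    ∃ f, embPS hr hq hm f = x := by
  choose f hf using fun J => exists_eq_mul_v_univ hr hq hm fun i => hx i J
  refine ⟨fun J => ⟨f J, mem_Inv_of_mul_v_univ_mem hr hq hm ?_⟩, funext fun J => Subtype.ext ?_⟩
  · rw [← hf]; exact (x J).2
  · exact (hf J).symm

/-- The scalar q is written as a right multiplication too, so that ℋᵐᵒᵖ-linearity alone carries the
equation through an element of 𝒮. -/
theorem mul_T_of_embPS (f : PS k m) (i : Fin m) :
    MulOpposite.op (T q i) • embPS hr hq hm f =
      MulOpposite.op (algebraMap k (Hecke q m) q) • embPS hr hq hm f := by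
  funext J
  refine Subtype.ext ?_
  change laurentToHecke q m (f J) * v q r Finset.univ * T q i =
    laurentToHecke q m (f J) * v q r Finset.univ * algebraMap k _ q
  rw [mul_assoc, v_mul_T hr hq hm (Finset.mem_univ i), ← Algebra.commutes, mul_smul_comm,
    Algebra.smul_def]

theorem exists_embPS_eq_apply (φ : Schur q r m) (f : PS k m) :
    ∃ g, embPS hr hq hm g = φ (embPS hr hq hm f) := by
  refine exists_embPS_eq hr hq hm fun i J => ?_
  have h := congrArg φ (mul_T_of_embPS hr hq hm f i)
  rw [map_smul, map_smul] at h
  have h' := congrArg (fun x : ∀ J : Finset (Fin m), vIdeal q r J => (x J : Hecke q m)) h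
  change (φ (embPS hr hq hm f) J : Hecke q m) * T q i =
    (φ (embPS hr hq hm f) J : Hecke q m) * algebraMap k _ q at h'
  rw [h', ← Algebra.commutes, Algebra.smul_def]

/-- The coefficients of the image of an element of `ℙ(𝒮)` under an element of `𝒮`. -/
def rhoFun (φ : Schur q r m) (f : PS k m) : PS k m :=
  Classical.choose (exists_embPS_eq_apply hr hq hm φ f)

theorem embPS_rhoFun (φ : Schur q r m) (f : PS k m) :
    embPS hr hq hm (rhoFun hr hq hm φ f) = φ (embPS hr hq hm f) :=
  Classical.choose_spec (exists_embPS_eq_apply hr hq hm φ f)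

/-- The representation of `𝒮` on `ℙ(𝒮)`. -/
def rho : Schur q r m →ₐ[k] Module.End k (PS k m) where
  toFun φ :=
    { toFun := rhoFun hr hq hm φ
      map_add' := fun f g => embPS_injective hr hq hm <| by
        simp only [map_add, embPS_rhoFun]
      map_smul' := fun c f => embPS_injective hr hq hm <| by
        simp only [map_smul, embPS_rhoFun, RingHom.id_apply, LinearMap.map_smul_of_tower] }
  map_one' := LinearMap.ext fun f => embPS_injective hr hq hm (embPS_rhoFun hr hq hm 1 f)
  map_mul' φ ψ := LinearMap.ext fun f => embPS_injective hr hq hm <| by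
    change embPS hr hq hm (rhoFun hr hq hm (φ * ψ) f) =
      embPS hr hq hm (rhoFun hr hq hm φ (rhoFun hr hq hm ψ f))
    rw [embPS_rhoFun, embPS_rhoFun, embPS_rhoFun]; rfl
  map_zero' := LinearMap.ext fun f => embPS_injective hr hq hm <| by
    change embPS hr hq hm (rhoFun hr hq hm 0 f) = embPS hr hq hm 0
    rw [embPS_rhoFun, map_zero]; rfl
  map_add' φ ψ := LinearMap.ext fun f => embPS_injective hr hq hm <| by
    change embPS hr hq hm (rhoFun hr hq hm (φ + ψ) f) =
      embPS hr hq hm (rhoFun hr hq hm φ f + rhoFun hr hq hm ψ f)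
    rw [map_add, embPS_rhoFun, embPS_rhoFun, embPS_rhoFun]; rfl
  commutes' c := LinearMap.ext fun f => embPS_injective hr hq hm <| by
    change embPS hr hq hm (rhoFun hr hq hm (algebraMap k _ c) f) = embPS hr hq hm (c • f)
    rw [embPS_rhoFun, map_smul]; rfl

theorem embPS_rho (φ : Schur q r m) (f : PS k m) :
    embPS hr hq hm (rho hr hq hm φ f) = φ (embPS hr hq hm f) :=
  embPS_rhoFun hr hq hm φ f

theorem embPS_single {J : Finset (Fin m)} (f : Inv k J) :
    embPS hr hq hm (single f) = Pi.single J
      (⟨laurentToHecke q m f * v q r Finset.univ,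
        laurentToHecke_mul_v_univ_mem hr hq hm f.2⟩ : vIdeal q r J) := by
  funext L
  refine Subtype.ext ?_
  rw [embPS_apply]
  by_cases h : L = J
  · subst h
    rw [Pi.single_eq_same, single, Pi.single_eq_same]
  · rw [Pi.single_eq_of_ne h, single, Pi.single_eq_of_ne h]
    simp

/-- For φ in the kernel, v_J g v_𝕀 satisfies the eigenvalue equations and so lies in the image of
ℙ(𝒮). Thus φ(v_J) g v_𝕀 = 0 for every g, and `eq_zero_of_mul_v_univ` kills each component of φ(v_J).
-/
theorem rho_injective : Function.Injective (rho hr hq hm : Schur q r m →ₐ[k] _) := by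
  rw [injective_iff_map_eq_zero]
  intro φ hφ
  have h0 : ∀ f, φ (embPS hr hq hm f) = 0 := fun f => by
    rw [← embPS_rho, hφ, LinearMap.zero_apply, map_zero]
  refine LinearMap.pi_ext fun J x => ?_
  obtain ⟨x, hx⟩ := x
  obtain ⟨h, rfl⟩ := mem_vIdeal.1 hx
  have hsingle : ∀ (h : Hecke q m) (hmem : v q r J * h ∈ vIdeal q r J),
      φ (Pi.single J (⟨v q r J * h, hmem⟩ : vIdeal q r J)) =
        MulOpposite.op h • φ (Pi.single J (vGen q r J)) := fun h hmem => by
    rw [← map_smul, ← Pi.single_smul]; rfl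
  suffices hv : φ (Pi.single J (vGen q r J)) = 0 by
    rw [hsingle, hv, smul_zero]; rfl
  funext K
  refine Subtype.ext ?_
  refine eq_zero_of_mul_v_univ hr hq hm fun g => ?_
  have hmem : v q r J * (laurentToHecke q m g * v q r Finset.univ) ∈ vIdeal q r J :=
    mem_vIdeal.2 ⟨_, rfl⟩
  obtain ⟨f, hf⟩ := exists_eq_mul_v_univ (q := q) hr hq hm
    (x := v q r J * (laurentToHecke q m g * v q r Finset.univ)) fun i => by
      rw [mul_assoc, mul_assoc, v_mul_T hr hq hm (Finset.mem_univ i), mul_smul_comm,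
        mul_smul_comm]
  have hfJ : f ∈ Inv k J := mem_Inv_of_mul_v_univ_mem hr hq hm (hf ▸ hmem)
  have h1 := h0 (single ⟨f, hfJ⟩)
  have h2 : (⟨laurentToHecke q m f * v q r Finset.univ,
      laurentToHecke_mul_v_univ_mem hr hq hm hfJ⟩ : vIdeal q r J) =
      ⟨v q r J * (laurentToHecke q m g * v q r Finset.univ), hmem⟩ := Subtype.ext hf.symm
  rw [embPS_single, h2, hsingle] at h1
  have h3 := congrArg (fun x : ∀ J : Finset (Fin m), vIdeal q r J => (x K : Hecke q m)) h1
  rw [mul_assoc]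
  exact h3

theorem rho_ofHom_single_of_ne {J K L : Finset (Fin m)}
    (φ : vIdeal q r J →ₗ[(Hecke q m)ᵐᵒᵖ] vIdeal q r K) (hL : L ≠ J) (f : Inv k L) :
    rho hr hq hm (ofHom φ) (single f) = 0 := by
  apply embPS_injective hr hq hm
  rw [embPS_rho, embPS_single, map_zero]
  simp [ofHom, Pi.single_eq_of_ne hL.symm]

/-- With v_𝕀 = v_J y and f commuting with v_J, linearity of φ gives φ(f v_𝕀) = φ(v_J) f y = h v_J f
y = h f v_𝕀. This equals g v_𝕀 with g invariant under W_K, and `mem_U_iff` turns the equality into g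
v = h f v in ℋ/U. -/
theorem exists_rho_ofHom_single {J K : Finset (Fin m)} {d : W m} (hd : d ∈ D K J)
    {φ : vIdeal q r J →ₗ[(Hecke q m)ᵐᵒᵖ] vIdeal q r K} (hφ : IsB d φ) (f : Inv k J) :
    ∃ g : Inv k K, rho hr hq hm (ofHom φ) (single f) = single g ∧
      mulV q m g = ∑ᶠ x ∈ DIn K ∅ (interConj K d J), (Tw q r x * Tw q r d) • mulV q m f := by
  set h := ∑ᶠ a ∈ DIn K ∅ (interConj K d J), Tw q r a * Tw q r d with hh
  have hφv : (φ (vGen q r J) : Hecke q m) = h * v q r J := hφ.trans (finsum_Tw_dcoset hr hq hm hd)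
  set x : vIdeal q r J := ⟨laurentToHecke q m f * v q r Finset.univ,
    laurentToHecke_mul_v_univ_mem hr hq hm f.2⟩ with hx
  have hφx : (φ x : Hecke q m) = h * laurentToHecke q m f * v q r Finset.univ := by
    obtain ⟨y, hy⟩ := exists_v_univ_eq hr hq hm J
    have hc := (laurentToHecke_commute_v hr hq hm f.2).eq
    have h1 : laurentToHecke q m f * v q r Finset.univ =
        v q r J * (laurentToHecke q m f * y) := by
      rw [hy, ← mul_assoc, hc, mul_assoc]
    have h2 : x = ⟨v q r J * (laurentToHecke q m f * y), mem_vIdeal.2 ⟨_, rfl⟩⟩ := Subtype.ext h1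
    rw [h2, hom_apply, hφv, mul_assoc, ← h1, mul_assoc]
  obtain ⟨g, hg⟩ := exists_eq_mul_v_univ (q := q) hr hq hm (x := (φ x : Hecke q m)) fun i => by
    rw [hφx, mul_assoc, v_mul_T hr hq hm (Finset.mem_univ i), mul_smul_comm]
  have hgK : g ∈ Inv k K := mem_Inv_of_mul_v_univ_mem hr hq hm (hg ▸ (φ x).2)
  refine ⟨⟨g, hgK⟩, embPS_injective hr hq hm ?_, ?_⟩
  · rw [embPS_rho, embPS_single, embPS_single, ofHom_single]
    congr 1
    exact Subtype.ext hg
  · have hsum : ∑ᶠ x ∈ DIn K ∅ (interConj K d J), (Tw q r x * Tw q r d) • mulV q m f =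
        h • mulV q m f := by
      rw [hh, ← (finite_DIn K (interConj K d J)).coe_toFinset, finsum_mem_coe_finset,
        finsum_mem_coe_finset, Finset.sum_smul]
    rw [hsum, mulV_apply, mulV_apply, ← Submodule.Quotient.mk_smul, Submodule.Quotient.eq,
      mem_U_iff hr hq hm, sub_mul, ← hg, hφx, smul_eq_mul, sub_self]

end

end Hecke

end

end AffSchur

theorem mainTheorem2
    (p a q : ℕ) (hp : p.Prime) (ha : 1 ≤ a) (hq : q = p ^ a)
    (k : Type*) [Field k] [IsAlgClosed k] (ℓ : ℕ) [CharP k ℓ] (hℓ : ℓ ≠ p)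
    (hqℓ : ¬ q ≡ 1 [MOD ℓ])
    (r : k) (hr : r ^ 2 = (q : k))
    (m : ℕ) (hm : 1 ≤ m) :
    Function.Bijective (AffSchur.mulV (q : k) m) ∧
    (∀ (J K : Finset (Fin m)), ∀ d ∈ AffSchur.D K J,
      ∃! φ : AffSchur.vIdeal (q : k) r J →ₗ[(AffSchur.Hecke (q : k) m)ᵐᵒᵖ]
          AffSchur.vIdeal (q : k) r K,
        AffSchur.IsB d φ) ∧
    ∃ ρ : AffSchur.Schur (q : k) r m →ₐ[k] Module.End k (AffSchur.PS k m),
      Function.Injective ρ ∧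
      ∀ (J K : Finset (Fin m)), ∀ d ∈ AffSchur.D K J,
        ∀ φ : AffSchur.vIdeal (q : k) r J →ₗ[(AffSchur.Hecke (q : k) m)ᵐᵒᵖ]
            AffSchur.vIdeal (q : k) r K,
          AffSchur.IsB d φ →
          (∀ L : Finset (Fin m), L ≠ J → ∀ f : AffSchur.Inv k L,
            ρ (AffSchur.ofHom φ) (AffSchur.single f) = 0) ∧
          ∀ f : AffSchur.Inv k J, ∃ g : AffSchur.Inv k K,
            ρ (AffSchur.ofHom φ) (AffSchur.single f) = AffSchur.single g ∧
            AffSchur.mulV (q : k) m g =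
              ∑ᶠ x ∈ AffSchur.DIn K ∅ (AffSchur.interConj K d J),
                (AffSchur.Tw (q : k) r x * AffSchur.Tw (q : k) r d) •
                  AffSchur.mulV (q : k) m f := by
  have hp0 : (p : k) ≠ 0 := fun h => by
    rcases (Nat.dvd_prime hp).1 ((CharP.cast_eq_zero_iff k ℓ p).1 h) with h1 | h1
    · exact CharP.char_ne_one k ℓ h1
    · exact hℓ h1
  have hq0 : (q : k) ≠ 0 := by
    rw [hq, Nat.cast_pow]
    exact pow_ne_zero a hp0
  have hr0 : r ≠ 0 := by
    rintro rfl
    exact hq0 (by rw [← hr, zero_pow two_ne_zero])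
  refine ⟨⟨AffSchur.mulV_injective _ m, AffSchur.mulV_surjective hq0 m⟩,
    fun J K d hd => AffSchur.existsUnique_isB hr0 hq0 hm hd,
    AffSchur.rho hr0 hq0 hm, AffSchur.rho_injective hr0 hq0 hm, fun J K d hd φ hφ =>
      ⟨fun L hL f => AffSchur.rho_ofHom_single_of_ne hr0 hq0 hm φ hL f,
        fun f => AffSchur.exists_rho_ofHom_single hr0 hq0 hm hd hφ f⟩⟩
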